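/- Let $k$ be a field of characteristic zero, $R=k[[t]]$, and let $G$ be a finitely generated torsion-free nilpotent group. A Malcev basis of $G$ is a tuple $x_1,\dots,x_d$ such that the subgroups $G_i=\langle x_i,\dots,x_d\rangle$ form a central series $G=G_1\ge G_2\ge\dots\ge G_{d+1}=1$ with each $G_i/G_{i+1}$ infinite cyclic; write ${\bf x}({\bf a})=x_1^{a_1}\cdots x_d^{a_d}$ for ${\bf a}\in\mathbb Z^d$. Then $G$ has a Malcev basis, and for every Malcev basis there are polynomials $\mu,\lambda$ over $\mathbb Q$ (Hall polynomials) with ${\bf x}({\bf a}){\bf x}({\bf b})={\bf x}(\mu({\bf a},{\bf b}))$ and ${\bf x}({\bf a})^m={\bf x}(\lambda({\bf a},m))$ for all ${\bf a},{\bf b}\in\mathbb Z^d$, $m\in\mathbb Z$. For a commutative $\mathbb Q$-algebra $A$ let $G^A$ be the group of formal elements ${\bf x}({\bf a})$, ${\bf a}\in A^d$, with product given by $\mu$ and with powers $g^r$ ($r\in A$) given by $\lambda$. There exist $n$ and an injective homomorphism $\rho$ of $G^{R}$ into the group of upper triangular $n\times n$ matrices over $R$ with $1$'s on the diagonal whose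 entries are polynomials over $\mathbb Q$ in the coordinates ${\bf a}$. Let $\rho$ be any such representation and let $\log U=\sum_{m\ge1}(-1)^{m+1}(U-1)^m/m$. Then $L_{\mathbb Q}=\log\rho(G^{\mathbb Q})$ is a Lie algebra over $\mathbb Q$ and ${\cal L}=\log\rho(G^{R})$ is a Lie algebra over $R$ under the matrix commutator, the natural map $R\otimes_{\mathbb Q}L_{\mathbb Q}\to{\cal L}$ is an isomorphism of $R$-Lie algebras, and $\log$ is a bijection from $G^{R}$ to ${\cal L}\cong L_{\mathbb Q}\otimes_{\mathbb Q} R$. Call a subgroup $H\le G^{R}$ $R$-closed if $h^r\in H$ for all $h\in H$, $r\in R$; say that an $R$-closed $H$ has finite codimension $n$ if $n$ is the maximal length of a chain $G^{R}=H_0\ge H_1\ge\dots\ge H_n=H$ of $R$-closed subgroups with $H_i$ of infinite index in $H_{i-1}$ for all $i\geq 1$. The codimension of an $R$-Lie subalgebra $M$ of $L_{\mathbb Q}\otimes R$ is $\dim_k\big((L_{\mathbb Q}\otimes R)/M\big)$. Then $H\mapsto\log H$ is a bijection from the set of $R$-closed subgroups of finite codimension in $G^{R}$ to the set of $R$-Lie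 subalgebras of finite codimension in $L_{\mathbb Q}\otimes R$. It preserves the codimension, and $H$ is normal in $G^{R}$ if and only if $\log H$ is an ideal of $L_{\mathbb Q}\otimes R$. -/

import Mathlib

open scoped TensorProduct PowerSeries

-- square matrices carry the commutator bracket
attribute [local instance] LieRing.ofAssociativeRing

/-- For `x : Fin d → G`, the subgroup generated by the `x j` with `i ≤ j` (indices from `0`). -/
def tailSubgroup {G : Type*} [Group G] {d : ℕ} (x : Fin d → G) (i : ℕ) : Subgroup G :=
  Subgroup.closure (x '' {j : Fin d | i ≤ (j : ℕ)})

/-- A Malcev basis of `G`: elements `x₀, …, x_{d-1}` such that the subgroups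
`Gᵢ = ⟨xᵢ, …, x_{d-1}⟩` form a central series `G = G₀ ≥ G₁ ≥ ⋯ ≥ G_d = 1` in which every factor
`Gᵢ / Gᵢ₊₁` (it is generated by the image of `xᵢ`) is infinite cyclic. -/
structure MalcevBasis (G : Type*) [Group G] (d : ℕ) where
  x : Fin d → G
  generates : tailSubgroup x 0 = ⊤
  central : ∀ i : Fin d, ⁅tailSubgroup x i, (⊤ : Subgroup G)⁆ ≤ tailSubgroup x (i + 1)
  infinite_cyclic : ∀ (i : Fin d) (m : ℤ), x i ^ m ∈ tailSubgroup x (i + 1) → m = 0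

namespace MalcevBasis

variable {G : Type*} [Group G] {d : ℕ}

/-- The element `x(a) = x₀ ^ a₀ ⋯ x_{d-1} ^ a_{d-1}`. -/
def elt (B : MalcevBasis G d) (a : Fin d → ℤ) : G :=
  (List.ofFn fun i => B.x i ^ a i).prod

theorem elt_injective (B : MalcevBasis G d) : Function.Injective B.elt := by
  intro a b hab
  have hmem : ∀ (i : ℕ) (c : Fin d → ℤ),
      (((List.finRange d).drop i).map fun j => B.x j ^ c j).prod ∈ tailSubgroup B.x i := by
    intro i c
    apply Subgroup.list_prod_mem
    intro y hy
    obtain ⟨j, hj, rfl⟩ := List.mem_map.1 hy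
    apply Subgroup.zpow_mem
    apply Subgroup.subset_closure
    refine ⟨j, ?_, rfl⟩
    obtain ⟨m, hm, rfl⟩ := List.mem_iff_getElem.1 hj
    simp
  have hprod : ∀ i : ℕ, i ≤ d →
      (∀ j : Fin d, (j : ℕ) < i → a j = b j) ∧
      (((List.finRange d).drop i).map fun j => B.x j ^ a j).prod =
      (((List.finRange d).drop i).map fun j => B.x j ^ b j).prod := by
    intro i
    induction i with
    | zero =>
      intro _
      refine ⟨fun j hj => absurd hj (Nat.not_lt_zero _), ?_⟩
      simpa [elt, List.ofFn_eq_map] using hab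
    | succ i ih =>
      intro hi
      obtain ⟨h1, h2⟩ := ih (by omega)
      have hdrop : (List.finRange d).drop i =
          (⟨i, by omega⟩ : Fin d) :: (List.finRange d).drop (i + 1) := by
        rw [List.drop_eq_getElem_cons (by simpa using hi)]
        simp
      rw [hdrop, List.map_cons, List.map_cons, List.prod_cons, List.prod_cons] at h2
      have hai := hmem (i + 1) a
      have hbi := hmem (i + 1) b
      generalize (((List.finRange d).drop (i + 1)).map fun j => B.x j ^ a j).prod = p at *
      generalize (((List.finRange d).drop (i + 1)).map fun j => B.x j ^ b j).prod = q at *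
      have h3 : B.x ⟨i, by omega⟩ ^ (-b ⟨i, by omega⟩ + a ⟨i, by omega⟩) = q * p⁻¹ := by
        rw [zpow_add, zpow_neg, eq_mul_inv_iff_mul_eq, mul_assoc, h2, inv_mul_cancel_left]
      have h4 := B.infinite_cyclic ⟨i, by omega⟩ (-b ⟨i, by omega⟩ + a ⟨i, by omega⟩) (by
        rw [h3]
        exact Subgroup.mul_mem _ hbi (Subgroup.inv_mem _ hai))
      have h5 : a ⟨i, by omega⟩ = b ⟨i, by omega⟩ := by omega
      refine ⟨fun j hj => ?_, ?_⟩
      · rcases Nat.lt_succ_iff_lt_or_eq.1 hj with h | h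
        · exact h1 j h
        · have : j = ⟨i, by omega⟩ := Fin.ext h
          rw [this, h5]
      · rw [h5] at h2
        exact mul_left_cancel h2
  funext j
  exact (hprod d le_rfl).1 j j.2

theorem elt_zero (B : MalcevBasis G d) : B.elt 0 = 1 := by
  simp [elt]

end MalcevBasis

/-- Hall polynomials of a Malcev basis: polynomials over `ℚ` that compute, on integral
coordinates, the product `x(a) x(b) = x(μ(a, b))` and the powers `x(a) ^ m = x(λ(a, m))`. -/
structure HallPolynomials {G : Type*} [Group G] {d : ℕ} (B : MalcevBasis G d) where
  μ : Fin d → MvPolynomial (Fin d ⊕ Fin d) ℚ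
  lam : Fin d → MvPolynomial (Fin d ⊕ Unit) ℚ
  mul_spec : ∀ a b : Fin d → ℤ, ∃ c : Fin d → ℤ, B.elt a * B.elt b = B.elt c ∧
    ∀ i, MvPolynomial.aeval (Sum.elim (fun j => (a j : ℚ)) (fun j => (b j : ℚ))) (μ i) = (c i : ℚ)
  pow_spec : ∀ (a : Fin d → ℤ) (m : ℤ), ∃ c : Fin d → ℤ, B.elt a ^ m = B.elt c ∧
    ∀ i, MvPolynomial.aeval (Sum.elim (fun j => (a j : ℚ)) (fun _ => (m : ℚ))) (lam i) = (c i : ℚ)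

namespace HallPolynomials

variable {G : Type*} [Group G] {d : ℕ} {B : MalcevBasis G d}

/-- The coordinates `μ(a, b)` over a `ℚ`-algebra. -/
noncomputable def mulCoord (P : HallPolynomials B) {A : Type*} [CommRing A] [Algebra ℚ A]
    (a b : Fin d → A) : Fin d → A :=
  fun i => MvPolynomial.aeval (Sum.elim a b) (P.μ i)

/-- The coordinates `λ(a, r)` over a `ℚ`-algebra. -/
noncomputable def powCoord (P : HallPolynomials B) {A : Type*} [CommRing A] [Algebra ℚ A]
    (a : Fin d → A) (r : A) : Fin d → A :=
  fun i => MvPolynomial.aeval (Sum.elim a (fun _ => r)) (P.lam i)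

theorem map_mulCoord (P : HallPolynomials B) {A A' : Type*} [CommRing A] [Algebra ℚ A]
    [CommRing A'] [Algebra ℚ A'] (f : A →ₐ[ℚ] A') (a b : Fin d → A) :
    f ∘ P.mulCoord a b = P.mulCoord (f ∘ a) (f ∘ b) := by
  funext i
  simp only [mulCoord, Function.comp_apply, ← Sum.comp_elim]
  exact MvPolynomial.comp_aeval_apply (Sum.elim a b) f (P.μ i)

theorem map_powCoord (P : HallPolynomials B) {A A' : Type*} [CommRing A] [Algebra ℚ A]
    [CommRing A'] [Algebra ℚ A'] (f : A →ₐ[ℚ] A') (a : Fin d → A) (r : A) :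
    f ∘ P.powCoord a r = P.powCoord (f ∘ a) (f r) := by
  funext i
  have : Sum.elim (f ∘ a) (fun _ : Unit => f r) = f ∘ Sum.elim a (fun _ => r) := by
    rw [Sum.comp_elim]; rfl
  simp only [powCoord, Function.comp_apply, this]
  exact MvPolynomial.comp_aeval_apply (Sum.elim a fun _ => r) f (P.lam i)

theorem elt_mulCoord (P : HallPolynomials B) (a b : Fin d → ℤ) :
    ∃ c : Fin d → ℤ, B.elt a * B.elt b = B.elt c ∧
      P.mulCoord (fun j => (a j : ℚ)) (fun j => (b j : ℚ)) = fun j => (c j : ℚ) := by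
  obtain ⟨c, h, hc⟩ := P.mul_spec a b
  exact ⟨c, h, funext hc⟩

theorem elt_powCoord (P : HallPolynomials B) (a : Fin d → ℤ) (m : ℤ) :
    ∃ c : Fin d → ℤ, B.elt a ^ m = B.elt c ∧
      P.powCoord (fun j => (a j : ℚ)) (m : ℚ) = fun j => (c j : ℚ) := by
  obtain ⟨c, h, hc⟩ := P.pow_spec a m
  exact ⟨c, h, funext hc⟩

/-- Polynomials over `ℚ` that agree at all integral points agree over every `ℚ`-algebra. -/
theorem aeval_eq_of_int {σ : Type*} {A : Type*} [CommRing A] [Algebra ℚ A]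
    {p q : MvPolynomial σ ℚ}
    (h : ∀ z : σ → ℤ, MvPolynomial.aeval (fun j => (z j : ℚ)) p =
      MvPolynomial.aeval (fun j => (z j : ℚ)) q) (v : σ → A) :
    MvPolynomial.aeval v p = MvPolynomial.aeval v q := by
  have hpq : p = q := by
    apply MvPolynomial.funext_set (fun _ => Set.range (Int.cast : ℤ → ℚ))
    · intro _
      exact Set.infinite_range_of_injective Int.cast_injective
    · intro y hy
      choose z hz using fun j => hy j (Set.mem_univ j)
      have hy' : y = fun j => (z j : ℚ) := funext fun j => (hz j).symm
      have := h z
      rw [MvPolynomial.aeval_eq_eval] at this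
      rw [hy']
      exact this
  rw [hpq]

theorem aeval_assoc (P : HallPolynomials B) {A : Type*} [CommRing A] [Algebra ℚ A]
    {X : Fin 3 → Fin d → MvPolynomial (Fin 3 × Fin d) ℚ} (hX : X = fun s j => MvPolynomial.X (s, j))
    (v : Fin 3 × Fin d → A) (i : Fin d) :
    MvPolynomial.aeval v (P.mulCoord (P.mulCoord (X 0) (X 1)) (X 2) i) =
      P.mulCoord (P.mulCoord (fun j => v (0, j)) (fun j => v (1, j))) (fun j => v (2, j)) i ∧
    MvPolynomial.aeval v (P.mulCoord (X 0) (P.mulCoord (X 1) (X 2)) i) =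
      P.mulCoord (fun j => v (0, j)) (P.mulCoord (fun j => v (1, j)) (fun j => v (2, j))) i := by
  have hX' : ∀ s, (MvPolynomial.aeval v : MvPolynomial _ ℚ →ₐ[ℚ] A) ∘ X s =
      fun j => v (s, j) := by
    intro s; funext j; simp [hX]
  constructor
  · rw [← hX', ← hX', ← hX', ← map_mulCoord, ← map_mulCoord]; rfl
  · rw [← hX', ← hX', ← hX', ← map_mulCoord, ← map_mulCoord]; rfl

theorem mulCoord_assoc (P : HallPolynomials B) {A : Type*} [CommRing A] [Algebra ℚ A]
    (a b c : Fin d → A) :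
    P.mulCoord (P.mulCoord a b) c = P.mulCoord a (P.mulCoord b c) := by
  obtain ⟨X, hX⟩ : ∃ X : Fin 3 → Fin d → MvPolynomial (Fin 3 × Fin d) ℚ,
    X = fun s j => MvPolynomial.X (s, j) := ⟨_, rfl⟩
  funext i
  let v : Fin 3 × Fin d → A := fun s => ![a, b, c] s.1 s.2
  have := aeval_eq_of_int (A := A) (p := P.mulCoord (P.mulCoord (X 0) (X 1)) (X 2) i)
    (q := P.mulCoord (X 0) (P.mulCoord (X 1) (X 2)) i) (by
      intro z
      have h1 := (P.aeval_assoc hX (fun s => (z s : ℚ)) i).1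
      have h2 := (P.aeval_assoc hX (fun s => (z s : ℚ)) i).2
      refine h1.trans (Eq.trans ?_ h2.symm)
      obtain ⟨e, he, he'⟩ := P.elt_mulCoord (fun j => z (0, j)) (fun j => z (1, j))
      obtain ⟨f, hf, hf'⟩ := P.elt_mulCoord (fun j => z (1, j)) (fun j => z (2, j))
      rw [he', hf']
      obtain ⟨g, hg, hg'⟩ := P.elt_mulCoord e (fun j => z (2, j))
      obtain ⟨h, hh, hh'⟩ := P.elt_mulCoord (fun j => z (0, j)) f
      rw [hg', hh']
      have : g = h := B.elt_injective (by rw [← hg, ← hh, ← he, ← hf, mul_assoc])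
      rw [this]) v
  have h1 := (P.aeval_assoc hX v i).1
  have h2 := (P.aeval_assoc hX v i).2
  exact h1.symm.trans (this.trans h2)

theorem aeval_zero_mul (P : HallPolynomials B) {A : Type*} [CommRing A] [Algebra ℚ A]
    (v : Fin d → A) (i : Fin d) :
    MvPolynomial.aeval v (P.mulCoord 0 (MvPolynomial.X : Fin d → MvPolynomial (Fin d) ℚ) i) =
      P.mulCoord 0 v i := by
  have := congrFun (P.map_mulCoord (MvPolynomial.aeval v) 0 MvPolynomial.X) i
  have h0 : (MvPolynomial.aeval v : MvPolynomial (Fin d) ℚ →ₐ[ℚ] A) ∘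
      (0 : Fin d → MvPolynomial (Fin d) ℚ) = 0 := by
    funext j; simp
  have hX : (MvPolynomial.aeval v : MvPolynomial (Fin d) ℚ →ₐ[ℚ] A) ∘ MvPolynomial.X = v := by
    funext j; simp
  rw [h0, hX] at this
  exact this

theorem zero_mulCoord (P : HallPolynomials B) {A : Type*} [CommRing A] [Algebra ℚ A]
    (a : Fin d → A) : P.mulCoord 0 a = a := by
  funext i
  have := aeval_eq_of_int (A := A) (q := MvPolynomial.X i)
    (p := P.mulCoord 0 (MvPolynomial.X : Fin d → MvPolynomial (Fin d) ℚ) i) (by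
      intro z
      refine (P.aeval_zero_mul (fun s => (z s : ℚ)) i).trans ?_
      obtain ⟨e, he, he'⟩ := P.elt_mulCoord 0 z
      have h0 : (fun j => (((0 : Fin d → ℤ) j : ℤ) : ℚ)) = 0 := by funext j; simp
      rw [h0] at he'
      rw [he', MvPolynomial.aeval_X]
      rw [B.elt_zero, one_mul] at he
      rw [B.elt_injective he]) a
  rw [← aeval_zero_mul, this, MvPolynomial.aeval_X]

theorem aeval_pow_mul (P : HallPolynomials B) {A : Type*} [CommRing A] [Algebra ℚ A]
    (v : Fin d → A) (i : Fin d) :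
    MvPolynomial.aeval v (P.mulCoord
      (P.powCoord (MvPolynomial.X : Fin d → MvPolynomial (Fin d) ℚ) (-1)) MvPolynomial.X i) =
      P.mulCoord (P.powCoord v (-1)) v i := by
  have := congrFun (P.map_mulCoord (MvPolynomial.aeval v)
    (P.powCoord (MvPolynomial.X : Fin d → MvPolynomial (Fin d) ℚ) (-1)) MvPolynomial.X) i
  have hX : (MvPolynomial.aeval v : MvPolynomial (Fin d) ℚ →ₐ[ℚ] A) ∘ MvPolynomial.X = v := by
    funext j; simp
  rw [map_powCoord, hX, map_neg, map_one] at this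
  exact this

theorem powCoord_mulCoord (P : HallPolynomials B) {A : Type*} [CommRing A] [Algebra ℚ A]
    (a : Fin d → A) : P.mulCoord (P.powCoord a (-1)) a = 0 := by
  funext i
  have := aeval_eq_of_int (A := A) (q := 0)
    (p := P.mulCoord
      (P.powCoord (MvPolynomial.X : Fin d → MvPolynomial (Fin d) ℚ) (-1)) MvPolynomial.X i) (by
      intro z
      refine (P.aeval_pow_mul (fun s => (z s : ℚ)) i).trans ?_
      obtain ⟨e, he, he'⟩ := P.elt_powCoord z (-1)
      have h0 : (((-1 : ℤ)) : ℚ) = -1 := by simp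
      rw [h0] at he'
      rw [he']
      obtain ⟨f, hf, hf'⟩ := P.elt_mulCoord e z
      rw [hf']
      have : f = 0 := B.elt_injective (by rw [← hf, ← he, B.elt_zero]; simp)
      simp [this]) a
  rw [← aeval_pow_mul, this, map_zero]
  rfl

/-- The underlying set of `G^A`: the formal elements `x(a)` with coordinates `a ∈ A^d`. -/
@[ext] structure Points (P : HallPolynomials B) (A : Type*) where
  coord : Fin d → A

variable {P : HallPolynomials B} {A : Type*} [CommRing A] [Algebra ℚ A]

theorem mulCoord_zero (P : HallPolynomials B) (a : Fin d → A) : P.mulCoord a 0 = a := by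
  have hassoc : ∀ a b c : Fin d → A,
      P.mulCoord (P.mulCoord a b) c = P.mulCoord a (P.mulCoord b c) := P.mulCoord_assoc
  have h1 := P.powCoord_mulCoord a
  have h2 := P.powCoord_mulCoord (P.powCoord a (-1))
  have h3 : P.mulCoord a (P.powCoord a (-1)) = 0 := by
    calc P.mulCoord a (P.powCoord a (-1))
        = P.mulCoord (P.mulCoord (P.powCoord (P.powCoord a (-1)) (-1)) (P.powCoord a (-1)))
            (P.mulCoord a (P.powCoord a (-1))) := by rw [h2, P.zero_mulCoord]
      _ = P.mulCoord (P.powCoord (P.powCoord a (-1)) (-1))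
            (P.mulCoord (P.mulCoord (P.powCoord a (-1)) a) (P.powCoord a (-1))) := by
          rw [hassoc, hassoc]
      _ = 0 := by rw [h1, P.zero_mulCoord, h2]
  rw [← h1, ← hassoc, h3, P.zero_mulCoord]

noncomputable instance : Mul (P.Points A) := ⟨fun g h => ⟨P.mulCoord g.coord h.coord⟩⟩

instance : One (P.Points A) := ⟨⟨0⟩⟩

noncomputable instance : Inv (P.Points A) := ⟨fun g => ⟨P.powCoord g.coord (-1)⟩⟩

/-- The group `G^A`: multiplication is given by the polynomials `μ`, the neutral element is `x(0)`
and inverses are the powers `g ^ (-1)`, given by the polynomials `λ`. -/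
noncomputable instance : Group (P.Points A) where
  mul_assoc g h l := Points.ext (P.mulCoord_assoc g.coord h.coord l.coord)
  one_mul g := Points.ext (P.zero_mulCoord g.coord)
  mul_one g := Points.ext (P.mulCoord_zero g.coord)
  inv_mul_cancel g := Points.ext (P.powCoord_mulCoord g.coord)

/-- The power `g ^ r ∈ G^A` for `g ∈ G^A` and `r ∈ A`, given by the polynomials `λ`. -/
noncomputable def Points.rpow (g : P.Points A) (r : A) : P.Points A :=
  ⟨P.powCoord g.coord r⟩

/-- A subgroup `H` of `G^A` is `A`-closed if `h ^ r ∈ H` for all `h ∈ H` and `r ∈ A`. -/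
def IsPowerClosed (H : Subgroup (P.Points A)) : Prop :=
  ∀ h ∈ H, ∀ r : A, h.rpow r ∈ H

/-- There is a chain `G^A = H₀ ≥ H₁ ≥ ⋯ ≥ Hₙ = H` of `A`-closed subgroups in which every
`Hᵢ₊₁` has infinite index in `Hᵢ` (Mathlib's `relIndex` is `0` exactly for infinite index). -/
def HasChain (H : Subgroup (P.Points A)) (n : ℕ) : Prop :=
  ∃ c : Fin (n + 1) → Subgroup (P.Points A),
    c 0 = ⊤ ∧ c (Fin.last n) = H ∧ (∀ i, IsPowerClosed (c i)) ∧
      ∀ i : Fin n, c i.succ ≤ c i.castSucc ∧ (c i.succ).relIndex (c i.castSucc) = 0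

/-- `H` has (finite) codimension `n` in `G^A`: the maximal length of such a chain is `n`. -/
def HasCodim (H : Subgroup (P.Points A)) (n : ℕ) : Prop :=
  IsGreatest {m | HasChain H m} n

/-- The value at `g ∈ G^A` of a matrix of polynomials over `ℚ` in the coordinates. -/
noncomputable def evalMatrix {n : ℕ} (ρ : Matrix (Fin n) (Fin n) (MvPolynomial (Fin d) ℚ))
    (g : P.Points A) : Matrix (Fin n) (Fin n) A :=
  ρ.map (MvPolynomial.aeval g.coord)

/-- `ρ` is a `ℚ`-rational embedding of `G^A` into the group of upper triangular `n × n` matrices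
over `A` with `1`'s on the diagonal. -/
structure IsUnipotentEmbedding (P : HallPolynomials B) (A : Type*) [CommRing A] [Algebra ℚ A]
    {n : ℕ} (ρ : Matrix (Fin n) (Fin n) (MvPolynomial (Fin d) ℚ)) : Prop where
  map_mul : ∀ g h : P.Points A, evalMatrix ρ (g * h) = evalMatrix ρ g * evalMatrix ρ h
  injective : Function.Injective (evalMatrix ρ : P.Points A → Matrix (Fin n) (Fin n) A)
  diag : ∀ (g : P.Points A) (i : Fin n), evalMatrix ρ g i i = 1
  upper : ∀ (g : P.Points A) (i j : Fin n), j < i → evalMatrix ρ g i j = 0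

/-- The logarithm `∑_{1 ≤ m < n} (-1)^(m+1) (U - 1)^m / m` of a unipotent upper triangular
`n × n` matrix `U` (for such `U` one has `(U - 1)^n = 0`). -/
noncomputable def unipotentLog {n : ℕ} (U : Matrix (Fin n) (Fin n) A) :
    Matrix (Fin n) (Fin n) A :=
  ∑ m ∈ Finset.Ico 1 n, ((-1 : ℚ) ^ (m + 1) / (m : ℚ)) • (U - 1) ^ m

/-- The map `log : G^A → M_n(A)` attached to a representation `ρ`. -/
noncomputable def logMap {n : ℕ} (ρ : Matrix (Fin n) (Fin n) (MvPolynomial (Fin d) ℚ))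
    (g : P.Points A) : Matrix (Fin n) (Fin n) A :=
  unipotentLog (evalMatrix ρ g)

end HallPolynomials

/-!
A maximal member of the set of isolated normal subgroups with a partial Malcev basis is the whole
group: modulo a proper one, a maximal cyclic central subgroup is isolated, since roots of central
elements of a torsion-free nilpotent group are central (`exists_malcevBasis`).

Hall polynomials exist because the maps `ℤ^σ → G` with polynomial coordinates are closed under
products, inverses, conjugation by powers and partial products; this is proved by descending
induction along the central series (`PolyMapsClosed`, `nonempty_hallPolynomials`). By centrality
`μ_i(a, b) = a_i + b_i + μ_i(a', b')`, where `a'`, `b'` keep only the coordinates before `i`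
(`HallPolynomials.mulCoord_eq_add`). Hence, for suitable weights of the variables, right
translations change a monomial by terms of smaller weight only, and they act on the polynomials of
bounded weight by unitriangular matrices (`HallPolynomials.exists_isUnipotentEmbedding`).

Now let `ρ` be any unitriangular representation. The group law becomes `log (exp x exp y)` on
logarithms. A weak form of the Baker–Campbell–Hausdorff formula is enough: in a Lie algebra of
nilpotent elements, `log (exp x exp y)` is `x + y` modulo any ideal that contains `⁅x, y⁆`
(`nilLog_exp_mul_exp_sub_mem`). So the exponentials of a Lie algebra form a group. Conversely, let
`h` be the set of logarithms of a group that is closed under rational powers, and `V` its span.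
Conjugation and a Vandermonde argument show that `V` is a Lie algebra, and successive approximation
along the series `[V, [V, …]]` shows `h = V` (`IsLogGroup.mem_of_mem_span`). Together with the
polynomial identity `log (g ^ r) = r log g`
(`HallPolynomials.IsUnipotentEmbedding.logMap_rpow`) this gives the bijection between power-closed
subgroups and Lie subalgebras, and in particular the Lie algebras `log ρ(G^ℚ)` and
`log ρ(G^{k⟦X⟧})`. The latter is the extension of scalars of the former, because the coefficients of
the polynomial map `a ↦ log ρ(x(a))` lie in `log ρ(G^ℚ)`
(`HallPolynomials.IsUnipotentEmbedding.range_matrixBaseChange`). Normal subgroups correspond to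
ideals since conjugation is the exponential of the adjoint action
(`HallPolynomials.IsUnipotentEmbedding.normal_iff`).

As for the codimension, a proper inclusion of power-closed subgroups automatically has infinite
index, so chains of subgroups are strict chains of Lie subalgebras. Let `T` be the nilpotent Lie
algebra over `k⟦X⟧`. If `T ⧸ M` is finite-dimensional over `k` and nonzero, there is an element
outside `M` whose brackets and whose multiple by `X` lie in `M`; adding it lowers the codimension by
one (`exists_finrank_quotient_eq_succ`). If `T ⧸ M` is infinite-dimensional, the subalgebras
`M + X^j T` decrease strictly, by Nakayama's lemma, so there are arbitrarily long chains
(`exists_hasLieChain_of_not_finiteDimensional`).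
-/

/-! ### Exponential and logarithm of nilpotent elements -/

section ExpLog

open Polynomial

/-- The logarithm `∑_{1 ≤ m < n} (-1)^(m+1) (u - 1)^m / m`, meaningful when `(u - 1)^n = 0`. -/
noncomputable def nilLog {S : Type*} [Ring S] [Module ℚ S] (n : ℕ) (u : S) : S :=
  ∑ m ∈ Finset.Ico 1 n, ((-1 : ℚ) ^ (m + 1) / (m : ℚ)) • (u - 1) ^ m

/-- The truncated exponential series `∑_{i < n} X^i / i!`. -/
noncomputable def truncExp (n : ℕ) : ℚ[X] := ∑ i ∈ Finset.range n, C ((i.factorial : ℚ)⁻¹) * X ^ i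

/-- The truncated logarithm series `∑_{1 ≤ m < n} (-1)^(m+1) X^m / m` of `1 + X`. -/
noncomputable def truncLog (n : ℕ) : ℚ[X] :=
  ∑ m ∈ Finset.Ico 1 n, C ((-1 : ℚ) ^ (m + 1) / (m : ℚ)) * X ^ m

/-- A polynomial without constant term whose derivative vanishes to order `m` vanishes to order
`m + 1`. -/
theorem X_pow_succ_dvd_of_derivative {f : ℚ[X]} {m : ℕ} (h0 : f.coeff 0 = 0)
    (h : X ^ m ∣ derivative f) : X ^ (m + 1) ∣ f := by
  rw [X_pow_dvd_iff] at h ⊢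
  intro d hd
  rcases d with _ | d
  · exact h0
  · have := h d (by omega)
    rw [coeff_derivative] at this
    have h1 : ((d : ℚ) + 1) ≠ 0 := by positivity
    exact (mul_eq_zero.1 this).resolve_right h1

theorem derivative_truncExp (m : ℕ) :
    derivative (truncExp (m + 1)) = truncExp (m + 1) - C ((m.factorial : ℚ)⁻¹) * X ^ m := by
  have h1 : derivative (truncExp (m + 1)) = truncExp m := by
    rw [truncExp, Finset.sum_range_succ', truncExp]
    simp only [derivative_add, derivative_sum, pow_zero, mul_one, derivative_C, add_zero]
    refine Finset.sum_congr rfl fun i _ => ?_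
    rw [derivative_C_mul_X_pow]
    congr 2
    rw [Nat.factorial_succ]
    have : ((i : ℚ) + 1) ≠ 0 := by positivity
    push_cast
    field_simp
  rw [h1, truncExp, truncExp, Finset.sum_range_succ, add_sub_cancel_right]

theorem derivative_truncLog (m : ℕ) :
    derivative (truncLog (m + 1)) * (1 + X) = 1 - (-X) ^ m := by
  have h1 : derivative (truncLog (m + 1)) = ∑ i ∈ Finset.range m, (-X) ^ i := by
    rw [truncLog, Finset.sum_Ico_eq_sum_range, derivative_sum]
    refine Finset.sum_congr (by simp) fun i _ => ?_
    rw [derivative_C_mul_X_pow, neg_pow (X : ℚ[X]), add_comm 1 i]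
    have : ((i : ℚ) + 1) ≠ 0 := by positivity
    have h2 : (-1 : ℚ) ^ (i + 1 + 1) / ((i + 1 : ℕ) : ℚ) * ((i + 1 : ℕ) : ℚ) = (-1) ^ i := by
      push_cast
      rw [div_mul_cancel₀ _ this, pow_add, pow_add]
      ring
    rw [h2]
    simp
  rw [h1]
  have := mul_neg_geom_sum (-X : ℚ[X]) m
  rw [sub_neg_eq_add] at this
  rw [mul_comm, this]

theorem X_dvd_truncExp_sub_one (m : ℕ) : X ∣ truncExp (m + 1) - 1 := by
  rw [X_dvd_iff, truncExp, Finset.sum_range_succ']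
  simp

theorem X_dvd_truncLog (n : ℕ) : X ∣ truncLog n := by
  refine Finset.dvd_sum fun i hi => ?_
  exact Dvd.dvd.mul_left (dvd_pow_self _ (by have := (Finset.mem_Ico.1 hi).1; omega)) _

/-- `log (exp X) = X` modulo `X ^ n`: both sides have the same derivative modulo `X ^ (n - 1)`. -/
theorem truncLog_comp_truncExp (n : ℕ) : X ^ n ∣ (truncLog n).comp (truncExp n - 1) - X := by
  rcases n with _ | m
  · simp
  have hX := X_dvd_truncExp_sub_one m
  apply X_pow_succ_dvd_of_derivative
  · rw [coeff_sub, coeff_X_zero, sub_zero]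
    have h2 : truncExp (m + 1) - 1 ∣ (truncLog (m + 1)).comp (truncExp (m + 1) - 1) := by
      obtain ⟨q, hq⟩ := X_dvd_truncLog (m + 1)
      rw [hq, mul_comp, X_comp]
      exact dvd_mul_right _ _
    exact X_dvd_iff.1 (hX.trans h2)
  · have h3 : derivative ((truncLog (m + 1)).comp (truncExp (m + 1) - 1) - X) =
        -(-(truncExp (m + 1) - 1)) ^ m - C ((m.factorial : ℚ)⁻¹) * X ^ m *
          (derivative (truncLog (m + 1))).comp (truncExp (m + 1) - 1) := by
      have h4 := congrArg (fun p => p.comp (truncExp (m + 1) - 1)) (derivative_truncLog m)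
      simp only [mul_comp, add_comp, one_comp, X_comp, sub_comp, pow_comp, neg_comp] at h4
      rw [derivative_sub, derivative_comp, derivative_sub, derivative_truncExp, derivative_one,
        derivative_X]
      linear_combination h4
    rw [h3]
    refine dvd_sub ?_ ?_
    · rw [dvd_neg]
      exact pow_dvd_pow_of_dvd ((dvd_neg).2 hX) m
    · exact Dvd.dvd.mul_right (dvd_mul_left _ _) _

/-- `exp (log (1 + X)) = 1 + X` modulo `X ^ n`. The difference `h` of the two sides satisfies
`(1 + X) h' = h` modulo `X ^ (n - 1)`, which forces it to vanish. -/
theorem truncExp_comp_truncLog (n : ℕ) : X ^ n ∣ (truncExp n).comp (truncLog n) - (1 + X) := by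
  rcases n with _ | m
  · simp
  have hX := X_dvd_truncLog (m + 1)
  set h := (truncExp (m + 1)).comp (truncLog (m + 1)) - (1 + X) with hh
  have h0 : h.coeff 0 = 0 := by
    obtain ⟨q, hq⟩ := X_dvd_truncExp_sub_one m
    have : h = X * (-1) + truncLog (m + 1) * q.comp (truncLog (m + 1)) := by
      rw [hh, eq_add_of_sub_eq hq]
      simp only [add_comp, mul_comp, X_comp, one_comp]
      ring
    rw [this]
    exact X_dvd_iff.1 (dvd_add (dvd_mul_right _ _) (Dvd.dvd.mul_right hX _))
  have hd : X ^ m ∣ (1 + X) * derivative h - h := by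
    obtain ⟨q, hq⟩ := hX
    have h4 := derivative_truncLog m
    have h5 : (1 + X) * derivative h - h = X ^ m * (-(-1) ^ m *
          ((truncExp (m + 1)).comp (truncLog (m + 1)) -
            C ((m.factorial : ℚ)⁻¹) * truncLog (m + 1) ^ m) -
          C ((m.factorial : ℚ)⁻¹) * q ^ m) := by
      rw [hh, derivative_sub, derivative_comp, derivative_truncExp, derivative_add, derivative_one,
        derivative_X, sub_comp, mul_comp, C_comp, pow_comp, X_comp]
      have h6 : truncLog (m + 1) ^ m = X ^ m * q ^ m := by rw [hq, mul_pow]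
      rw [neg_pow] at h4
      linear_combination (((truncExp (m + 1)).comp (truncLog (m + 1)) -
            C ((m.factorial : ℚ)⁻¹) * truncLog (m + 1) ^ m)) * h4 - C ((m.factorial : ℚ)⁻¹) * h6
    rw [h5]
    exact dvd_mul_right _ _
  -- `(1 + X) h' ≡ h` modulo `X ^ m`, so divisibility of `h` by `X ^ k` improves by one step
  have key : ∀ k ≤ m + 1, X ^ k ∣ h := by
    intro k
    induction k with
    | zero => intro _; simp
    | succ k ih =>
      intro hk
      have h1 := ih (by omega)
      have h2 : X ^ k ∣ (1 + X) * derivative h := by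
        have := dvd_add ((pow_dvd_pow X (show k ≤ m by omega)).trans hd) h1
        rwa [sub_add_cancel] at this
      have h3 : IsCoprime (X ^ k : ℚ[X]) (1 + X) :=
        IsCoprime.pow_left ⟨-1, 1, by ring⟩
      exact X_pow_succ_dvd_of_derivative h0 (h3.dvd_of_dvd_mul_left h2)
  exact key _ le_rfl

variable {S : Type*} [Ring S] [Algebra ℚ S]

theorem aeval_truncExp {x : S} {n : ℕ} (hx : x ^ n = 0) :
    aeval x (truncExp n) = IsNilpotent.exp x := by
  rw [IsNilpotent.exp_eq_sum hx, truncExp]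
  simp [Algebra.smul_def]

theorem aeval_truncLog (x : S) (n : ℕ) : aeval x (truncLog n) = nilLog n (1 + x) := by
  rw [nilLog, truncLog, add_sub_cancel_left]
  simp [Algebra.smul_def]

theorem aeval_eq_of_X_pow_dvd {x : S} {n : ℕ} (hx : x ^ n = 0) {p q : ℚ[X]}
    (h : X ^ n ∣ p - q) : aeval x p = aeval x q := by
  obtain ⟨r, hr⟩ := h
  rw [← sub_eq_zero, ← map_sub, hr, map_mul, map_pow, aeval_X, hx, zero_mul]

theorem nilLog_exp {x : S} {n : ℕ} (hx : x ^ n = 0) : nilLog n (IsNilpotent.exp x) = x := by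
  have h := aeval_eq_of_X_pow_dvd hx (truncLog_comp_truncExp n)
  rw [aeval_comp, aeval_X, map_sub, map_one, aeval_truncExp hx, aeval_truncLog] at h
  simpa using h

theorem nilLog_pow_eq_zero {u : S} {n : ℕ} (hu : (u - 1) ^ n = 0) : nilLog n u ^ n = 0 := by
  obtain ⟨q, hq⟩ := X_dvd_truncLog n
  have h := aeval_truncLog (u - 1) n
  rw [add_sub_cancel] at h
  rw [← h, hq, ← map_pow, mul_pow, map_mul, map_pow, aeval_X, hu, zero_mul]

theorem exp_nilLog {u : S} {n : ℕ} (hu : (u - 1) ^ n = 0) :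
    IsNilpotent.exp (nilLog n u) = u := by
  have h := aeval_eq_of_X_pow_dvd hu (truncExp_comp_truncLog n)
  have h1 := aeval_truncLog (u - 1) n
  rw [add_sub_cancel] at h1
  rw [aeval_comp, h1, aeval_truncExp (nilLog_pow_eq_zero hu)] at h
  simpa using h

theorem map_nilLog {S' F : Type*} [Ring S'] [Algebra ℚ S'] [FunLike F S S'] [RingHomClass F S S']
    (f : F) (n : ℕ) (u : S) : f (nilLog n u) = nilLog n (f u) := by
  simp [nilLog, map_sum, map_rat_smul]

end ExpLog

/-! ### Conjugation by exponentials and the derivative of the exponential -/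

section DerivExp

variable {S : Type*} [Ring S]

/-- The iterated commutator `ad(z)^i (y)`. -/
def adIter (z : S) (i : ℕ) (y : S) : S := (fun w => ⁅z, w⁆)^[i] y

@[simp] theorem adIter_zero (z y : S) : adIter z 0 y = y := rfl

theorem adIter_succ (z : S) (i : ℕ) (y : S) : adIter z (i + 1) y = ⁅z, adIter z i y⁆ :=
  Function.iterate_succ_apply' _ _ _

theorem adIter_succ' (z : S) (i : ℕ) (y : S) : adIter z (i + 1) y = adIter z i ⁅z, y⁆ :=
  Function.iterate_succ_apply _ _ _

theorem mul_adIter (z : S) (i : ℕ) (y : S) :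
    z * adIter z i y = adIter z (i + 1) y + adIter z i y * z := by
  rw [adIter_succ, Ring.lie_def, sub_add_cancel]

/-- Pascal's rule in the form used to expand `z ^ (k + 1) y` and `D (z ^ (k + 1))`. -/
theorem sum_choose_pascal (a : ℕ → S) (z : S) (k : ℕ) :
    ∑ p ∈ Finset.HasAntidiagonal.antidiagonal k,
        k.choose p.1 • ((a (p.1 + 1) + a p.1 * z) * z ^ p.2) =
      ∑ p ∈ Finset.HasAntidiagonal.antidiagonal (k + 1),
        (k + 1).choose p.1 • (a p.1 * z ^ p.2) := by
  rw [Finset.sum_antidiagonal_choose_succ_nsmul (fun i j => a i * z ^ j) k,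
    ← Finset.sum_add_distrib]
  refine Finset.sum_congr rfl fun p hp => ?_
  have : k.choose p.2 = k.choose p.1 := by
    rw [← Finset.HasAntidiagonal.mem_antidiagonal.1 hp, add_comm p.1 p.2, Nat.choose_symm_add]
  rw [this, add_mul, smul_add, mul_assoc, ← pow_succ', add_comm]

theorem pow_mul_eq_sum_adIter (z y : S) (k : ℕ) :
    z ^ k * y = ∑ p ∈ Finset.HasAntidiagonal.antidiagonal k,
      k.choose p.1 • (adIter z p.1 y * z ^ p.2) := by
  induction k with
  | zero => simp
  | succ k ih =>
    rw [← sum_choose_pascal (fun i => adIter z i y), pow_succ', mul_assoc, ih, Finset.mul_sum]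
    refine Finset.sum_congr rfl fun p _ => ?_
    rw [mul_smul_comm, ← mul_assoc, mul_adIter]

/-- The sequence `0, y, ad(z)(y), ad(z)^2(y), …`. -/
def adShift (z y : S) : ℕ → S
  | 0 => 0
  | i + 1 => adIter z i y

theorem adShift_zero (z y : S) : adShift z y 0 = 0 := rfl

theorem adShift_succ (z y : S) (i : ℕ) : adShift z y (i + 1) = adIter z i y := rfl

/-- A derivation of a power, with the iterated commutators of `z` moved to the left. -/
theorem derivation_pow_eq_sum_adIter (D : S →+ S) (hD : ∀ a b, D (a * b) = D a * b + a * D b)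
    (z : S) (k : ℕ) :
    D (z ^ k) = ∑ p ∈ Finset.HasAntidiagonal.antidiagonal k,
      k.choose p.1 • (adShift z (D z) p.1 * z ^ p.2) := by
  induction k with
  | zero =>
    have h : D 1 = 0 := by
      have := hD 1 1
      rw [one_mul, mul_one, one_mul] at this
      exact left_eq_add.1 this
    simp [h, adShift]
  | succ k ih =>
    rw [← sum_choose_pascal (adShift z (D z)), pow_succ', hD, ih, Finset.mul_sum]
    -- `z * a i = a (i + 1) + a i * z` holds for `i ≥ 1`; at `i = 0` the defect is `D z`
    rcases k with _ | k
    · simp [adShift]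
    rw [Finset.Nat.sum_antidiagonal_succ, Finset.Nat.sum_antidiagonal_succ]
    simp only [adShift, zero_mul, smul_zero, mul_zero, zero_add, add_zero, adIter_zero,
      Nat.choose_zero_right, one_smul]
    congr 1
    refine Finset.sum_congr rfl fun p _ => ?_
    rw [mul_smul_comm, ← mul_assoc, mul_adIter]

variable [Algebra ℚ S]

/-- The Cauchy product of `∑ a_i / i!` and `exp z`. -/
theorem sum_exp_coeff_eq_mul_exp (a : ℕ → S) {z : S} {n : ℕ} (hz : z ^ n = 0)
    (h : ∀ i j, n ≤ i + j → a i * z ^ j = 0) :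
    ∑ k ∈ Finset.range n, (k.factorial : ℚ)⁻¹ •
        ∑ p ∈ Finset.HasAntidiagonal.antidiagonal k, k.choose p.1 • (a p.1 * z ^ p.2) =
      (∑ i ∈ Finset.range n, (i.factorial : ℚ)⁻¹ • a i) * IsNilpotent.exp z := by
  rw [IsNilpotent.exp_eq_sum hz, Finset.sum_mul_sum, ← Finset.sum_product']
  have h1 : ∑ p ∈ Finset.range n ×ˢ Finset.range n,
      ((p.1.factorial : ℚ)⁻¹ • a p.1) * ((p.2.factorial : ℚ)⁻¹ • z ^ p.2) =
      ∑ p ∈ (Finset.range n ×ˢ Finset.range n).filter (fun p => p.1 + p.2 < n),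
      ((p.1.factorial : ℚ)⁻¹ • a p.1) * ((p.2.factorial : ℚ)⁻¹ • z ^ p.2) := by
    symm
    apply Finset.sum_subset (Finset.filter_subset _ _)
    intro p hp hp'
    rw [smul_mul_smul_comm, h _ _ (by
      by_contra hlt
      exact hp' (Finset.mem_filter.2 ⟨hp, by omega⟩)), smul_zero]
  rw [h1]
  simp_rw [Finset.smul_sum]
  rw [Finset.sum_sigma']
  refine Finset.sum_bij' (fun x _ => x.2) (fun p _ => ⟨p.1 + p.2, p⟩) ?_ ?_ ?_ ?_ ?_
  · rintro ⟨k, p⟩ hp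
    simp only [Finset.mem_sigma, Finset.mem_range, Finset.HasAntidiagonal.mem_antidiagonal] at hp
    simp only [Finset.mem_filter, Finset.mem_product, Finset.mem_range]
    omega
  · rintro p hp
    simp only [Finset.mem_filter] at hp
    simpa using hp.2
  · rintro ⟨k, p⟩ hp
    simp only [Finset.mem_sigma, Finset.HasAntidiagonal.mem_antidiagonal] at hp
    obtain ⟨-, rfl⟩ := hp
    rfl
  · intros; rfl
  · rintro ⟨k, p⟩ hp
    simp only [Finset.mem_sigma, Finset.HasAntidiagonal.mem_antidiagonal] at hp
    obtain ⟨-, rfl⟩ := hp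
    rw [smul_mul_smul_comm, ← Nat.cast_smul_eq_nsmul ℚ, smul_smul]
    congr 1
    have h2 := Nat.add_choose_mul_factorial_mul_factorial p.1 p.2
    have h3 : ((p.1 + p.2).choose p.1 : ℚ) * p.1.factorial * p.2.factorial =
      (p.1 + p.2).factorial := by rw [Nat.choose_symm_add]; exact_mod_cast h2
    have h4 : ((p.1 + p.2).factorial : ℚ) ≠ 0 := by positivity
    have h5 : (p.1.factorial : ℚ) ≠ 0 := by positivity
    have h6 : (p.2.factorial : ℚ) ≠ 0 := by positivity
    dsimp only
    field_simp
    linarith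

section Filtration

variable {N : Submodule ℚ S}

theorem lie_mem_pow_add {i j : ℕ} {x y : S} (hx : x ∈ N ^ i) (hy : y ∈ N ^ j) :
    ⁅x, y⁆ ∈ N ^ (i + j) := by
  rw [Ring.lie_def]
  refine Submodule.sub_mem _ ?_ ?_
  · rw [pow_add]; exact Submodule.mul_mem_mul hx hy
  · rw [add_comm, pow_add]; exact Submodule.mul_mem_mul hy hx

theorem adIter_mem_pow {z y : S} (hz : z ∈ N) (hy : y ∈ N) (i : ℕ) :
    adIter z i y ∈ N ^ (i + 1) := by
  induction i with
  | zero => simpa using hy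
  | succ i ih =>
    rw [adIter_succ, add_comm]
    exact lie_mem_pow_add (by simpa using hz) ih

theorem eq_zero_of_mem_pow {n : ℕ} (hn : N ^ n = ⊥) {m : ℕ} (hm : n ≤ m) {x : S}
    (hx : x ∈ N ^ m) : x = 0 := by
  obtain ⟨l, rfl⟩ := Nat.exists_eq_add_of_le hm
  rw [pow_add, hn, Submodule.bot_mul] at hx
  exact hx

theorem pow_eq_zero_of_mem {n : ℕ} (hn : N ^ n = ⊥) {x : S} (hx : x ∈ N) : x ^ n = 0 :=
  eq_zero_of_mem_pow hn le_rfl (Submodule.pow_mem_pow N hx n)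

theorem isNilpotent_of_mem {n : ℕ} (hn : N ^ n = ⊥) {x : S} (hx : x ∈ N) : IsNilpotent x :=
  ⟨n, pow_eq_zero_of_mem hn hx⟩

theorem exp_mul_eq_sum_adIter {n : ℕ} (hn : N ^ n = ⊥) {z y : S} (hz : z ∈ N) (hy : y ∈ N) :
    IsNilpotent.exp z * y =
      (∑ i ∈ Finset.range n, (i.factorial : ℚ)⁻¹ • adIter z i y) * IsNilpotent.exp z := by
  have hz' := pow_eq_zero_of_mem hn hz
  rw [← sum_exp_coeff_eq_mul_exp (fun i => adIter z i y) hz', IsNilpotent.exp_eq_sum hz',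
    Finset.sum_mul]
  · simp_rw [smul_mul_assoc, pow_mul_eq_sum_adIter]
  · intro i j hij
    refine eq_zero_of_mem_pow hn (m := i + 1 + j) (by omega) ?_
    rw [pow_add]
    exact Submodule.mul_mem_mul (adIter_mem_pow hz hy i) (Submodule.pow_mem_pow N hz j)

/-- Conjugation by `exp z` is `exp (ad z)`. -/
theorem exp_mul_mul_exp_neg {n : ℕ} (hn : N ^ n = ⊥) {z y : S} (hz : z ∈ N) (hy : y ∈ N) :
    IsNilpotent.exp z * y * IsNilpotent.exp (-z) =
      ∑ i ∈ Finset.range n, (i.factorial : ℚ)⁻¹ • adIter z i y := by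
  rw [exp_mul_eq_sum_adIter hn hz hy, mul_assoc,
    IsNilpotent.exp_mul_exp_neg_self (isNilpotent_of_mem hn hz), mul_one]

/-- The derivative of the exponential: `D (exp z) = (∑ ad(z)^i (D z) / (i+1)!) exp z`. -/
theorem derivation_exp {n : ℕ} (hn : N ^ n = ⊥) (D : S →+ S)
    (hD : ∀ a b, D (a * b) = D a * b + a * D b) {z : S} (hz : z ∈ N) (hDz : D z ∈ N) :
    D (IsNilpotent.exp z) =
      (∑ i ∈ Finset.range n, ((i + 1).factorial : ℚ)⁻¹ • adIter z i (D z)) *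
        IsNilpotent.exp z := by
  have hz' := pow_eq_zero_of_mem hn hz
  have h1 := sum_exp_coeff_eq_mul_exp (adShift z (D z)) (z := z) (n := n + 1)
    (by rw [pow_succ, hz', zero_mul]) (by
      intro i j hij
      rcases i with _ | i
      · simp [adShift]
      · refine eq_zero_of_mem_pow hn (m := i + 1 + j) (by omega) ?_
        rw [pow_add]
        exact Submodule.mul_mem_mul (adIter_mem_pow hz hDz i) (Submodule.pow_mem_pow N hz j))
  rw [Finset.sum_range_succ' (fun i => (i.factorial : ℚ)⁻¹ • adShift z (D z) i)] at h1
  simp only [adShift_zero, adShift_succ, smul_zero, add_zero] at h1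
  rw [← h1, IsNilpotent.exp_eq_sum (k := n + 1) (by rw [pow_succ, hz', zero_mul]), map_sum]
  refine Finset.sum_congr rfl fun k _ => ?_
  rw [map_rat_smul, derivation_pow_eq_sum_adIter D hD]

end Filtration

end DerivExp

/-! ### The Baker–Campbell–Hausdorff theorem for nilpotent associative algebras -/

section BCH

open Polynomial

variable {S : Type*} [Ring S]

theorem coeff_lie (f g : S[X]) (k : ℕ) :
    (⁅f, g⁆ : S[X]).coeff k =
      ∑ p ∈ Finset.HasAntidiagonal.antidiagonal k, ⁅f.coeff p.1, g.coeff p.2⁆ := by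
  rw [Ring.lie_def, coeff_sub, coeff_mul, coeff_mul,
    ← Finset.Nat.sum_antidiagonal_swap (f := fun p : ℕ × ℕ => g.coeff p.1 * f.coeff p.2),
    ← Finset.sum_sub_distrib]
  rfl

variable [Algebra ℚ S]

/-- The polynomials all of whose coefficients lie in `N`. -/
def polyCoeffMem (N : Submodule ℚ S) : Submodule ℚ S[X] where
  carrier := {f | ∀ k, f.coeff k ∈ N}
  add_mem' hf hg k := by rw [coeff_add]; exact N.add_mem (hf k) (hg k)
  zero_mem' k := by simp
  smul_mem' q f hf k := by rw [coeff_smul]; exact N.smul_mem q (hf k)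

theorem polyCoeffMem_mul_le (A B : Submodule ℚ S) :
    polyCoeffMem A * polyCoeffMem B ≤ polyCoeffMem (A * B) := by
  rw [Submodule.mul_le]
  intro f hf g hg k
  rw [coeff_mul]
  exact Submodule.sum_mem _ fun p _ => Submodule.mul_mem_mul (hf _) (hg _)

theorem polyCoeffMem_mono {A B : Submodule ℚ S} (h : A ≤ B) :
    polyCoeffMem A ≤ polyCoeffMem B := fun _ hf k => h (hf k)

theorem polyCoeffMem_pow_succ_le (N : Submodule ℚ S) (m : ℕ) :
    polyCoeffMem N ^ (m + 1) ≤ polyCoeffMem (N ^ (m + 1)) := by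
  induction m with
  | zero => simp
  | succ m ih =>
    rw [pow_succ, pow_succ N]
    exact (mul_le_mul' ih le_rfl).trans (polyCoeffMem_mul_le _ _)

theorem subsingleton_of_pow_zero_eq_bot {N : Submodule ℚ S} (hn : N ^ 0 = ⊥) : Subsingleton S := by
  have h1 : (1 : S) ∈ N ^ 0 := by
    rw [pow_zero]
    exact Submodule.one_le.1 le_rfl
  rw [hn] at h1
  exact subsingleton_of_zero_eq_one (Submodule.mem_bot ℚ |>.1 h1).symm

theorem polyCoeffMem_pow_eq_bot {N : Submodule ℚ S} {n : ℕ} (hn : N ^ n = ⊥) :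
    polyCoeffMem N ^ n = ⊥ := by
  rcases n with _ | n
  · have := subsingleton_of_pow_zero_eq_bot hn
    exact Subsingleton.elim _ _
  · rw [eq_bot_iff]
    refine (polyCoeffMem_pow_succ_le N n).trans ?_
    rw [hn]
    intro f hf
    exact Polynomial.ext fun k => by simpa using hf k

section Closed

variable {N : Submodule ℚ S}

theorem exp_sub_one_mem (hN : N * N ≤ N) {n : ℕ} (hn : N ^ n = ⊥) {x : S} (hx : x ∈ N) :
    IsNilpotent.exp x - 1 ∈ N := by
  have hpow : ∀ m, x ^ (m + 1) ∈ N := by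
    intro m
    induction m with
    | zero => simpa using hx
    | succ m ih => rw [pow_succ]; exact hN (Submodule.mul_mem_mul ih hx)
  rw [IsNilpotent.exp_eq_sum (k := n + 1) (by rw [pow_succ, pow_eq_zero_of_mem hn hx, zero_mul]),
    Finset.sum_range_succ']
  simp only [Nat.factorial_zero, Nat.cast_one, inv_one, pow_zero, one_smul, add_sub_cancel_right]
  exact Submodule.sum_mem _ fun m _ => N.smul_mem _ (hpow m)

theorem nilLog_mem (hN : N * N ≤ N) (n : ℕ) {u : S} (hu : u - 1 ∈ N) : nilLog n u ∈ N := by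
  have hpow : ∀ m, (u - 1) ^ (m + 1) ∈ N := by
    intro m
    induction m with
    | zero => simpa using hu
    | succ m ih => rw [pow_succ]; exact hN (Submodule.mul_mem_mul ih hu)
  refine Submodule.sum_mem _ fun m hm => N.smul_mem _ ?_
  obtain ⟨l, rfl⟩ := Nat.exists_eq_add_of_le' (Finset.mem_Ico.1 hm).1
  exact hpow l

theorem mul_sub_one_mem (hN : N * N ≤ N) {u v : S} (hu : u - 1 ∈ N) (hv : v - 1 ∈ N) :
    u * v - 1 ∈ N := by
  have : u * v - 1 = (u - 1) * (v - 1) + (u - 1) + (v - 1) := by noncomm_ring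
  rw [this]
  exact N.add_mem (N.add_mem (hN (Submodule.mul_mem_mul hu hv)) hu) hv

theorem exp_mul_exp_sub_one_mem (hN : N * N ≤ N) {n : ℕ} (hn : N ^ n = ⊥) {x y : S}
    (hx : x ∈ N) (hy : y ∈ N) : IsNilpotent.exp x * IsNilpotent.exp y - 1 ∈ N :=
  mul_sub_one_mem hN (exp_sub_one_mem hN hn hx) (exp_sub_one_mem hN hn hy)

theorem exp_nilLog_of_mem {n : ℕ} (hn : N ^ n = ⊥) {u : S} (hu : u - 1 ∈ N) :
    IsNilpotent.exp (nilLog n u) = u :=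
  exp_nilLog (pow_eq_zero_of_mem hn hu)

theorem nilLog_exp_of_mem {n : ℕ} (hn : N ^ n = ⊥) {x : S} (hx : x ∈ N) :
    nilLog n (IsNilpotent.exp x) = x :=
  nilLog_exp (pow_eq_zero_of_mem hn hx)

theorem exp_nilLog_exp_mul_exp (hN : N * N ≤ N) {n : ℕ} (hn : N ^ n = ⊥) {x y : S}
    (hx : x ∈ N) (hy : y ∈ N) :
    IsNilpotent.exp (nilLog n (IsNilpotent.exp x * IsNilpotent.exp y)) =
      IsNilpotent.exp x * IsNilpotent.exp y :=
  exp_nilLog_of_mem hn (exp_mul_exp_sub_one_mem hN hn hx hy)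

end Closed

/-- The coefficients of `f` in degrees below `k` lie in `J`. -/
def CoeffMemBelow (J : Submodule ℚ S) (k : ℕ) (f : S[X]) : Prop := ∀ i < k, f.coeff i ∈ J

namespace CoeffMemBelow

variable {M J : Submodule ℚ S} {k : ℕ} {f g : S[X]}

theorem add (hf : CoeffMemBelow J k f) (hg : CoeffMemBelow J k g) : CoeffMemBelow J k (f + g) :=
  fun i hi => by rw [coeff_add]; exact J.add_mem (hf i hi) (hg i hi)

theorem sub (hf : CoeffMemBelow J k f) (hg : CoeffMemBelow J k g) : CoeffMemBelow J k (f - g) :=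
  fun i hi => by rw [coeff_sub]; exact J.sub_mem (hf i hi) (hg i hi)

theorem smul (q : ℚ) (hf : CoeffMemBelow J k f) : CoeffMemBelow J k (q • f) :=
  fun i hi => by rw [coeff_smul]; exact J.smul_mem q (hf i hi)

theorem sum {ι : Type*} {s : Finset ι} {F : ι → S[X]} (h : ∀ i ∈ s, CoeffMemBelow J k (F i)) :
    CoeffMemBelow J k (∑ i ∈ s, F i) :=
  fun j hj => by rw [finsetSum_coeff]; exact J.sum_mem fun i hi => h i hi j hj

theorem mono (h : M ≤ J) (hf : CoeffMemBelow M k f) : CoeffMemBelow J k f :=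
  fun i hi => h (hf i hi)

theorem lie (hJ : ∀ a ∈ M, ∀ b ∈ J, ⁅a, b⁆ ∈ J) (hf : CoeffMemBelow M k f)
    (hg : CoeffMemBelow J k g) : CoeffMemBelow J k ⁅f, g⁆ := by
  intro i hi
  rw [coeff_lie]
  refine J.sum_mem fun p hp => hJ _ (hf _ ?_) _ (hg _ ?_) <;>
  · have := Finset.HasAntidiagonal.mem_antidiagonal.1 hp
    omega

/-- A factor without constant term raises the order of approximation by one. -/
theorem lie_succ (hJ : ∀ a ∈ M, ∀ b ∈ J, ⁅a, b⁆ ∈ J) (hf : CoeffMemBelow M (k + 1) f)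
    (hf0 : f.coeff 0 = 0) (hg : CoeffMemBelow J k g) : CoeffMemBelow J (k + 1) ⁅f, g⁆ := by
  intro i hi
  rw [coeff_lie]
  refine J.sum_mem fun p hp => ?_
  have hp' := Finset.HasAntidiagonal.mem_antidiagonal.1 hp
  rcases Nat.eq_zero_or_pos p.1 with h0 | h0
  · rw [h0, hf0, zero_lie]; exact J.zero_mem
  · exact hJ _ (hf _ (by omega)) _ (hg _ (by omega))

theorem adIter (hJ : ∀ a ∈ M, ∀ b ∈ J, ⁅a, b⁆ ∈ J) (hf : CoeffMemBelow M k f)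
    (hg : CoeffMemBelow J k g) (i : ℕ) : CoeffMemBelow J k (adIter f i g) := by
  induction i with
  | zero => exact hg
  | succ i ih => rw [adIter_succ]; exact lie hJ hf ih

end CoeffMemBelow

theorem derivative_exp_C_mul_X {N : Submodule ℚ S} {n : ℕ} (hn : N ^ n = ⊥) {x : S}
    (hx : x ∈ N) :
    derivative (IsNilpotent.exp (C x * X)) = C x * IsNilpotent.exp (C x * X : S[X]) := by
  rcases n with _ | n
  · have := subsingleton_of_pow_zero_eq_bot hn
    exact Subsingleton.elim _ _
  have hmem : C x * X ∈ polyCoeffMem N := by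
    intro k
    rw [coeff_C_mul, coeff_X]
    split_ifs <;> simp [hx]
  have hC : C x ∈ polyCoeffMem N := by
    intro k
    rw [coeff_C]
    split_ifs <;> simp [hx]
  have hd : derivative (C x * X : S[X]) = C x := by simp
  have h := derivation_exp (polyCoeffMem_pow_eq_bot hn) (derivative (R := S)).toAddMonoidHom
    (fun a b => derivative_mul) hmem (by
      change derivative (C x * X : S[X]) ∈ _
      rwa [hd])
  change derivative _ = (∑ i ∈ _, _ • adIter _ i (derivative (C x * X : S[X]))) * _ at h
  rw [h, hd, Finset.sum_range_succ', Finset.sum_eq_zero]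
  · simp
  · intro i _
    rw [adIter_succ', Ring.lie_def, mul_assoc, X_mul_C, sub_self]
    have : ∀ j, adIter (C x * X : S[X]) j 0 = 0 := by
      intro j
      induction j with
      | zero => rfl
      | succ j ih => rw [adIter_succ, ih, lie_zero]
    rw [this, smul_zero]

set_option maxHeartbeats 1000000 in
/-- **Baker–Campbell–Hausdorff.** In a Lie algebra `M` of nilpotent elements, `log (exp x exp y)` is
`x + y` modulo any ideal `J` that contains `⁅x, y⁆`. The series is not needed:
`z = log (exp (x X) exp (y X))` satisfies a differential equation in the polynomial ring, which
shows by induction on the degree that the coefficients of `z - (x + y) X` lie in `J`. -/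
theorem nilLog_exp_mul_exp_sub_mem {N M J : Submodule ℚ S} {n : ℕ} (hN : N * N ≤ N)
    (hn : N ^ n = ⊥) (hMN : M ≤ N) (hJM : J ≤ M)
    (hJ : ∀ a ∈ M, ∀ b ∈ J, ⁅a, b⁆ ∈ J) {x y : S} (hx : x ∈ M) (hy : y ∈ M) (hxy : ⁅x, y⁆ ∈ J) :
    nilLog n (IsNilpotent.exp x * IsNilpotent.exp y) - (x + y) ∈ J := by
  rcases n with _ | n
  · have := subsingleton_of_pow_zero_eq_bot hn
    rw [Subsingleton.elim (nilLog 0 _ - _) 0]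
    exact J.zero_mem
  set n' := n + 1 with hn'
  have hP := polyCoeffMem_pow_eq_bot hn
  have hPP : polyCoeffMem N * polyCoeffMem N ≤ polyCoeffMem N :=
    (polyCoeffMem_mul_le N N).trans (polyCoeffMem_mono hN)
  have hCX : ∀ a ∈ N, C a * X ∈ polyCoeffMem N := by
    intro a ha k
    rw [coeff_C_mul, coeff_X]
    split_ifs <;> simp [ha]
  have hC : ∀ a ∈ N, C a ∈ polyCoeffMem N := by
    intro a ha k
    rw [coeff_C]
    split_ifs <;> simp [ha]
  set u : S[X] := IsNilpotent.exp (C x * X) * IsNilpotent.exp (C y * X) with hu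
  set z : S[X] := nilLog n' u with hz
  have hzN : z ∈ polyCoeffMem N := nilLog_mem hPP _
    (exp_mul_exp_sub_one_mem hPP hP (hCX x (hMN hx)) (hCX y (hMN hy)))
  have hzu : IsNilpotent.exp z = u :=
    exp_nilLog_exp_mul_exp hPP hP (hCX x (hMN hx)) (hCX y (hMN hy))
  have hz'N : derivative z ∈ polyCoeffMem N := by
    intro k
    rw [coeff_derivative]
    have := N.smul_mem ((k : ℚ) + 1) (hzN (k + 1))
    rw [Algebra.smul_def] at this
    simp only [map_add, map_natCast, map_one] at this
    have hc : z.coeff (k + 1) * ((k : S) + 1) = ((k : S) + 1) * z.coeff (k + 1) := by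
      rw [mul_add, add_mul, (Nat.cast_commute k _).eq, one_mul, mul_one]
    rwa [hc]
  -- the differential equation satisfied by `z`
  have hode : ∑ i ∈ Finset.range n', ((i + 1).factorial : ℚ)⁻¹ • adIter z i (derivative z) =
      C x + ∑ i ∈ Finset.range n', (i.factorial : ℚ)⁻¹ • adIter z i (C y) := by
    have h1 := derivation_exp hP (derivative (R := S)).toAddMonoidHom
      (fun a b => derivative_mul) hzN hz'N
    change derivative _ = (∑ i ∈ _, _ • adIter _ i (derivative z)) * _ at h1
    have h2 : derivative u = C x * u + u * C y := by
      rw [hu, derivative_mul, derivative_exp_C_mul_X hn (hMN hx),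
        derivative_exp_C_mul_X hn (hMN hy)]
      have hcomm : IsNilpotent.exp (C y * X) * C y = C y * IsNilpotent.exp (C y * X : S[X]) := by
        have h3 := exp_mul_eq_sum_adIter hP (hCX y (hMN hy)) (hC y (hMN hy))
        have hcm : Commute (C y * X : S[X]) (C y) := by
          change _ = _
          rw [mul_assoc, X_mul_C]
        rw [IsNilpotent.exp_eq_sum (pow_eq_zero_of_mem hP (hCX y (hMN hy)))]
        exact (Commute.sum_left _ _ _ fun i _ => (hcm.pow_left i).smul_left _).eq
      rw [mul_assoc _ _ (C y), hcomm, mul_assoc]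
    have h3 := exp_mul_eq_sum_adIter hP hzN (hC y (hMN hy))
    rw [hzu] at h1 h3
    have hunit : u * IsNilpotent.exp (-z) = 1 := by
      rw [← hzu]
      exact IsNilpotent.exp_mul_exp_neg_self (isNilpotent_of_mem hP hzN)
    have h4 : (∑ i ∈ Finset.range n', ((i + 1).factorial : ℚ)⁻¹ • adIter z i (derivative z)) * u =
        (C x + ∑ i ∈ Finset.range n', (i.factorial : ℚ)⁻¹ • adIter z i (C y)) * u := by
      rw [← h1, h2, h3, add_mul]
    have h5 := congrArg (· * IsNilpotent.exp (-z)) h4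
    simpa only [mul_assoc, hunit, mul_one] using h5
  -- the deviation of `z` from its linear term
  set w : S[X] := z - C (x + y) * X with hw
  have hz_eq : z = w + C (x + y) * X := by rw [hw, sub_add_cancel]
  have hw' : derivative w = ∑ i ∈ Finset.range n, ((i + 1).factorial : ℚ)⁻¹ • adIter z i ⁅z, C y⁆ -
      ∑ i ∈ Finset.range n, ((i + 1 + 1).factorial : ℚ)⁻¹ • adIter z i ⁅z, derivative z⁆ := by
    rw [hn', Finset.sum_range_succ', Finset.sum_range_succ'] at hode
    simp only [adIter_succ', zero_add, Nat.factorial_one, Nat.factorial_zero, Nat.cast_one,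
      inv_one, one_smul, adIter_zero] at hode
    have : derivative w = derivative z - C (x + y) := by simp [hw]
    rw [this, C_add, sub_eq_sub_iff_add_eq_add, add_comm, hode, add_left_comm]
  have hw0 : w.coeff 0 = 0 := by
    have h1 : constantCoeff u = 1 := by
      rw [hu, map_mul, IsNilpotent.map_exp (isNilpotent_of_mem hP (hCX x (hMN hx))),
        IsNilpotent.map_exp (isNilpotent_of_mem hP (hCX y (hMN hy)))]
      simp
    have h2 : constantCoeff z = 0 := by
      rw [hz, map_nilLog, h1, nilLog, sub_self]
      refine Finset.sum_eq_zero fun m hm => ?_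
      rw [zero_pow (by have := (Finset.mem_Ico.1 hm).1; omega), smul_zero]
    rw [constantCoeff_apply] at h2
    simp [hw, h2]
  have hxyM : x + y ∈ M := M.add_mem hx hy
  have hlin : ∀ k, CoeffMemBelow M k (C (x + y) * X) := by
    intro k i _
    rw [coeff_C_mul, coeff_X]
    split_ifs <;> simp [hxyM]
  have hCb : ∀ a ∈ M, ∀ k, CoeffMemBelow M k (C a) := by
    intro a ha k i _
    rw [coeff_C]
    split_ifs <;> simp [ha]
  have hJ' : ∀ a ∈ J, ∀ b ∈ M, ⁅a, b⁆ ∈ J := by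
    intro a ha b hb
    rw [← lie_skew]
    exact J.neg_mem (hJ b hb a ha)
  have hJJ : ∀ a ∈ J, ∀ b ∈ J, ⁅a, b⁆ ∈ J := fun a ha b hb => hJ a (hJM ha) b hb
  have key : ∀ k, CoeffMemBelow J (k + 1) w := by
    intro k
    induction k with
    | zero =>
      intro i hi
      rw [Nat.lt_one_iff.1 hi, hw0]
      exact J.zero_mem
    | succ k ih =>
      have hzM : CoeffMemBelow M (k + 1) z := by
        rw [hz_eq]; exact (ih.mono hJM).add (hlin _)
      have hz0 : z.coeff 0 = 0 := by rw [hz_eq]; simp [hw0]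
      have hdk : CoeffMemBelow J k (derivative w) := by
        intro i hi
        rw [coeff_derivative]
        have := J.smul_mem ((i : ℚ) + 1) (ih (i + 1) (by omega))
        rw [Algebra.smul_def] at this
        simp only [map_add, map_natCast, map_one] at this
        have hc : w.coeff (i + 1) * ((i : S) + 1) = ((i : S) + 1) * w.coeff (i + 1) := by
          rw [mul_add, add_mul, (Nat.cast_commute i _).eq, one_mul, mul_one]
        rwa [hc]
      have h1 : CoeffMemBelow J (k + 1) ⁅z, C y⁆ := by
        have : (⁅z, C y⁆ : S[X]) = ⁅w, C y⁆ + C ⁅x, y⁆ * X := by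
          rw [hz_eq, add_lie]
          congr 1
          rw [Ring.lie_def, mul_assoc, X_mul_C, ← mul_assoc, ← mul_assoc, ← C_mul, ← C_mul,
            ← sub_mul, ← C_sub, Ring.lie_def]
          congr 2
          noncomm_ring
        rw [this]
        refine .add ?_ ?_
        · intro i hi
          rw [coeff_lie]
          refine J.sum_mem fun p hp => hJ' _ (ih _ ?_) _ (hCb y hy (p.2 + 1) _ (by omega))
          have := Finset.HasAntidiagonal.mem_antidiagonal.1 hp
          omega
        · intro i _
          rw [coeff_C_mul, coeff_X]
          split_ifs <;> simp [hxy]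
      have h2 : CoeffMemBelow J (k + 1) ⁅z, derivative z⁆ := by
        have hdz : derivative z = derivative w + C (x + y) := by
          conv_lhs => rw [hz_eq]
          simp
        have : (⁅z, derivative z⁆ : S[X]) = ⁅z, derivative w⁆ + ⁅w, C (x + y)⁆ := by
          rw [hdz, lie_add]
          congr 1
          conv_lhs => rw [hz_eq]
          rw [add_lie]
          have : (⁅C (x + y) * X, C (x + y)⁆ : S[X]) = 0 := by
            rw [Ring.lie_def, mul_assoc, X_mul_C, sub_self]
          rw [this, add_zero]
        rw [this]
        refine .add (CoeffMemBelow.lie_succ hJ hzM hz0 hdk) ?_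
        intro i hi
        rw [coeff_lie]
        refine J.sum_mem fun p hp => hJ' _ (ih _ ?_) _ (hCb _ hxyM (p.2 + 1) _ (by omega))
        have := Finset.HasAntidiagonal.mem_antidiagonal.1 hp
        omega
      have h3 : CoeffMemBelow J (k + 1) (derivative w) := by
        rw [hw']
        exact .sub (.sum fun i _ => (CoeffMemBelow.adIter hJ hzM h1 i).smul _)
          (.sum fun i _ => (CoeffMemBelow.adIter hJ hzM h2 i).smul _)
      intro i hi
      rcases i with _ | i
      · rw [hw0]; exact J.zero_mem
      · have h4 := h3 i (by omega)
        rw [coeff_derivative] at h4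
        have h5 := J.smul_mem (((i : ℚ) + 1)⁻¹) h4
        have h6 : w.coeff (i + 1) * ((i : S) + 1) = ((i : ℚ) + 1) • w.coeff (i + 1) := by
          rw [Algebra.smul_def]
          simp only [map_add, map_natCast, map_one]
          rw [mul_add, add_mul, (Nat.cast_commute i _).eq, one_mul, mul_one]
        rw [h6, inv_smul_smul₀ (by positivity)] at h5
        exact h5
  -- evaluation at `1`
  let ev : S[X] →+* S := eval₂RingHom' (RingHom.id S) 1 (fun a => Commute.one_right a)
  have hev : ∀ f : S[X], ev f = f.sum fun _ a => a := by
    intro f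
    change eval₂ (RingHom.id S) 1 f = _
    simp [eval₂_eq_sum]
  have hevC : ∀ a : S, ev (C a * X) = a := by
    intro a
    change eval₂ (RingHom.id S) 1 (C a * X) = _
    simp
  have h1 : ev z = nilLog n' (IsNilpotent.exp x * IsNilpotent.exp y) := by
    rw [hz, map_nilLog, hu, map_mul, IsNilpotent.map_exp (isNilpotent_of_mem hP (hCX x (hMN hx))),
      IsNilpotent.map_exp (isNilpotent_of_mem hP (hCX y (hMN hy))), hevC, hevC]
  rw [← h1, ← hevC (x + y), ← map_sub, hev]
  exact J.sum_mem fun i _ => key i i (by omega)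

end BCH

/-! ### Power-closed unipotent groups and their Lie algebras -/

section Vandermonde

variable {W : Type*} [AddCommGroup W] [Module ℚ W]

theorem coeff_mem_of_forall_sum_pow_smul_mem (V : Submodule ℚ W) {m : ℕ} (c : ℕ → W)
    (h : ∀ q : ℚ, ∑ i ∈ Finset.range m, q ^ i • c i ∈ V) {i : ℕ} (hi : i < m) : c i ∈ V := by
  by_contra hc
  obtain ⟨φ, hφ, hV⟩ := Submodule.exists_le_ker_of_notMem hc
  have hp : ∑ j ∈ Finset.range m, Polynomial.C (φ (c j)) * Polynomial.X ^ j = 0 := by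
    refine Polynomial.funext fun q => ?_
    have := hV (h q)
    rw [LinearMap.mem_ker, map_sum] at this
    simp only [map_smul, smul_eq_mul] at this
    rw [Polynomial.eval_finsetSum, Polynomial.eval_zero, ← this]
    refine Finset.sum_congr rfl fun j _ => ?_
    rw [Polynomial.eval_mul, Polynomial.eval_C, Polynomial.eval_pow, Polynomial.eval_X]
    exact mul_comm _ _
  have := congrArg (fun p => Polynomial.coeff p i) hp
  rw [Polynomial.finsetSum_coeff, Polynomial.coeff_zero] at this
  simp only [Polynomial.coeff_C_mul_X_pow] at this
  rw [Finset.sum_ite_eq, if_pos (Finset.mem_range.2 hi)] at this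
  exact hφ this

/-- A polynomial map with vector coefficients that takes values in a subspace at all rational
points has its coefficients in this subspace. -/
theorem coeff_mem_of_forall_sum_prod_pow_smul_mem (V : Submodule ℚ W) {σ : Type*}
    (s : Finset (σ →₀ ℕ)) (c : (σ →₀ ℕ) → W)
    (h : ∀ a : σ → ℚ, ∑ α ∈ s, (α.prod fun i e => a i ^ e) • c α ∈ V) {α : σ →₀ ℕ} (hα : α ∈ s) :
    c α ∈ V := by
  by_contra hc
  obtain ⟨φ, hφ, hV⟩ := Submodule.exists_le_ker_of_notMem hc
  have hp : ∑ β ∈ s, MvPolynomial.monomial β (φ (c β)) = 0 := by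
    refine MvPolynomial.funext fun a => ?_
    have := hV (h a)
    rw [LinearMap.mem_ker, map_sum] at this
    simp only [map_smul, smul_eq_mul] at this
    rw [map_sum, map_zero, ← this]
    refine Finset.sum_congr rfl fun β _ => ?_
    rw [MvPolynomial.eval_monomial, mul_comm]
  have := congrArg (MvPolynomial.coeff α) hp
  classical
  simp [MvPolynomial.coeff_sum, MvPolynomial.coeff_monomial, hα] at this
  exact hφ this

end Vandermonde

section PowerClosed

variable {S : Type*} [Ring S] [Algebra ℚ S] {N : Submodule ℚ S} {n : ℕ}

theorem adIter_smul (q : ℚ) (x y : S) (i : ℕ) : adIter (q • x) i y = q ^ i • adIter x i y := by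
  induction i with
  | zero => simp
  | succ i ih =>
    rw [adIter_succ, ih, adIter_succ, Ring.lie_def, Ring.lie_def, smul_mul_smul_comm,
      smul_mul_smul_comm, ← pow_succ', ← pow_succ, smul_sub]

theorem pow_succ_le_self (hN : N * N ≤ N) (i : ℕ) : N ^ (i + 1) ≤ N := by
  induction i with
  | zero => simp
  | succ i ih => rw [pow_succ]; exact (mul_le_mul' ih le_rfl).trans hN

theorem adIter_mem (hN : N * N ≤ N) {x y : S} (hx : x ∈ N) (hy : y ∈ N) (i : ℕ) :
    adIter x i y ∈ N :=
  pow_succ_le_self hN i (adIter_mem_pow hx hy i)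

theorem conj_mem (hN : N * N ≤ N) (hn : N ^ n = ⊥) {x y : S} (hx : x ∈ N) (hy : y ∈ N) :
    IsNilpotent.exp x * y * IsNilpotent.exp (-x) ∈ N := by
  rw [exp_mul_mul_exp_neg hn hx hy]
  exact Submodule.sum_mem _ fun i _ => N.smul_mem _ (adIter_mem hN hx hy i)

theorem pow_add_eq_bot (hn : N ^ n = ⊥) (m : ℕ) : N ^ (n + m) = ⊥ := by
  rw [pow_add, hn, Submodule.bot_mul]

theorem lie_mem_of_forall_conj_mem (hn : N ^ n = ⊥) {V : Submodule ℚ S} {x y : S} (hx : x ∈ N)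
    (hy : y ∈ N)
    (h : ∀ q : ℚ, IsNilpotent.exp (q • x) * y * IsNilpotent.exp (-(q • x)) ∈ V) : ⁅x, y⁆ ∈ V := by
  have h1 := coeff_mem_of_forall_sum_pow_smul_mem V (m := n + 2)
    (fun i => (i.factorial : ℚ)⁻¹ • adIter x i y) (by
      intro q
      have := h q
      rw [exp_mul_mul_exp_neg (pow_add_eq_bot hn 2) (N.smul_mem q hx) hy] at this
      convert this using 2 with i
      rw [adIter_smul, smul_comm]) (i := 1) (by omega)
  simpa [adIter_succ] using h1

theorem exp_conj {x u v : S} (hx : IsNilpotent x) (huv : v * u = 1) (hvu : u * v = 1) :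
    IsNilpotent.exp (u * x * v) = u * IsNilpotent.exp x * v := by
  obtain ⟨k, hk⟩ := hx
  have hpow : ∀ i, (u * x * v) ^ i = u * x ^ i * v := by
    intro i
    induction i with
    | zero => simp [hvu]
    | succ i ih =>
      rw [pow_succ, ih, pow_succ]
      simp only [mul_assoc]
      rw [← mul_assoc v u, huv, one_mul]
  rw [IsNilpotent.exp_eq_sum hk, IsNilpotent.exp_eq_sum (k := k) (by rw [hpow, hk]; simp)]
  simp [hpow, Finset.mul_sum, Finset.sum_mul]

theorem nilLog_exp_mul_exp_mul_exp_neg (hN : N * N ≤ N) (hn : N ^ n = ⊥) {x y : S} (hx : x ∈ N)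
    (hy : y ∈ N) :
    nilLog n (IsNilpotent.exp x * IsNilpotent.exp y * IsNilpotent.exp (-x)) =
      IsNilpotent.exp x * y * IsNilpotent.exp (-x) := by
  have hx' := isNilpotent_of_mem hn hx
  rw [← exp_conj (isNilpotent_of_mem hn hy) (IsNilpotent.exp_neg_mul_exp_self hx')
    (IsNilpotent.exp_mul_exp_neg_self hx'), nilLog_exp_of_mem hn (conj_mem hN hn hx hy)]

/-- The descending series `V, [V, V], [V, [V, V]], …`. -/
def lieSeries (V : Submodule ℚ S) : ℕ → Submodule ℚ S
  | 0 => V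
  | j + 1 => Submodule.span ℚ {z | ∃ v ∈ V, ∃ w ∈ lieSeries V j, ⁅v, w⁆ = z}

theorem lie_mem_lieSeries {V : Submodule ℚ S} {j : ℕ} {v w : S} (hv : v ∈ V)
    (hw : w ∈ lieSeries V j) : ⁅v, w⁆ ∈ lieSeries V (j + 1) :=
  Submodule.subset_span ⟨v, hv, w, hw, rfl⟩

theorem lieSeries_succ_le {V : Submodule ℚ S} (hV : ∀ a ∈ V, ∀ b ∈ V, ⁅a, b⁆ ∈ V) (j : ℕ) :
    lieSeries V (j + 1) ≤ lieSeries V j := by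
  induction j with
  | zero =>
    refine Submodule.span_le.2 ?_
    rintro _ ⟨v, hv, w, hw, rfl⟩
    exact hV v hv w hw
  | succ j ih =>
    refine Submodule.span_le.2 ?_
    rintro _ ⟨v, hv, w, hw, rfl⟩
    exact lie_mem_lieSeries hv (ih hw)

theorem lieSeries_le_pow {V : Submodule ℚ S} (hVN : V ≤ N) (j : ℕ) :
    lieSeries V j ≤ N ^ (j + 1) := by
  induction j with
  | zero => simpa using! hVN
  | succ j ih =>
    refine Submodule.span_le.2 ?_
    rintro _ ⟨v, hv, w, hw, rfl⟩
    rw [add_comm]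
    exact lie_mem_pow_add (by simpa using hVN hv) (ih hw)

theorem lieSeries_le_self {V : Submodule ℚ S} (hV : ∀ a ∈ V, ∀ b ∈ V, ⁅a, b⁆ ∈ V) (j : ℕ) :
    lieSeries V j ≤ V := by
  induction j with
  | zero => exact le_rfl
  | succ j ih => exact (lieSeries_succ_le hV j).trans ih

theorem adIter_mem_lieSeries {V : Submodule ℚ S} {j : ℕ} {v w : S} (hv : v ∈ V)
    (hw : w ∈ lieSeries V j) (i : ℕ) : adIter v i w ∈ lieSeries V (j + i) := by
  induction i with
  | zero => exact hw
  | succ i ih => rw [adIter_succ]; exact lie_mem_lieSeries hv ih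

/-- The logarithms of a group of unipotent elements. -/
structure IsLogGroup (N : Submodule ℚ S) (n : ℕ) (h : Set S) : Prop where
  subset : h ⊆ N
  zero_mem : 0 ∈ h
  smul_mem : ∀ q : ℚ, ∀ x ∈ h, q • x ∈ h
  mul_mem : ∀ x ∈ h, ∀ y ∈ h, nilLog n (IsNilpotent.exp x * IsNilpotent.exp y) ∈ h

namespace IsLogGroup

variable {h : Set S}

theorem neg_mem (hh : IsLogGroup N n h) {x : S} (hx : x ∈ h) : -x ∈ h := by
  simpa using hh.smul_mem (-1) x hx

theorem conj_mem (hh : IsLogGroup N n h) (hN : N * N ≤ N) (hn : N ^ n = ⊥) {x y : S}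
    (hx : x ∈ h) (hy : y ∈ h) : IsNilpotent.exp x * y * IsNilpotent.exp (-x) ∈ h := by
  have h1 := hh.mul_mem _ (hh.mul_mem x hx y hy) _ (hh.neg_mem hx)
  rwa [exp_nilLog_exp_mul_exp hN hn (hh.subset hx) (hh.subset hy),
    nilLog_exp_mul_exp_mul_exp_neg hN hn (hh.subset hx) (hh.subset hy)] at h1

theorem span_le (hh : IsLogGroup N n h) : Submodule.span ℚ h ≤ N :=
  Submodule.span_le.2 hh.subset

theorem lie_mem_span (hh : IsLogGroup N n h) (hN : N * N ≤ N) (hn : N ^ n = ⊥) :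
    ∀ a ∈ Submodule.span ℚ h, ∀ b ∈ Submodule.span ℚ h, ⁅a, b⁆ ∈ Submodule.span ℚ h := by
  intro a ha b hb
  induction ha using Submodule.span_induction with
  | zero => rw [zero_lie]; exact Submodule.zero_mem _
  | add a a' _ _ iha iha' => rw [add_lie]; exact Submodule.add_mem _ iha iha'
  | smul q a _ iha =>
    rw [Ring.lie_def, smul_mul_assoc, mul_smul_comm, ← smul_sub]
    exact Submodule.smul_mem _ _ iha
  | mem a ha =>
    induction hb using Submodule.span_induction with
    | zero => rw [lie_zero]; exact Submodule.zero_mem _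
    | add b b' _ _ ihb ihb' => rw [lie_add]; exact Submodule.add_mem _ ihb ihb'
    | smul q b _ ihb =>
      rw [Ring.lie_def, smul_mul_assoc, mul_smul_comm, ← smul_sub]
      exact Submodule.smul_mem _ _ ihb
    | mem b hb =>
      exact lie_mem_of_forall_conj_mem hn (hh.subset ha) (hh.subset hb) fun q =>
        Submodule.subset_span (hh.conj_mem hN hn (hh.smul_mem q a ha) hb)

/-- The series `[V, [V, …]]` of the span `V` of the logarithms is approximated, term by term and
modulo the next term, by logarithms: iterated brackets of logarithms are logarithms of iterated
group commutators modulo the next term. -/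
theorem exists_sub_mem_lieSeries (hh : IsLogGroup N n h) (hN : N * N ≤ N) (hn : N ^ n = ⊥)
    (j : ℕ) : ∀ v ∈ lieSeries (Submodule.span ℚ h) j,
      ∃ g ∈ h, g - v ∈ lieSeries (Submodule.span ℚ h) (j + 1) := by
  set V := Submodule.span ℚ h with hVdef
  have hVlie := hh.lie_mem_span hN hn
  have hJ : ∀ j, ∀ a ∈ V, ∀ b ∈ lieSeries V j, ⁅a, b⁆ ∈ lieSeries V j := fun j a ha b hb =>
    lieSeries_succ_le hVlie j (lie_mem_lieSeries ha hb)
  -- the elements that can be approximated form a subspace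
  let A : ℕ → Submodule ℚ S := fun j =>
    { carrier := {v | v ∈ lieSeries V j ∧ ∃ g ∈ h, g - v ∈ lieSeries V (j + 1)}
      zero_mem' := ⟨Submodule.zero_mem _, 0, hh.zero_mem, by simp⟩
      smul_mem' := by
        rintro q v ⟨hv, g, hg, hgv⟩
        refine ⟨Submodule.smul_mem _ q hv, q • g, hh.smul_mem q g hg, ?_⟩
        rw [← smul_sub]
        exact Submodule.smul_mem _ q hgv
      add_mem' := by
        rintro v v' ⟨hv, g, hg, hgv⟩ ⟨hv', g', hg', hgv'⟩
        refine ⟨Submodule.add_mem _ hv hv', _, hh.mul_mem g hg g' hg', ?_⟩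
        have hg'j : g' ∈ lieSeries V j := by
          have := Submodule.add_mem _ (lieSeries_succ_le hVlie j hgv') hv'
          rwa [sub_add_cancel] at this
        have h1 := nilLog_exp_mul_exp_sub_mem hN hn hh.span_le (lieSeries_le_self hVlie (j + 1))
          (hJ (j + 1)) (Submodule.subset_span hg) (Submodule.subset_span hg')
          (lie_mem_lieSeries (Submodule.subset_span hg) hg'j)
        have h2 := Submodule.add_mem _ h1 (Submodule.add_mem _ hgv hgv')
        convert h2 using 1
        abel }
  suffices H : ∀ j, lieSeries V j ≤ A j from fun v hv => (H j hv).2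
  intro j
  induction j with
  | zero =>
    refine Submodule.span_le.2 fun g hg => ⟨Submodule.subset_span hg, g, hg, ?_⟩
    rw [sub_self]
    exact Submodule.zero_mem _
  | succ j ih =>
    refine Submodule.span_le.2 ?_
    rintro _ ⟨v, hv, w, hw, rfl⟩
    change ⁅v, w⁆ ∈ A (j + 1)
    induction hv using Submodule.span_induction with
    | zero => rw [zero_lie]; exact Submodule.zero_mem _
    | add a a' _ _ iha iha' => rw [add_lie]; exact Submodule.add_mem _ iha iha'
    | smul q a _ iha =>
      rw [Ring.lie_def, smul_mul_assoc, mul_smul_comm, ← smul_sub]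
      exact Submodule.smul_mem _ _ iha
    | mem x hx =>
      have hxV : x ∈ V := Submodule.subset_span hx
      obtain ⟨-, g, hg, hgw⟩ := ih hw
      have hgV : g ∈ V := Submodule.subset_span hg
      have hgj : g ∈ lieSeries V j := by
        have := Submodule.add_mem _ (lieSeries_succ_le hVlie j hgw) hw
        rwa [sub_add_cancel] at this
      refine ⟨lie_mem_lieSeries hxV hw, ?_⟩
      set e := IsNilpotent.exp x * g * IsNilpotent.exp (-x) with he
      have heh : e ∈ h := hh.conj_mem hN hn hx hg
      have h1 : e - g - ⁅x, g⁆ ∈ lieSeries V (j + 2) := by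
        have h2 := exp_mul_mul_exp_neg (pow_add_eq_bot hn 2) (hh.subset hx) (hh.subset hg)
        rw [Finset.sum_range_succ', Finset.sum_range_succ'] at h2
        simp only [zero_add, Nat.factorial_one, Nat.factorial_zero, Nat.cast_one, inv_one,
          one_smul, adIter_zero, adIter_succ x 0] at h2
        rw [he, h2, add_sub_cancel_right, add_sub_cancel_right]
        refine Submodule.sum_mem _ fun i _ => Submodule.smul_mem _ _ ?_
        have h3 := adIter_mem_lieSeries hxV hgj (i + 2)
        have h4 : ∀ i, lieSeries V (j + (i + 2)) ≤ lieSeries V (j + 2) := by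
          intro i
          induction i with
          | zero => exact le_rfl
          | succ i ih => exact (lieSeries_succ_le hVlie (j + (i + 2))).trans ih
        exact h4 i h3
      have heg : e - g ∈ lieSeries V (j + 1) := by
        have := Submodule.add_mem _ (lieSeries_succ_le hVlie (j + 1) h1)
          (lie_mem_lieSeries hxV hgj)
        rwa [sub_add_cancel] at this
      refine ⟨_, hh.mul_mem e heh (-g) (hh.neg_mem hg), ?_⟩
      have h5 := nilLog_exp_mul_exp_sub_mem hN hn hh.span_le (lieSeries_le_self hVlie (j + 2))
          (hJ (j + 2)) (Submodule.subset_span heh) (V.neg_mem hgV) (by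
            have : ⁅e, -g⁆ = ⁅g, e - g⁆ := by
              rw [lie_neg, lie_skew, lie_sub, lie_self, sub_zero]
            rw [this]
            exact lie_mem_lieSeries hgV heg)
      have h6 := lie_mem_lieSeries hxV hgw
      rw [lie_sub] at h6
      have h7 := Submodule.add_mem _ h5 (Submodule.add_mem _ h1 h6)
      convert h7 using 1
      abel

/-- Every element of the span of the logarithms of a power-closed group is itself a logarithm. -/
theorem mem_of_mem_span (hh : IsLogGroup N n h) (hN : N * N ≤ N) (hn : N ^ n = ⊥) {z : S}
    (hz : z ∈ Submodule.span ℚ h) : z ∈ h := by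
  set V := Submodule.span ℚ h with hVdef
  have hVlie := hh.lie_mem_span hN hn
  have hVN := hh.span_le
  have key : ∀ j, ∃ g ∈ h, ∃ w ∈ lieSeries V j,
      IsNilpotent.exp z = IsNilpotent.exp g * IsNilpotent.exp w := by
    intro j
    induction j with
    | zero => exact ⟨0, hh.zero_mem, z, hz, by simp⟩
    | succ j ih =>
      obtain ⟨g, hg, w, hw, hgw⟩ := ih
      obtain ⟨g', hg', hgw'⟩ := hh.exists_sub_mem_lieSeries hN hn j w hw
      have hwV := lieSeries_le_self hVlie j hw
      have hg'N := hh.subset hg'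
      refine ⟨_, hh.mul_mem g hg g' hg',
        nilLog n (IsNilpotent.exp (-g') * IsNilpotent.exp w), ?_, ?_⟩
      · have h1 := nilLog_exp_mul_exp_sub_mem hN hn hVN (lieSeries_le_self hVlie (j + 1))
          (fun a ha b hb => lieSeries_succ_le hVlie (j + 1) (lie_mem_lieSeries ha hb))
          (V.neg_mem (Submodule.subset_span hg')) hwV
          (lie_mem_lieSeries (V.neg_mem (Submodule.subset_span hg')) hw)
        have h2 := Submodule.sub_mem _ h1 hgw'
        convert h2 using 1
        abel
      · rw [exp_nilLog_exp_mul_exp hN hn (hh.subset hg) hg'N,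
          exp_nilLog_exp_mul_exp hN hn (N.neg_mem hg'N) (hVN hwV), hgw, mul_assoc,
          ← mul_assoc (IsNilpotent.exp g'),
          IsNilpotent.exp_mul_exp_neg_self (isNilpotent_of_mem hn hg'N), one_mul]
  obtain ⟨g, hg, w, hw, hgw⟩ := key n
  have hw0 : w = 0 := eq_zero_of_mem_pow hn (Nat.le_succ n) (lieSeries_le_pow hVN n hw)
  rw [hw0, IsNilpotent.exp_zero, mul_one] at hgw
  have := congrArg (nilLog n) hgw
  rw [nilLog_exp_of_mem hn (hVN hz), nilLog_exp_of_mem hn (hh.subset hg)] at this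
  rwa [this]

theorem add_mem (hh : IsLogGroup N n h) (hN : N * N ≤ N) (hn : N ^ n = ⊥) {x y : S}
    (hx : x ∈ h) (hy : y ∈ h) : x + y ∈ h :=
  hh.mem_of_mem_span hN hn
    (Submodule.add_mem _ (Submodule.subset_span hx) (Submodule.subset_span hy))

theorem lie_mem (hh : IsLogGroup N n h) (hN : N * N ≤ N) (hn : N ^ n = ⊥) {x y : S}
    (hx : x ∈ h) (hy : y ∈ h) : ⁅x, y⁆ ∈ h :=
  hh.mem_of_mem_span hN hn
    (hh.lie_mem_span hN hn _ (Submodule.subset_span hx) _ (Submodule.subset_span hy))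

end IsLogGroup

/-- A Lie algebra of nilpotent elements is the set of logarithms of a group. -/
theorem nilLog_exp_mul_exp_mem (hN : N * N ≤ N) (hn : N ^ n = ⊥) {M : Submodule ℚ S}
    (hMN : M ≤ N) (hM : ∀ a ∈ M, ∀ b ∈ M, ⁅a, b⁆ ∈ M) {x y : S} (hx : x ∈ M) (hy : y ∈ M) :
    nilLog n (IsNilpotent.exp x * IsNilpotent.exp y) ∈ M := by
  have h1 := nilLog_exp_mul_exp_sub_mem hN hn hMN le_rfl hM hx hy (hM x hx y hy)
  have h2 := M.add_mem h1 (M.add_mem hx hy)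
  rwa [sub_add_cancel] at h2

end PowerClosed

/-! ### Subgroups of finitely generated nilpotent groups -/

section Noetherian

open scoped commutatorElement

variable {G : Type*} [Group G]

/-- The ascending chain condition for the traces on `K` of the subgroups of `G`. -/
def AccOn (K : Subgroup G) : Prop :=
  ∀ f : ℕ →o Subgroup G, ∃ n, ∀ m, n ≤ m → f m ⊓ K = f n ⊓ K

theorem AccOn.closure_singleton_sup {K : Subgroup G} [K.Normal] (hK : AccOn K) (a : G) :
    AccOn (Subgroup.closure {a} ⊔ K) := by
  intro f
  obtain ⟨n₁, hn₁⟩ := hK f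
  let I : ℕ →o Submodule ℤ ℤ :=
    { toFun := fun n =>
        { carrier := {m : ℤ | a ^ m ∈ f n ⊔ K}
          zero_mem' := by simp
          add_mem' := by
            intro m m' hm hm'
            simp only [Set.mem_ofPred_eq, zpow_add] at *
            exact Subgroup.mul_mem _ hm hm'
          smul_mem' := by
            intro c m hm
            simp only [Set.mem_ofPred_eq, smul_eq_mul, mul_comm c, zpow_mul] at *
            exact Subgroup.zpow_mem _ hm c }
      monotone' := fun n m hnm c hc => sup_le_sup_right (f.monotone hnm) K hc }
  obtain ⟨n₂, hn₂⟩ := monotone_stabilizes_iff_noetherian.2 (inferInstance : IsNoetherian ℤ ℤ) I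
  refine ⟨max n₁ n₂, fun m hm => le_antisymm ?_ (inf_le_inf_right _ (f.monotone hm))⟩
  rintro x ⟨hxm, hx⟩
  refine ⟨?_, hx⟩
  obtain ⟨y, hy, k, hk, rfl⟩ := Subgroup.mem_sup_of_normal_right.1 hx
  obtain ⟨i, rfl⟩ := Subgroup.mem_closure_singleton.1 hy
  have h1 : i ∈ I m := by
    change a ^ i ∈ f m ⊔ K
    have : a ^ i = a ^ i * k * k⁻¹ := by group
    rw [this]
    exact Subgroup.mul_mem _ (Subgroup.mem_sup_left hxm)
      (Subgroup.mem_sup_right (K.inv_mem hk))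
  have h2 : i ∈ I (max n₁ n₂) := by
    rw [← hn₂ _ (le_max_right _ _), hn₂ m ((le_max_right _ _).trans hm)]
    exact h1
  obtain ⟨h, hh, k', hk', hik⟩ := Subgroup.mem_sup_of_normal_right.1 (show a ^ i ∈ _ ⊔ K from h2)
  have h3 : h⁻¹ * (a ^ i * k) ∈ f m ⊓ K := by
    refine ⟨Subgroup.mul_mem _ (Subgroup.inv_mem _ (f.monotone hm hh)) hxm, ?_⟩
    rw [← hik]
    have : h⁻¹ * (h * k' * k) = k' * k := by group
    rw [this]
    exact K.mul_mem hk' hk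
  rw [hn₁ m ((le_max_left _ _).trans hm), ← hn₁ _ (le_max_left n₁ n₂)] at h3
  have h4 := Subgroup.mul_mem _ hh h3.1
  rwa [mul_inv_cancel_left] at h4

theorem normal_of_lowerCentralSeries_le {i : ℕ} {K : Subgroup G}
    (h1 : (⊤ : Subgroup G).lowerCentralSeries (i + 1) ≤ K)
    (h2 : K ≤ (⊤ : Subgroup G).lowerCentralSeries i) : K.Normal := by
  refine ⟨fun x hx g => ?_⟩
  have h3 : ⁅x, g⁆ ∈ K := h1 (by
    rw [Subgroup.lowerCentralSeries_succ]
    exact Subgroup.commutator_mem_commutator (h2 hx) (Subgroup.mem_top g))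
  have h4 : g * x * g⁻¹ = ⁅x, g⁆⁻¹ * x := by rw [commutatorElement_def]; group
  rw [h4]
  exact K.mul_mem (K.inv_mem h3) hx

/-- The elements that commute with all elements modulo `P`. -/
def centralMod (P : Subgroup G) [P.Normal] : Subgroup G :=
  (Subgroup.center (G ⧸ P)).comap (QuotientGroup.mk' P)

theorem mem_centralMod {P : Subgroup G} [P.Normal] {x : G} :
    x ∈ centralMod P ↔ ∀ y, ⁅x, y⁆ ∈ P := by
  rw [centralMod, Subgroup.mem_comap, Subgroup.mem_center_iff]
  constructor
  · intro h y
    rw [← QuotientGroup.eq_one_iff]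
    have := h (y : G ⧸ P)
    change ((⁅x, y⁆ : G) : G ⧸ P) = 1
    rw [commutatorElement_def]
    simp only [QuotientGroup.mk_mul, QuotientGroup.mk_inv]
    rw [QuotientGroup.mk'_apply] at this
    rw [← this]
    group
  · intro h y
    induction y using QuotientGroup.induction_on with
    | H y =>
      have := (QuotientGroup.eq_one_iff _).2 (h y)
      rw [commutatorElement_def] at this
      simp only [QuotientGroup.mk_mul, QuotientGroup.mk_inv] at this
      rw [QuotientGroup.mk'_apply]
      rw [mul_inv_eq_one, mul_inv_eq_iff_eq_mul] at this
      exact this.symm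

/-- The lower central factors of a finitely generated group are finitely generated. -/
theorem exists_finite_lowerCentralSeries_le [hG : Group.FG G] (i : ℕ) :
    ∃ A : Set G, A.Finite ∧ A ⊆ (⊤ : Subgroup G).lowerCentralSeries i ∧
      (⊤ : Subgroup G).lowerCentralSeries i ≤
        Subgroup.closure A ⊔ (⊤ : Subgroup G).lowerCentralSeries (i + 1) := by
  obtain ⟨S, hS, hSfin⟩ := Group.fg_iff.1 hG
  induction i with
  | zero => exact ⟨S, hSfin, by simp, by rw [hS]; simp⟩
  | succ i ih =>
    obtain ⟨A, hAfin, hA, hle⟩ := ih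
    set γ := (⊤ : Subgroup G).lowerCentralSeries with hγ
    have hsucc : ∀ j, γ (j + 1) = ⁅γ j, ⊤⁆ := fun j => Subgroup.lowerCentralSeries_succ _ j
    have hB : Set.image2 (fun a s => ⁅a, s⁆) A S ⊆ γ (i + 1) := by
      rintro _ ⟨a, ha, s, -, rfl⟩
      rw [hsucc]
      exact Subgroup.commutator_mem_commutator (hA ha) (Subgroup.mem_top s)
    refine ⟨Set.image2 (fun a s => ⁅a, s⁆) A S, hAfin.image2 _ hSfin, hB, ?_⟩
    set P := Subgroup.closure (Set.image2 (fun a s => ⁅a, s⁆) A S) ⊔ γ (i + 1 + 1) with hP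
    have hPn : P.Normal := normal_of_lowerCentralSeries_le (i := i + 1) le_sup_right
      (sup_le ((Subgroup.closure_le _).2 hB)
        (Subgroup.lowerCentralSeries_antitone _ (Nat.le_succ _)))
    have h1 : γ i ≤ centralMod P := by
      refine hle.trans (sup_le ((Subgroup.closure_le _).2 fun a ha => ?_) fun x hx => ?_)
      · -- the centralizer of `a` modulo `P` contains the generators of `G`
        rw [SetLike.mem_coe, centralMod, Subgroup.mem_comap, Subgroup.mem_center_iff]
        have h2 : (⊤ : Subgroup G) ≤
            (Subgroup.centralizer {(QuotientGroup.mk' P a)}).comap (QuotientGroup.mk' P) := by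
          rw [← hS, Subgroup.closure_le]
          intro s hs
          rw [SetLike.mem_coe, Subgroup.mem_comap, Subgroup.mem_centralizer_singleton_iff]
          have h3 : ((⁅a, s⁆ : G) : G ⧸ P) = 1 := (QuotientGroup.eq_one_iff _).2
            (Subgroup.mem_sup_left (Subgroup.subset_closure ⟨a, ha, s, hs, rfl⟩))
          rw [commutatorElement_def] at h3
          simp only [QuotientGroup.mk_mul, QuotientGroup.mk_inv] at h3
          rw [mul_inv_eq_one, mul_inv_eq_iff_eq_mul] at h3
          exact h3.symm
        intro g
        induction g using QuotientGroup.induction_on with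
        | H g =>
          have := h2 (Subgroup.mem_top g)
          rw [Subgroup.mem_comap, Subgroup.mem_centralizer_singleton_iff] at this
          exact this
      · refine mem_centralMod.2 fun y => Subgroup.mem_sup_right ?_
        rw [hsucc (i + 1)]
        exact Subgroup.commutator_mem_commutator hx (Subgroup.mem_top y)
    rw [hsucc i, Subgroup.commutator_le]
    intro x hx y _
    exact mem_centralMod.1 (h1 hx) y

/-- The subgroups of a finitely generated nilpotent group satisfy the ascending chain condition. -/
theorem wellFoundedGT_subgroup_of_isNilpotent [Group.FG G] [hN : Group.IsNilpotent G] :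
    WellFoundedGT (Subgroup G) := by
  set γ := (⊤ : Subgroup G).lowerCentralSeries with hγ
  have step : ∀ i, AccOn (γ (i + 1)) → AccOn (γ i) := by
    intro i hi
    obtain ⟨A, hAfin, hA, hle⟩ := exists_finite_lowerCentralSeries_le (G := G) i
    have hfin : ∀ B : Set G, B.Finite → B ⊆ γ i → AccOn (Subgroup.closure B ⊔ γ (i + 1)) := by
      intro B hB
      induction B, hB using Set.Finite.induction_on with
      | empty => intro _; simpa using hi
      | @insert a B _ _ ih =>
        intro hs
        have hs' : B ⊆ γ i := (Set.subset_insert a B).trans hs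
        have : (Subgroup.closure B ⊔ γ (i + 1)).Normal :=
          normal_of_lowerCentralSeries_le (i := i) le_sup_right
            (sup_le ((Subgroup.closure_le _).2 hs')
              (Subgroup.lowerCentralSeries_antitone _ (Nat.le_succ _)))
        have h1 := (ih hs').closure_singleton_sup a
        rwa [← sup_assoc, ← Subgroup.closure_union, ← Set.insert_eq] at h1
    have h2 := hfin A hAfin hA
    have h3 : Subgroup.closure A ⊔ γ (i + 1) = γ i :=
      le_antisymm (sup_le ((Subgroup.closure_le _).2 hA)
        (Subgroup.lowerCentralSeries_antitone _ (Nat.le_succ _))) hle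
    rwa [h3] at h2
  obtain ⟨c, hc⟩ := Subgroup.nilpotent_iff_lowerCentralSeries.1 hN
  have h0 : ∀ j ≤ c, AccOn (γ (c - j)) := by
    intro j
    induction j with
    | zero =>
      intro _ f
      refine ⟨0, fun m _ => ?_⟩
      rw [Nat.sub_zero, hγ, hc, inf_bot_eq, inf_bot_eq]
    | succ j ih =>
      intro hj
      apply step
      have : c - (j + 1) + 1 = c - j := by omega
      rw [this]
      exact ih (by omega)
  have htop : AccOn (⊤ : Subgroup G) := by
    have := h0 c le_rfl
    rwa [Nat.sub_self, hγ, Subgroup.lowerCentralSeries_zero] at this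
  refine wellFoundedGT_iff_monotone_chain_condition.2 fun f => ?_
  obtain ⟨n, hn⟩ := htop f
  exact ⟨n, fun m hm => by simpa using (hn m hm).symm⟩

end Noetherian

/-! ### Existence of Malcev bases -/

section MalcevExistence

open scoped commutatorElement

variable {G : Type*} [Group G]

theorem pow_mul_eq_of_commutator_central {x y c : G} (hc : ∀ g, c * g = g * c)
    (h : x * y = c * (y * x)) (n : ℕ) : x ^ n * y = c ^ n * (y * x ^ n) := by
  induction n with
  | zero => simp
  | succ n ih =>
    have hcx : x * c ^ n = c ^ n * x := ((show Commute c x from hc x).pow_left n).eq.symm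
    rw [pow_succ', mul_assoc, ih, ← mul_assoc, hcx, mul_assoc, ← mul_assoc x, h, pow_succ]
    simp only [mul_assoc]

/-- In a torsion-free group the upper central factors are torsion-free. -/
theorem mem_upperCentralSeries_of_pow_mem (htf : ∀ (g : G) (n : ℕ), n ≠ 0 → g ^ n = 1 → g = 1)
    {n : ℕ} (hn : n ≠ 0) (i : ℕ) :
    ∀ x ∈ Subgroup.upperCentralSeries G (i + 1), x ^ n ∈ Subgroup.upperCentralSeries G i →
      x ∈ Subgroup.upperCentralSeries G i := by
  induction i with
  | zero =>
    intro x _ hx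
    simp only [Subgroup.upperCentralSeries_zero, Subgroup.mem_bot] at hx ⊢
    exact htf x n hn hx
  | succ i ih =>
    intro x hx hxn
    rw [Subgroup.mem_upperCentralSeries_succ_iff] at hx hxn ⊢
    intro y
    refine ih _ (hx y) ?_
    -- `[x ^ n, y] = [x, y] ^ n` modulo the `i`-th term, where `[x, y]` is central
    have hc : ∀ g : G ⧸ Subgroup.upperCentralSeries G i,
        ((⁅x, y⁆ : G) : G ⧸ Subgroup.upperCentralSeries G i) * g = g * (⁅x, y⁆ : G) := by
      have h1 : ⁅x, y⁆ ∈ centralMod (Subgroup.upperCentralSeries G i) :=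
        mem_centralMod.2 fun g => (Subgroup.mem_upperCentralSeries_succ_iff.1 (hx y)) g
      intro g
      exact (Subgroup.mem_center_iff.1 h1 g).symm
    have h2 := pow_mul_eq_of_commutator_central hc
      (x := (x : G ⧸ Subgroup.upperCentralSeries G i)) (y := (y : G ⧸ _)) (by
        rw [← QuotientGroup.mk_mul, ← QuotientGroup.mk_mul, ← QuotientGroup.mk_mul,
          commutatorElement_def]
        congr 1
        group) n
    have h3 := (QuotientGroup.eq_one_iff _).2 (hxn y)
    rw [← QuotientGroup.eq_one_iff, QuotientGroup.mk_pow]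
    rw [commutatorElement_def] at h3
    simp only [QuotientGroup.mk_mul, QuotientGroup.mk_inv, QuotientGroup.mk_pow] at h3
    rw [mul_inv_eq_one, mul_inv_eq_iff_eq_mul] at h3
    rw [h3] at h2
    exact (right_eq_mul.1 h2)

theorem mem_center_of_pow_mem_center [hN : Group.IsNilpotent G]
    (htf : ∀ (g : G) (n : ℕ), n ≠ 0 → g ^ n = 1 → g = 1) {n : ℕ} (hn : n ≠ 0) {x : G}
    (hx : x ^ n ∈ Subgroup.center G) : x ∈ Subgroup.center G := by
  obtain ⟨c, hc⟩ := Group.IsNilpotent.nilpotent G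
  have h : ∀ j, x ∈ Subgroup.upperCentralSeries G (j + 1) →
      x ∈ Subgroup.upperCentralSeries G 1 := by
    intro j
    induction j with
    | zero => exact id
    | succ j ih =>
      intro hj
      refine ih (mem_upperCentralSeries_of_pow_mem htf hn (j + 1) x hj ?_)
      rw [← Subgroup.upperCentralSeries_one] at hx
      exact Subgroup.upperCentralSeries_mono G (by omega) hx
  rw [← Subgroup.upperCentralSeries_one]
  refine h c (Subgroup.upperCentralSeries_mono G (Nat.le_succ c) ?_)
  rw [hc]
  exact Subgroup.mem_top x

/-- A torsion-free nilpotent group with the ascending chain condition contains a nontrivial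
central element generating an isolated subgroup: take a maximal cyclic central subgroup. -/
theorem exists_isolated_mem_center [Nontrivial G] [Group.IsNilpotent G]
    [WellFoundedGT (Subgroup G)] (htf : ∀ (g : G) (n : ℕ), n ≠ 0 → g ^ n = 1 → g = 1) :
    ∃ z ∈ Subgroup.center G, z ≠ 1 ∧
      ∀ (y : G) (n : ℕ), n ≠ 0 → y ^ n ∈ Subgroup.zpowers z → y ∈ Subgroup.zpowers z := by
  obtain ⟨⟨z₀, hz₀⟩, hz₀1⟩ := Subgroup.ne_bot_iff_exists_ne_one.1
    (Group.IsNilpotent.center_ne_bot G)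
  obtain ⟨H, ⟨z, hz, hz1, rfl⟩, hmax⟩ := exists_maximal_of_wellFoundedGT
    (fun H : Subgroup G => ∃ z ∈ Subgroup.center G, z ≠ 1 ∧ Subgroup.zpowers z = H)
    ⟨_, z₀, hz₀, fun h => hz₀1 (Subtype.ext h), rfl⟩
  refine ⟨z, hz, hz1, fun y m hm hy => ?_⟩
  have hyc : y ∈ Subgroup.center G :=
    mem_center_of_pow_mem_center htf hm (Subgroup.zpowers_le.2 hz hy)
  obtain ⟨k, hk⟩ := Subgroup.mem_zpowers_iff.1 hy
  have hcomm : Commute z y := Subgroup.mem_center_iff.1 hyc z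
  -- divide `y ^ m = z ^ k` by the greatest common divisor of `m` and `k`
  obtain ⟨g, m', k', hg, hcop, hm', hk'⟩ : ∃ (g : ℕ) (m' k' : ℤ), g ≠ 0 ∧
      IsCoprime m' k' ∧ (m : ℤ) = m' * g ∧ k = k' * g := by
    have h0 : Int.gcd m k ≠ 0 := by
      intro h
      rw [Int.gcd_eq_zero_iff] at h
      exact hm (by exact_mod_cast h.1)
    obtain ⟨m', k', h1, h2, h3⟩ := Int.exists_gcd_one (Nat.pos_of_ne_zero h0)
    exact ⟨Int.gcd m k, m', k', h0, Int.isCoprime_iff_gcd_eq_one.2 h1, h2, h3⟩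
  have h1 : y ^ m' = z ^ k' := by
    have h2 : (z ^ (-k') * y ^ m') ^ g = 1 := by
      rw [((hcomm.zpow_left _).zpow_right _).mul_pow, ← zpow_natCast, ← zpow_natCast, ← zpow_mul,
        ← zpow_mul, neg_mul, ← hk', ← hm', zpow_natCast, ← hk, zpow_neg, inv_mul_cancel]
    have h3 := htf _ g hg h2
    rw [zpow_neg] at h3
    exact (inv_mul_eq_one.1 h3).symm
  obtain ⟨u, v, huv⟩ := hcop
  have hzt : (z ^ u * y ^ v) ^ m' = z := by
    rw [((hcomm.zpow_left _).zpow_right _).mul_zpow, ← zpow_mul, ← zpow_mul, mul_comm v m',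
      zpow_mul y, h1, ← zpow_mul, ← zpow_add, mul_comm k', huv, zpow_one]
  have hyt : (z ^ u * y ^ v) ^ k' = y := by
    rw [((hcomm.zpow_left _).zpow_right _).mul_zpow, ← zpow_mul, ← zpow_mul, mul_comm u k',
      zpow_mul z, ← h1, ← zpow_mul, ← zpow_add, mul_comm m', huv, zpow_one]
  have hle : Subgroup.zpowers z ≤ Subgroup.zpowers (z ^ u * y ^ v) :=
    Subgroup.zpowers_le.2 (Subgroup.mem_zpowers_iff.2 ⟨m', hzt⟩)
  refine hmax ⟨z ^ u * y ^ v, Subgroup.mul_mem _ (Subgroup.zpow_mem _ hz _)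
    (Subgroup.zpow_mem _ hyc _), ?_, rfl⟩ hle (Subgroup.mem_zpowers_iff.2 ⟨k', hyt⟩)
  intro h
  rw [h, one_zpow] at hzt
  exact hz1 hzt.symm

/-- `x` is a Malcev basis of its span `N`, with commutators taken in the whole group, and `N` is
an isolated normal subgroup. -/
structure IsPartialMalcevBasis {d : ℕ} (x : Fin d → G) (N : Subgroup G) : Prop where
  normal : N.Normal
  generates : tailSubgroup x 0 = N
  central : ∀ i : Fin d, ⁅tailSubgroup x i, (⊤ : Subgroup G)⁆ ≤ tailSubgroup x (i + 1)
  infinite_cyclic : ∀ (i : Fin d) (m : ℤ), x i ^ m ∈ tailSubgroup x (i + 1) → m = 0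
  isolated : ∀ (g : G) (n : ℕ), n ≠ 0 → g ^ n ∈ N → g ∈ N

theorem tailSubgroup_cons_succ {d : ℕ} (z : G) (x : Fin d → G) (i : ℕ) :
    tailSubgroup (Fin.cons z x : Fin (d + 1) → G) (i + 1) = tailSubgroup x i := by
  unfold tailSubgroup
  congr 1
  ext g
  constructor
  · rintro ⟨j, hj, rfl⟩
    induction j using Fin.cases with
    | zero => simp at hj
    | succ j => exact ⟨j, by simpa using hj, by simp⟩
  · rintro ⟨j, hj, rfl⟩
    exact ⟨j.succ, by simpa using hj, by simp⟩

theorem tailSubgroup_cons_zero {d : ℕ} (z : G) (x : Fin d → G) :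
    tailSubgroup (Fin.cons z x : Fin (d + 1) → G) 0 =
      Subgroup.closure {z} ⊔ tailSubgroup x 0 := by
  unfold tailSubgroup
  rw [← Subgroup.closure_union]
  congr 1
  ext g
  constructor
  · rintro ⟨j, -, rfl⟩
    induction j using Fin.cases with
    | zero => left; simp
    | succ j => right; exact ⟨j, by simp, by simp⟩
  · rintro (rfl | ⟨j, -, rfl⟩)
    · exact ⟨0, by simp, by simp⟩
    · exact ⟨j.succ, by simp, by simp⟩

theorem isPartialMalcevBasis_bot (htf : ∀ (g : G) (n : ℕ), n ≠ 0 → g ^ n = 1 → g = 1) :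
    IsPartialMalcevBasis (Fin.elim0 : Fin 0 → G) ⊥ where
  normal := inferInstance
  generates := by simp [tailSubgroup]
  central i := i.elim0
  infinite_cyclic i := i.elim0
  isolated g n hn hg := by
    rw [Subgroup.mem_bot] at hg ⊢
    exact htf g n hn hg

/-- A partial Malcev basis of a proper subgroup `N` is extended by an element that generates an
isolated central subgroup of `G ⧸ N`. -/
theorem IsPartialMalcevBasis.exists_cons [Group.IsNilpotent G] [hW : WellFoundedGT (Subgroup G)]
    {d : ℕ} {x : Fin d → G} {N : Subgroup G} (h : IsPartialMalcevBasis x N) (hN : N ≠ ⊤) :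
    ∃ (z : G) (N' : Subgroup G), N < N' ∧
      IsPartialMalcevBasis (Fin.cons z x : Fin (d + 1) → G) N' := by
  have := h.normal
  have hnt : Nontrivial (G ⧸ N) := QuotientGroup.nontrivial_iff.2 hN
  have htf : ∀ (g : G ⧸ N) (n : ℕ), n ≠ 0 → g ^ n = 1 → g = 1 := by
    intro g n hn hg
    induction g using QuotientGroup.induction_on with
    | H g =>
      rw [← QuotientGroup.mk_pow, QuotientGroup.eq_one_iff] at hg
      exact (QuotientGroup.eq_one_iff g).2 (h.isolated g n hn hg)
  have hW' : WellFoundedGT (Subgroup (G ⧸ N)) := by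
    have hmono : StrictMono (fun H : Subgroup (G ⧸ N) => H.comap (QuotientGroup.mk' N)) :=
      Monotone.strictMono_of_injective (fun _ _ h => Subgroup.comap_mono h)
        (Subgroup.comap_injective (QuotientGroup.mk'_surjective N))
    exact hmono.wellFoundedGT
  obtain ⟨z', hz, hz1, hiso⟩ := exists_isolated_mem_center htf
  obtain ⟨z, rfl⟩ := QuotientGroup.mk_surjective z'
  have hzN : z ∉ N := fun hz' => hz1 ((QuotientGroup.eq_one_iff z).2 hz')
  have hmem : ∀ g, g ∈ Subgroup.closure {z} ⊔ N ↔ (g : G ⧸ N) ∈ Subgroup.zpowers (z : G ⧸ N) := by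
    intro g
    rw [Subgroup.mem_sup_of_normal_right, Subgroup.mem_zpowers_iff]
    constructor
    · rintro ⟨y, hy, w, hw, rfl⟩
      obtain ⟨k, rfl⟩ := Subgroup.mem_closure_singleton.1 hy
      exact ⟨k, by rw [QuotientGroup.mk_mul, (QuotientGroup.eq_one_iff w).2 hw, mul_one]; rfl⟩
    · rintro ⟨k, hk⟩
      refine ⟨z ^ k, Subgroup.mem_closure_singleton.2 ⟨k, rfl⟩, (z ^ k)⁻¹ * g, ?_, by group⟩
      rw [← QuotientGroup.eq_one_iff, QuotientGroup.mk_mul, QuotientGroup.mk_inv,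
        QuotientGroup.mk_zpow, hk, inv_mul_cancel]
  have hcen : Subgroup.closure {z} ⊔ N ≤ centralMod N := by
    intro g hg
    exact Subgroup.zpowers_le.2 hz ((hmem g).1 hg)
  have hcomm : ⁅Subgroup.closure {z} ⊔ N, (⊤ : Subgroup G)⁆ ≤ N :=
    Subgroup.commutator_le.2 fun g hg y _ => mem_centralMod.1 (hcen hg) y
  refine ⟨z, Subgroup.closure {z} ⊔ N, ?_, ?_, ?_, ?_, ?_, ?_⟩
  · refine lt_of_le_of_ne le_sup_right fun heq => hzN ?_
    rw [heq]
    exact Subgroup.mem_sup_left (Subgroup.subset_closure rfl)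
  · refine ⟨fun g hg y => ?_⟩
    have h4 : y * g * y⁻¹ = ⁅g, y⁆⁻¹ * g := by rw [commutatorElement_def]; group
    rw [h4]
    exact Subgroup.mul_mem _ (Subgroup.inv_mem _ (Subgroup.mem_sup_right
      (mem_centralMod.1 (hcen hg) y))) hg
  · rw [tailSubgroup_cons_zero, h.generates]
  · intro i
    induction i using Fin.cases with
    | zero =>
      rw [Fin.val_zero, tailSubgroup_cons_succ, tailSubgroup_cons_zero, h.generates]
      exact hcomm
    | succ i =>
      rw [Fin.val_succ, tailSubgroup_cons_succ, tailSubgroup_cons_succ]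
      exact h.central i
  · intro i m hm
    rw [tailSubgroup_cons_succ] at hm
    induction i using Fin.cases with
    | zero =>
      rw [Fin.val_zero, h.generates, Fin.cons_zero] at hm
      by_contra hm0
      apply hzN
      refine h.isolated z m.natAbs (by simpa using hm0) ?_
      rcases Int.natAbs_eq m with h1 | h1
      · rwa [h1, zpow_natCast] at hm
      · rw [h1, zpow_neg, zpow_natCast] at hm
        simpa using N.inv_mem hm
    | succ i =>
      rw [Fin.val_succ, Fin.cons_succ] at hm
      exact h.infinite_cyclic i m hm
  · intro g m hm hg
    rw [hmem] at hg ⊢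
    rw [QuotientGroup.mk_pow] at hg
    exact hiso _ m hm hg

theorem exists_malcevBasis [Group.FG G] [Group.IsNilpotent G]
    (htf : ∀ g : G, IsOfFinOrder g → g = 1) : ∃ d : ℕ, Nonempty (MalcevBasis G d) := by
  have hW : WellFoundedGT (Subgroup G) := wellFoundedGT_subgroup_of_isNilpotent
  have htf' : ∀ (g : G) (n : ℕ), n ≠ 0 → g ^ n = 1 → g = 1 := fun g n hn hg =>
    htf g (isOfFinOrder_iff_pow_eq_one.2 ⟨n, Nat.pos_of_ne_zero hn, hg⟩)
  obtain ⟨N, ⟨d, x, hx⟩, hmax⟩ := exists_maximal_of_wellFoundedGT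
    (fun N : Subgroup G => ∃ (d : ℕ) (x : Fin d → G), IsPartialMalcevBasis x N)
    ⟨⊥, 0, _, isPartialMalcevBasis_bot htf'⟩
  have hN : N = ⊤ := by
    by_contra hN
    obtain ⟨z, N', hlt, hN'⟩ := hx.exists_cons hN
    exact not_le_of_gt hlt (hmax ⟨_, _, hN'⟩ hlt.le)
  exact ⟨d, ⟨⟨x, hx.generates.trans hN, hx.central, hx.infinite_cyclic⟩⟩⟩

end MalcevExistence

/-! ### Polynomial functions on integral points -/

section PolyFun

/-- Integer valued functions on `ℤ^σ` that are given by a polynomial over `ℚ`. -/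
def IsPolyFun {σ : Type} (f : (σ → ℤ) → ℤ) : Prop :=
  ∃ p : MvPolynomial σ ℚ, ∀ z, MvPolynomial.aeval (fun j => (z j : ℚ)) p = (f z : ℚ)

/-- A function of `z ∈ ℤ^σ` and `s ∈ ℤ` as a function on `ℤ^(σ ⊕ Unit)`. -/
def uncurryLast {σ : Type} {α : Type*} (f : (σ → ℤ) → ℤ → α) (w : σ ⊕ Unit → ℤ) : α :=
  f (fun i => w (Sum.inl i)) (w (Sum.inr ()))

variable {σ τ : Type} {f g : (σ → ℤ) → ℤ}

theorem isPolyFun_const (c : ℤ) : IsPolyFun fun _ : σ → ℤ => c :=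
  ⟨MvPolynomial.C (c : ℚ), fun z => by simp⟩

theorem isPolyFun_apply (i : σ) : IsPolyFun fun z : σ → ℤ => z i :=
  ⟨MvPolynomial.X i, fun z => by simp⟩

theorem IsPolyFun.add (hf : IsPolyFun f) (hg : IsPolyFun g) : IsPolyFun fun z => f z + g z := by
  obtain ⟨p, hp⟩ := hf
  obtain ⟨q, hq⟩ := hg
  exact ⟨p + q, fun z => by rw [map_add, hp, hq]; push_cast; rfl⟩

theorem IsPolyFun.neg (hf : IsPolyFun f) : IsPolyFun fun z => -f z := by
  obtain ⟨p, hp⟩ := hf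
  exact ⟨-p, fun z => by rw [map_neg, hp]; push_cast; rfl⟩

theorem IsPolyFun.comp {f : (τ → ℤ) → ℤ} (hf : IsPolyFun f) {g : τ → (σ → ℤ) → ℤ}
    (hg : ∀ t, IsPolyFun (g t)) : IsPolyFun fun z => f fun t => g t z := by
  obtain ⟨p, hp⟩ := hf
  choose q hq using hg
  refine ⟨MvPolynomial.aeval q p, fun z => ?_⟩
  rw [← hp, MvPolynomial.comp_aeval_apply]
  simp only [hq]

/-- Discrete antiderivatives of powers, from the Bernoulli polynomials. -/
theorem exists_antidifference_pow (k : ℕ) : ∃ F : Polynomial ℚ, F.eval 0 = 0 ∧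
    ∀ s : ℚ, F.eval (s + 1) - F.eval s = s ^ k := by
  refine ⟨Polynomial.C ((k + 1 : ℚ)⁻¹) *
    (Polynomial.bernoulli (k + 1) - Polynomial.C ((Polynomial.bernoulli (k + 1)).eval 0)),
    by simp, fun s => ?_⟩
  have h := Polynomial.bernoulli_eval_one_add (k + 1) s
  rw [add_comm 1 s] at h
  simp only [Polynomial.eval_mul, Polynomial.eval_C, Polynomial.eval_sub, h]
  have : (k + 1 : ℚ) ≠ 0 := by positivity
  push_cast
  field_simp
  ring

theorem exists_antidifference_mvPolynomial (p : MvPolynomial (σ ⊕ Unit) ℚ) :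
    ∃ P : MvPolynomial (σ ⊕ Unit) ℚ,
      (∀ z : σ → ℚ, MvPolynomial.aeval (Sum.elim z fun _ => (0 : ℚ)) P = 0) ∧
      ∀ (z : σ → ℚ) (s : ℚ), MvPolynomial.aeval (Sum.elim z fun _ => s + 1) P =
        MvPolynomial.aeval (Sum.elim z fun _ => s) P +
          MvPolynomial.aeval (Sum.elim z fun _ => s) p := by
  induction p using MvPolynomial.induction_on' with
  | add p q hp hq =>
    obtain ⟨P, hP0, hP⟩ := hp
    obtain ⟨Q, hQ0, hQ⟩ := hq
    refine ⟨P + Q, fun z => by rw [map_add, hP0, hQ0, add_zero], fun z s => ?_⟩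
    rw [map_add, map_add, map_add, hP, hQ]
    ring
  | monomial α c =>
    classical
    obtain ⟨F, hF0, hF⟩ := exists_antidifference_pow (α (Sum.inr ()))
    set m : MvPolynomial (σ ⊕ Unit) ℚ := MvPolynomial.monomial (α.erase (Sum.inr ())) c with hm
    have hmono : MvPolynomial.monomial α c = m * MvPolynomial.X (Sum.inr ()) ^ α (Sum.inr ()) := by
      rw [hm, MvPolynomial.X_pow_eq_monomial, MvPolynomial.monomial_mul, mul_one, add_comm,
        Finsupp.single_add_erase]
    have hconst : ∀ (z : σ → ℚ) (s t : ℚ), MvPolynomial.aeval (Sum.elim z fun _ => s) m =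
        MvPolynomial.aeval (Sum.elim z fun _ => t) m := by
      intro z s t
      rw [hm, MvPolynomial.aeval_monomial, MvPolynomial.aeval_monomial]
      congr 1
      refine Finsupp.prod_congr fun i hi => ?_
      rcases i with i | i
      · rfl
      · simp at hi
    have hFe : ∀ (z : σ → ℚ) (s : ℚ), MvPolynomial.aeval (Sum.elim z fun _ => s)
        (Polynomial.aeval (MvPolynomial.X (Sum.inr ()) : MvPolynomial (σ ⊕ Unit) ℚ) F) =
        F.eval s := by
      intro z s
      rw [← Polynomial.aeval_algHom_apply, MvPolynomial.aeval_X, Polynomial.aeval_def,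
        Polynomial.eval₂_eq_eval_map]
      simp
    refine ⟨m * Polynomial.aeval (MvPolynomial.X (Sum.inr ())) F, fun z => ?_, fun z s => ?_⟩
    · rw [map_mul, hFe, hF0, mul_zero]
    · rw [hmono, map_mul, map_mul, map_mul, hFe, hFe, hconst z (s + 1) s, map_pow,
        MvPolynomial.aeval_X, Sum.elim_inr, ← hF s]
      ring

/-- Sums of polynomial functions, in positive and negative range, are polynomial functions. -/
theorem exists_isPolyFun_antidifference {q : (σ → ℤ) → ℤ → ℤ} (hq : IsPolyFun (uncurryLast q)) :
    ∃ a : (σ → ℤ) → ℤ → ℤ, IsPolyFun (uncurryLast a) ∧ (∀ z, a z 0 = 0) ∧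
      ∀ z s, a z (s + 1) = a z s + q z s := by
  obtain ⟨p, hp⟩ := hq
  obtain ⟨P, hP0, hP⟩ := exists_antidifference_mvPolynomial p
  have hp' : ∀ (z : σ → ℤ) (s : ℤ), MvPolynomial.aeval
      (Sum.elim (fun i => (z i : ℚ)) fun _ => (s : ℚ)) p = (q z s : ℚ) := by
    intro z s
    refine Eq.trans ?_ (hp (Sum.elim z fun _ => s))
    congr 2
    funext i
    rcases i with i | i <;> rfl
  have hint : ∀ (z : σ → ℤ) (s : ℤ), ∃ m : ℤ, (m : ℚ) =
      MvPolynomial.aeval (Sum.elim (fun i => (z i : ℚ)) fun _ => (s : ℚ)) P := by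
    intro z s
    induction s using Int.induction_on with
    | zero => exact ⟨0, by rw [Int.cast_zero, hP0]⟩
    | succ s ih =>
      obtain ⟨m, hm⟩ := ih
      refine ⟨m + q z s, ?_⟩
      push_cast at hm ⊢
      rw [hP, ← hm]
      have := hp' z s
      push_cast at this
      rw [this]
    | pred s ih =>
      obtain ⟨m, hm⟩ := ih
      refine ⟨m - q z (-s - 1), ?_⟩
      have h1 := hP (fun i => (z i : ℚ)) ((-s - 1 : ℤ) : ℚ)
      have h2 : (((-s - 1 : ℤ) : ℚ) + 1) = ((-s : ℤ) : ℚ) := by push_cast; ring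
      rw [h2, ← hm, hp'] at h1
      rw [Int.cast_sub, h1, add_sub_cancel_right]
  choose a ha using hint
  refine ⟨a, ⟨P, fun w => ?_⟩, fun z => ?_, fun z s => ?_⟩
  · rw [uncurryLast, ha]
    congr 2
    funext i
    rcases i with i | i <;> rfl
  · have := ha z 0
    rw [Int.cast_zero, hP0] at this
    exact_mod_cast this
  · have := ha z (s + 1)
    push_cast at this
    rw [hP, ← ha, hp'] at this
    exact_mod_cast this

end PolyFun

/-! ### Existence of Hall polynomials -/

section HallExistence

open scoped commutatorElement

variable {G : Type*} [Group G] {d : ℕ}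

/-- The functions `ℤ^σ → ⟨x_j, …, x_{d-1}⟩` whose coordinates are polynomial functions. -/
def IsPolyMap (B : MalcevBasis G d) (j : ℕ) {σ : Type} (f : (σ → ℤ) → G) : Prop :=
  ∃ c : Fin d → (σ → ℤ) → ℤ, (∀ i, IsPolyFun (c i)) ∧
    ∀ z, f z = (((List.finRange d).drop j).map fun i => B.x i ^ c i z).prod

variable {B : MalcevBasis G d} {j : ℕ} {σ τ : Type}

theorem finRange_drop_eq_cons (hj : j < d) :
    (List.finRange d).drop j = (⟨j, hj⟩ : Fin d) :: (List.finRange d).drop (j + 1) := by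
  rw [List.drop_eq_getElem_cons (by simpa using hj)]
  simp

/-- A polynomial map is a power of `x_j` with polynomial exponent times a polynomial map one step
further down. -/
theorem isPolyMap_iff (hj : j < d) {f : (σ → ℤ) → G} :
    IsPolyMap B j f ↔ ∃ p : (σ → ℤ) → ℤ, IsPolyFun p ∧ ∃ f' : (σ → ℤ) → G,
      IsPolyMap B (j + 1) f' ∧ ∀ z, f z = B.x ⟨j, hj⟩ ^ p z * f' z := by
  constructor
  · rintro ⟨c, hc, hf⟩
    refine ⟨c ⟨j, hj⟩, hc _, _, ⟨c, hc, fun z => rfl⟩, fun z => ?_⟩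
    rw [hf, finRange_drop_eq_cons hj, List.map_cons, List.prod_cons]
  · rintro ⟨p, hp, f', ⟨c, hc, hf'⟩, hf⟩
    refine ⟨Function.update c ⟨j, hj⟩ p, fun i => ?_, fun z => ?_⟩
    · by_cases h : i = ⟨j, hj⟩
      · subst h; simpa using hp
      · rw [Function.update_of_ne h]; exact hc i
    · rw [hf, finRange_drop_eq_cons hj, List.map_cons, List.prod_cons, Function.update_self, hf']
      congr 2
      refine List.map_congr_left fun i hi => ?_
      obtain ⟨m, hm, rfl⟩ := List.mem_iff_getElem.1 hi
      rw [Function.update_of_ne]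
      simp [Fin.ext_iff]
      omega

theorem isPolyMap_one : IsPolyMap B j fun _ : σ → ℤ => (1 : G) :=
  ⟨fun _ _ => 0, fun _ => isPolyFun_const 0, fun z => by simp⟩

theorem IsPolyMap.eq_one {f : (σ → ℤ) → G} (hj : d ≤ j) (hf : IsPolyMap B j f) (z : σ → ℤ) :
    f z = 1 := by
  obtain ⟨c, -, hf⟩ := hf
  rw [hf, List.drop_of_length_le (by simpa using hj)]
  simp

theorem IsPolyMap.of_succ {f : (σ → ℤ) → G} (hf : IsPolyMap B (j + 1) f) : IsPolyMap B j f := by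
  by_cases hj : j < d
  · exact (isPolyMap_iff hj).2 ⟨fun _ => 0, isPolyFun_const 0, f, hf, fun z => by simp⟩
  · have : f = fun _ => 1 := funext fun z => hf.eq_one (by omega) z
    rw [this]
    exact isPolyMap_one

theorem IsPolyMap.comp {f : (τ → ℤ) → G} (hf : IsPolyMap B j f) {g : τ → (σ → ℤ) → ℤ}
    (hg : ∀ t, IsPolyFun (g t)) : IsPolyMap B j fun z => f fun t => g t z := by
  obtain ⟨c, hc, hf⟩ := hf
  exact ⟨fun i z => c i fun t => g t z, fun i => (hc i).comp hg, fun z => hf _⟩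

theorem isPolyMap_zpow (hj : j < d) {p : (σ → ℤ) → ℤ} (hp : IsPolyFun p) :
    IsPolyMap B j fun z => B.x ⟨j, hj⟩ ^ p z :=
  (isPolyMap_iff hj).2 ⟨p, hp, _, isPolyMap_one, fun z => by simp⟩

theorem isPolyMap_generator (i : Fin d) (hj : j ≤ i) : IsPolyMap B j fun _ : σ → ℤ => B.x i := by
  refine Nat.decreasingInduction (motive := fun j _ => IsPolyMap B j fun _ : σ → ℤ => B.x i)
    (fun k _ ih => ih.of_succ) ?_ hj
  simpa using isPolyMap_zpow (B := B) (σ := σ) i.2 (isPolyFun_const 1)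

/-- The closure properties of the polynomial maps into `⟨x_j, …, x_{d-1}⟩`: they form a group, and
are closed under passage from `f` to its partial products `f 0 * f 1 * ⋯ * f (s - 1)` and under
conjugation by the powers `g ^ q` with a polynomial exponent. -/
structure PolyMapsClosed (B : MalcevBasis G d) (j : ℕ) : Prop where
  mul : ∀ {σ : Type} {f g : (σ → ℤ) → G}, IsPolyMap B j f → IsPolyMap B j g →
    IsPolyMap B j fun z => f z * g z
  inv : ∀ {σ : Type} {f : (σ → ℤ) → G}, IsPolyMap B j f → IsPolyMap B j fun z => (f z)⁻¹
  partialProd : ∀ {σ : Type} {f u : (σ → ℤ) → ℤ → G}, IsPolyMap B j (uncurryLast f) →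
    (∀ z, u z 0 = 1) → (∀ z s, u z (s + 1) = u z s * f z s) → IsPolyMap B j (uncurryLast u)
  conj : ∀ {σ : Type} {f : (σ → ℤ) → G} {q : (σ → ℤ) → ℤ} (g : G), IsPolyMap B j f →
    IsPolyFun q → IsPolyMap B j fun z => g ^ (-q z) * f z * g ^ q z

theorem polyMapsClosed_of_le (hj : d ≤ j) : PolyMapsClosed B j where
  mul hf hg := by
    simp only [hf.eq_one hj, hg.eq_one hj, mul_one]
    exact isPolyMap_one
  inv hf := by
    simp only [hf.eq_one hj, inv_one]
    exact isPolyMap_one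
  partialProd {σ f u} hf h0 h1 := by
    have hf1 : ∀ z s, f z s = 1 := fun z s => hf.eq_one hj (Sum.elim z fun _ => s)
    have hu : ∀ z s, u z s = 1 := by
      intro z s
      induction s using Int.induction_on with
      | zero => exact h0 z
      | succ s ih => rw [h1, ih, hf1, mul_one]
      | pred s ih =>
        have := h1 z (-s - 1)
        rw [sub_add_cancel, ih, hf1, mul_one] at this
        exact this.symm
    have : uncurryLast u = fun _ => 1 := funext fun w => hu _ _
    rw [this]
    exact isPolyMap_one
  conj g hf hq := by
    simp only [hf.eq_one hj, mul_one, zpow_neg, inv_mul_cancel]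
    exact isPolyMap_one

namespace PolyMapsClosed

theorem isPolyMap_const (H : PolyMapsClosed B j) {g : G} (hg : g ∈ tailSubgroup B.x j) :
    IsPolyMap B j fun _ : σ → ℤ => g := by
  induction hg using Subgroup.closure_induction with
  | mem x hx =>
    obtain ⟨i, hi, rfl⟩ := hx
    exact isPolyMap_generator i hi
  | one => exact isPolyMap_one
  | mul x y _ _ hx hy => exact H.mul hx hy
  | inv x _ hx => exact H.inv hx

theorem zpow (H : PolyMapsClosed B j) {f : (σ → ℤ) → G} (hf : IsPolyMap B j f) :
    IsPolyMap B j (uncurryLast fun z s => f z ^ s) :=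
  H.partialProd (f := fun z _ => f z) (hf.comp fun i => isPolyFun_apply (Sum.inl i))
    (fun _ => zpow_zero _) (fun _ _ => zpow_add_one _ _)

/-- Substitution of a polynomial function for the last variable. -/
theorem comp_last {F : (σ → ℤ) → ℤ → G} (hF : IsPolyMap B j (uncurryLast F))
    {q : (σ → ℤ) → ℤ} (hq : IsPolyFun q) : IsPolyMap B j fun z => F z (q z) := by
  have := hF.comp (g := fun (t : σ ⊕ Unit) z => t.elim z fun _ => q z) (by
    rintro (i | i)
    · exact isPolyFun_apply i
    · exact hq)
  exact this

/-- The closure properties pass from `⟨x_{j+1}, …⟩` to `⟨x_j, …⟩`. Centrality of the series is used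
for conjugation: it moves `x_j` only by elements of `⟨x_{j+1}, …⟩`. -/
theorem of_succ (hj : j < d) (H : PolyMapsClosed B (j + 1)) : PolyMapsClosed B j := by
  set x := B.x ⟨j, hj⟩ with hx
  have hmul : ∀ {σ : Type} {f g : (σ → ℤ) → G}, IsPolyMap B j f → IsPolyMap B j g →
      IsPolyMap B j fun z => f z * g z := by
    intro σ f g hf hg
    obtain ⟨p, hp, f', hf', hf⟩ := (isPolyMap_iff hj).1 hf
    obtain ⟨q, hq, g', hg', hg⟩ := (isPolyMap_iff hj).1 hg
    refine (isPolyMap_iff hj).2 ⟨_, hp.add hq, _, H.mul (H.conj x hf' hq) hg', fun z => ?_⟩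
    rw [hf, hg, ← hx]
    group
  have hinv : ∀ {σ : Type} {f : (σ → ℤ) → G}, IsPolyMap B j f →
      IsPolyMap B j fun z => (f z)⁻¹ := by
    intro σ f hf
    obtain ⟨p, hp, f', hf', hf⟩ := (isPolyMap_iff hj).1 hf
    refine (isPolyMap_iff hj).2 ⟨_, hp.neg, _, H.conj x (H.inv hf') hp.neg, fun z => ?_⟩
    rw [hf, ← hx]
    group
  have hprod : ∀ {σ : Type} {f u : (σ → ℤ) → ℤ → G}, IsPolyMap B j (uncurryLast f) →
      (∀ z, u z 0 = 1) → (∀ z s, u z (s + 1) = u z s * f z s) →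
      IsPolyMap B j (uncurryLast u) := by
    intro σ f u hf h0 h1
    obtain ⟨q, hq, f', hf', hf⟩ := (isPolyMap_iff hj).1 hf
    -- the exponents of `x` add up to a discrete antiderivative `a`; what remains of the partial
    -- products after splitting off `x ^ a` are partial products of conjugates of `f'`
    obtain ⟨a, ha, ha0, ha1⟩ := exists_isPolyFun_antidifference
      (q := fun (z : σ → ℤ) s => q (Sum.elim z fun _ => s)) (by
        have : uncurryLast (fun (z : σ → ℤ) s => q (Sum.elim z fun _ => s)) = q := by
          funext w
          rw [uncurryLast]
          congr 1
          funext i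
          rcases i with i | i <;> rfl
        rwa [this])
    have hqz : ∀ w : σ ⊕ Unit → ℤ,
        q (Sum.elim (fun i => w (Sum.inl i)) fun _ => w (Sum.inr ())) = q w := by
      intro w
      congr 1
      funext i
      rcases i with i | i <;> rfl
    have h2 : IsPolyMap B (j + 1) (uncurryLast fun z s => u z s * x ^ (-a z s)) := by
      refine H.partialProd
        (f := fun z s => x ^ (-(-(a z s + q (Sum.elim z fun _ => s)))) *
          f' (Sum.elim z fun _ => s) * x ^ (-(a z s + q (Sum.elim z fun _ => s)))) ?_ ?_ ?_
      · have h3 := H.conj x hf' (ha.add hq).neg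
        convert h3 using 1
        funext w
        simp only [uncurryLast, hqz]
        congr 3
        funext i
        rcases i with i | i <;> rfl
      · intro z
        rw [h0, ha0]
        simp
      · intro z s
        have h3 : f z s = x ^ q (Sum.elim z fun _ => s) * f' (Sum.elim z fun _ => s) :=
          hf (Sum.elim z fun _ => s)
        rw [h1, ha1, h3]
        group
    refine (isPolyMap_iff hj).2 ⟨_, ha, _, H.conj x h2 ha, fun w => ?_⟩
    rw [← hx]
    simp only [uncurryLast]
    group
  refine ⟨hmul, hinv, hprod, ?_⟩
  intro σ f q g hf hq
  obtain ⟨p, hp, f', hf', hf⟩ := (isPolyMap_iff hj).1 hf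
  have hc : ⁅x⁻¹, g⁻¹⁆ ∈ tailSubgroup B.x (j + 1) :=
    B.central ⟨j, hj⟩ (Subgroup.commutator_mem_commutator
      (Subgroup.inv_mem _ (Subgroup.subset_closure ⟨⟨j, hj⟩, le_refl j, rfl⟩))
      (Subgroup.mem_top _))
  -- `x⁻¹ (g ^ (-t) x g ^ t)` is a partial product of conjugates of the commutator
  have hu : IsPolyMap B j (uncurryLast fun (_ : σ → ℤ) (t : ℤ) => x⁻¹ * (g ^ (-t) * x * g ^ t)) :=
    hprod (f := fun _ t => g ^ (-t) * ⁅x⁻¹, g⁻¹⁆ * g ^ t)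
      ((H.conj g (H.isPolyMap_const hc) (isPolyFun_apply (Sum.inr ()))).of_succ)
      (fun z => by simp) (fun z s => by rw [commutatorElement_def]; group)
  have hxq : IsPolyMap B j fun z => g ^ (-q z) * x * g ^ q z := by
    have h1 := hmul (isPolyMap_generator (B := B) ⟨j, hj⟩ (le_refl j))
      (comp_last hu hq)
    simpa only [← hx, mul_inv_cancel_left] using h1
  have hxp : IsPolyMap B j fun z => (g ^ (-q z) * x * g ^ q z) ^ p z :=
    comp_last (hprod (f := fun z _ => g ^ (-q z) * x * g ^ q z)
      (u := fun z s => (g ^ (-q z) * x * g ^ q z) ^ s)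
      (hxq.comp fun i => isPolyFun_apply (Sum.inl i))
      (fun _ => zpow_zero _) (fun _ _ => zpow_add_one _ _)) hp
  have h2 := hmul hxp (H.conj g hf' hq).of_succ
  convert h2 using 1
  funext z
  have h3 : (g ^ (-q z) * x * g ^ q z) ^ p z = g ^ (-q z) * x ^ p z * g ^ q z := by
    have := conj_zpow (i := p z) (a := g ^ (-q z)) (b := x)
    rwa [zpow_neg, inv_inv, ← zpow_neg] at this
  rw [h3, hf, ← hx]
  group

end PolyMapsClosed

theorem polyMapsClosed (B : MalcevBasis G d) (j : ℕ) : PolyMapsClosed B j := by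
  rcases le_total d j with hj | hj
  · exact polyMapsClosed_of_le hj
  · exact Nat.decreasingInduction (motive := fun j _ => PolyMapsClosed B j)
      (fun _ hk ih => ih.of_succ hk) (polyMapsClosed_of_le le_rfl) hj

theorem isPolyMap_zero_iff {f : (σ → ℤ) → G} :
    IsPolyMap B 0 f ↔ ∃ c : Fin d → (σ → ℤ) → ℤ, (∀ i, IsPolyFun (c i)) ∧
      ∀ z, f z = B.elt fun i => c i z := by
  simp only [IsPolyMap, MalcevBasis.elt, List.drop_zero, List.ofFn_eq_map]

/-- The Hall polynomials are the coordinates of `(a, b) ↦ x(a) x(b)` and `(a, m) ↦ x(a) ^ m`. -/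
theorem nonempty_hallPolynomials (B : MalcevBasis G d) : Nonempty (HallPolynomials B) := by
  have H := polyMapsClosed B 0
  obtain ⟨c, hc, hmul⟩ := isPolyMap_zero_iff.1 (H.mul
    (isPolyMap_zero_iff.2 ⟨fun i (z : Fin d ⊕ Fin d → ℤ) => z (Sum.inl i),
      fun i => isPolyFun_apply _, fun z => rfl⟩)
    (isPolyMap_zero_iff.2 ⟨fun i (z : Fin d ⊕ Fin d → ℤ) => z (Sum.inr i),
      fun i => isPolyFun_apply _, fun z => rfl⟩))
  obtain ⟨e, he, hpow⟩ := isPolyMap_zero_iff.1 (H.zpow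
    (isPolyMap_zero_iff.2 ⟨fun i (z : Fin d → ℤ) => z i, fun i => isPolyFun_apply _, fun z => rfl⟩))
  choose μ hμ using hc
  choose lam hlam using he
  refine ⟨⟨μ, lam, fun a b => ⟨_, hmul (Sum.elim a b), fun i => ?_⟩,
    fun a m => ⟨_, hpow (Sum.elim a fun _ => m), fun i => ?_⟩⟩⟩
  · rw [← hμ]
    congr 2
    funext i
    rcases i with i | i <;> rfl
  · rw [← hlam]
    congr 2
    funext i
    rcases i with i | i <;> rfl

end HallExistence

/-! ### The shape of the multiplication polynomials -/

section MulShape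

open scoped commutatorElement

variable {G : Type*} [Group G] {d : ℕ} {B : MalcevBasis G d}

theorem exists_eq_prod_of_mem_tailSubgroup {j : ℕ} {t : G} (ht : t ∈ tailSubgroup B.x j) :
    ∃ c : Fin d → ℤ, t = (((List.finRange d).drop j).map fun i => B.x i ^ c i).prod := by
  obtain ⟨c, -, hc⟩ := (polyMapsClosed B j).isPolyMap_const (σ := Empty) ht
  exact ⟨fun i => c i Empty.elim, hc Empty.elim⟩

theorem MalcevBasis.elt_surjective (B : MalcevBasis G d) : Function.Surjective B.elt := by
  intro g
  obtain ⟨c, hc⟩ := exists_eq_prod_of_mem_tailSubgroup (B := B) (j := 0) (t := g)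
    (by rw [B.generates]; exact Subgroup.mem_top g)
  exact ⟨c, by rw [hc, MalcevBasis.elt, List.drop_zero, List.ofFn_eq_map]⟩

theorem mem_drop_finRange {j : ℕ} {i : Fin d} (hi : i ∈ (List.finRange d).drop j) :
    j ≤ (i : ℕ) := by
  obtain ⟨m, hm, rfl⟩ := List.mem_iff_getElem.1 hi
  simp

theorem mem_tailSubgroup (x : Fin d → G) {j : ℕ} {i : Fin d} (h : j ≤ (i : ℕ)) :
    x i ∈ tailSubgroup x j :=
  Subgroup.subset_closure (Set.mem_image_of_mem x h)

theorem prod_drop_mem_tailSubgroup (B : MalcevBasis G d) (j : ℕ) (c : Fin d → ℤ) :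
    (((List.finRange d).drop j).map fun i => B.x i ^ c i).prod ∈ tailSubgroup B.x j := by
  apply Subgroup.list_prod_mem
  intro y hy
  obtain ⟨i, hi, rfl⟩ := List.mem_map.1 hy
  exact Subgroup.zpow_mem _ (mem_tailSubgroup B.x (mem_drop_finRange hi)) _

theorem MalcevBasis.elt_eq_take_mul_drop (B : MalcevBasis G d) (j : ℕ) (c : Fin d → ℤ) :
    B.elt c = (((List.finRange d).take j).map fun i => B.x i ^ c i).prod *
      (((List.finRange d).drop j).map fun i => B.x i ^ c i).prod := by
  rw [← List.prod_append, ← List.map_append, List.take_append_drop, MalcevBasis.elt,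
    List.ofFn_eq_map]

theorem mem_take_finRange {j : ℕ} {i : Fin d} (hi : i ∈ (List.finRange d).take j) :
    (i : ℕ) < j := by
  obtain ⟨m, hm, rfl⟩ := List.mem_iff_getElem.1 hi
  simp only [List.length_take, List.length_finRange] at hm
  simp
  omega

/-- Right multiplication by an element of `⟨x_j, …⟩` does not change the coordinates before `j`. -/
theorem elt_coord_eq_of_mul_mem {j : ℕ} {a c : Fin d → ℤ} {t : G}
    (ht : t ∈ tailSubgroup B.x j) (h : B.elt c = B.elt a * t) {i : Fin d} (hi : (i : ℕ) < j) :
    c i = a i := by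
  obtain ⟨w, hw⟩ := exists_eq_prod_of_mem_tailSubgroup
    (Subgroup.mul_mem _ (prod_drop_mem_tailSubgroup B j a) ht)
  have h1 : B.elt c = B.elt fun i => if (i : ℕ) < j then a i else w i := by
    rw [h, B.elt_eq_take_mul_drop j a, mul_assoc, hw, B.elt_eq_take_mul_drop j]
    congr 2
    · exact List.map_congr_left fun i hi => by rw [if_pos (mem_take_finRange hi)]
    · exact List.map_congr_left fun i hi => by rw [if_neg (not_lt.2 (mem_drop_finRange hi))]
  rw [B.elt_injective h1]
  exact if_pos hi

/-- The coordinates before `i`, the others being replaced by `0`. -/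
def truncCoord {α : Type*} [Zero α] (i : Fin d) (a : Fin d → α) : Fin d → α :=
  fun j => if j < i then a j else 0

theorem elt_eq_truncCoord_mul (B : MalcevBasis G d) (i : Fin d) (a : Fin d → ℤ) :
    ∃ t ∈ tailSubgroup B.x (i + 1), B.elt a = B.elt (truncCoord i a) * B.x i ^ a i * t := by
  refine ⟨_, prod_drop_mem_tailSubgroup B (i + 1) a, ?_⟩
  have h1 : B.elt (truncCoord i a) =
      (((List.finRange d).take i).map fun i => B.x i ^ a i).prod := by
    rw [B.elt_eq_take_mul_drop i]
    have h2 : (((List.finRange d).drop i).map fun j => B.x j ^ truncCoord i a j).prod = 1 := by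
      apply List.prod_eq_one
      intro y hy
      obtain ⟨j, hj, rfl⟩ := List.mem_map.1 hy
      rw [truncCoord, if_neg (not_lt.2 (by exact mem_drop_finRange hj)), zpow_zero]
    rw [h2, mul_one]
    congr 1
    refine List.map_congr_left fun j hj => ?_
    rw [truncCoord, if_pos (by exact mem_take_finRange hj)]
  rw [h1, B.elt_eq_take_mul_drop i, finRange_drop_eq_cons i.2, List.map_cons, List.prod_cons,
    mul_assoc]

theorem tailSubgroup_antitone (x : Fin d → G) {i j : ℕ} (h : i ≤ j) :
    tailSubgroup x j ≤ tailSubgroup x i :=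
  Subgroup.closure_mono (Set.image_mono fun _ hk => h.trans hk)

theorem MalcevBasis.normal_tailSubgroup_succ (B : MalcevBasis G d) (i : Fin d) :
    (tailSubgroup B.x (i + 1)).Normal := by
  refine ⟨fun t ht g => ?_⟩
  have h1 : ⁅g, t⁆ ∈ tailSubgroup B.x (i + 1) := by
    rw [← commutatorElement_inv]
    exact Subgroup.inv_mem _ (B.central i (Subgroup.commutator_mem_commutator
      (tailSubgroup_antitone B.x (Nat.le_succ _) ht) (Subgroup.mem_top g)))
  have h2 : g * t * g⁻¹ = ⁅g, t⁆ * t := by rw [commutatorElement_def]; group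
  rw [h2]
  exact Subgroup.mul_mem _ h1 ht

/-- The `i`-th coordinate of a product: modulo `⟨x_{i+1}, …⟩` the element `x_i` is central. -/
theorem coord_mul_eq {a b c c' : Fin d → ℤ} {i : Fin d} (hc : B.elt a * B.elt b = B.elt c)
    (hc' : B.elt (truncCoord i a) * B.elt (truncCoord i b) = B.elt c') :
    c i = a i + b i + c' i := by
  have hn := B.normal_tailSubgroup_succ i
  let π := QuotientGroup.mk' (tailSubgroup B.x (i + 1))
  have hπ : ∀ e : Fin d → ℤ, π (B.elt e) = π (B.elt (truncCoord i e)) * π (B.x i) ^ e i := by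
    intro e
    obtain ⟨t, ht, he⟩ := elt_eq_truncCoord_mul B i e
    have h1 : π t = 1 := (QuotientGroup.eq_one_iff t).2 ht
    rw [he, map_mul, map_mul, h1, mul_one, map_zpow]
  have hcen : ∀ g : G, Commute (π (B.x i)) (π g) := by
    intro g
    have h1 : ⁅B.x i, g⁆ ∈ tailSubgroup B.x (i + 1) := B.central i
      (Subgroup.commutator_mem_commutator (mem_tailSubgroup B.x le_rfl)
        (Subgroup.mem_top g))
    have h2 : π ⁅B.x i, g⁆ = 1 := (QuotientGroup.eq_one_iff _).2 h1
    rw [map_commutatorElement] at h2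
    exact commutatorElement_eq_one_iff_mul_comm.1 h2
  set e := Function.update c' i (a i + b i + c' i) with he
  have h1 : π (B.elt c) = π (B.elt e) := by
    have h2 : truncCoord i e = truncCoord i c' := by
      funext j
      simp only [truncCoord]
      split_ifs with hj
      · rw [he, Function.update_of_ne hj.ne]
      · rfl
    have h3 := congrArg π hc'
    rw [map_mul, hπ c'] at h3
    rw [hπ e, h2, he, Function.update_self, ← hc, map_mul, hπ a, hπ b]
    have h4 := ((hcen (B.elt (truncCoord i b))).zpow_left (a i)).eq
    calc _ = π (B.elt (truncCoord i a)) * (π (B.x i) ^ a i * π (B.elt (truncCoord i b))) *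
          π (B.x i) ^ b i := by simp only [mul_assoc]
      _ = π (B.elt (truncCoord i a)) * π (B.elt (truncCoord i b)) *
          (π (B.x i) ^ a i * π (B.x i) ^ b i) := by rw [h4]; simp only [mul_assoc]
      _ = _ := by
        rw [h3, mul_assoc, ← zpow_add, ← zpow_add, add_comm (c' i)]
  have h4 : (B.elt e)⁻¹ * B.elt c ∈ tailSubgroup B.x (i + 1) := QuotientGroup.eq.1 h1.symm
  have h5 := elt_coord_eq_of_mul_mem h4 (by rw [mul_inv_cancel_left]) (Nat.lt_succ_self i)
  rw [h5, he, Function.update_self]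

namespace HallPolynomials

variable {A : Type*} [CommRing A] [Algebra ℚ A]

theorem map_truncCoord {A' : Type*} [CommRing A'] [Algebra ℚ A'] (f : A →ₐ[ℚ] A') (i : Fin d)
    (a : Fin d → A) : f ∘ truncCoord i a = truncCoord i (f ∘ a) := by
  funext j
  simp only [Function.comp_apply, truncCoord]
  split_ifs <;> simp

theorem aeval_X_add_X_add_mulCoord (P : HallPolynomials B) (i : Fin d)
    {Xl Xr : Fin d → MvPolynomial (Fin d ⊕ Fin d) ℚ}
    (hl : Xl = fun j => MvPolynomial.X (Sum.inl j)) (hr : Xr = fun j => MvPolynomial.X (Sum.inr j))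
    (v : Fin d ⊕ Fin d → A) :
    MvPolynomial.aeval v (Xl i + Xr i + P.mulCoord (truncCoord i Xl) (truncCoord i Xr) i) =
      v (Sum.inl i) + v (Sum.inr i) + P.mulCoord (truncCoord i fun j => v (Sum.inl j))
        (truncCoord i fun j => v (Sum.inr j)) i := by
  have h := congrFun (P.map_mulCoord (MvPolynomial.aeval v) (truncCoord i Xl) (truncCoord i Xr)) i
  rw [map_truncCoord, map_truncCoord] at h
  rw [map_add, map_add]
  refine congr_arg₂ _ (by simp [hl, hr]) (h.trans ?_)
  congr 2 <;>
  · funext j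
    simp [hl, hr]

/-- `μ_i(a, b) = a_i + b_i + μ_i(a', b')`, where `a'`, `b'` keep only the coordinates before `i`. -/
theorem mulCoord_eq_add (P : HallPolynomials B) (a b : Fin d → A) (i : Fin d) :
    P.mulCoord a b i = a i + b i + P.mulCoord (truncCoord i a) (truncCoord i b) i := by
  obtain ⟨Xl, hl⟩ : ∃ Xl : Fin d → MvPolynomial (Fin d ⊕ Fin d) ℚ,
    Xl = fun j => MvPolynomial.X (Sum.inl j) := ⟨_, rfl⟩
  obtain ⟨Xr, hr⟩ : ∃ Xr : Fin d → MvPolynomial (Fin d ⊕ Fin d) ℚ,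
    Xr = fun j => MvPolynomial.X (Sum.inr j) := ⟨_, rfl⟩
  have h1 := aeval_eq_of_int (A := A) (p := P.μ i)
    (q := Xl i + Xr i + P.mulCoord (truncCoord i Xl) (truncCoord i Xr) i) (by
      intro z
      rw [P.aeval_X_add_X_add_mulCoord i hl hr]
      obtain ⟨c, hc, hc'⟩ := P.elt_mulCoord (fun j => z (Sum.inl j)) (fun j => z (Sum.inr j))
      obtain ⟨e, he, he'⟩ := P.elt_mulCoord (truncCoord i fun j => z (Sum.inl j))
        (truncCoord i fun j => z (Sum.inr j))
      have h2 : ∀ f : Fin d → ℤ, (fun j => ((truncCoord i f j : ℤ) : ℚ)) =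
          truncCoord i fun j => (f j : ℚ) := by
        intro f
        funext j
        simp only [truncCoord]
        split_ifs <;> simp
      rw [h2, h2] at he'
      rw [he', ← Int.cast_add, ← Int.cast_add, ← coord_mul_eq hc he, ← congrFun hc' i, mulCoord]
      congr 2
      funext j
      rcases j with j | j <;> rfl) (Sum.elim a b)
  rw [P.aeval_X_add_X_add_mulCoord i hl hr] at h1
  exact h1

end HallPolynomials

end MulShape

/-! ### Unitriangular representations from right translations of polynomials -/

section WeightFiltration

open MvPolynomial

variable {ι : Type*} {A : Type*} [CommRing A]

/-- The polynomials all of whose monomials have weight less than `m`, where the variable `X i` has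
weight `w i`. -/
def weightLT (A : Type*) [CommRing A] (w : ι → ℕ) (m : ℕ) : Submodule A (MvPolynomial ι A) where
  carrier := {f | ∀ β, m ≤ Finsupp.weight w β → coeff β f = 0}
  add_mem' hf hg β hβ := by rw [coeff_add, hf β hβ, hg β hβ, add_zero]
  zero_mem' β _ := coeff_zero β
  smul_mem' c f hf β hβ := by rw [coeff_smul, hf β hβ, smul_zero]

variable {w : ι → ℕ} {m l : ℕ} {f g : MvPolynomial ι A}

theorem weightLT_mono (h : m ≤ l) : weightLT A w m ≤ weightLT A w l :=
  fun _ hf β hβ => hf β (h.trans hβ)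

theorem mul_mem_weightLT (hf : f ∈ weightLT A w m) (hg : g ∈ weightLT A w (l + 1)) :
    f * g ∈ weightLT A w (m + l) := by
  classical
  intro β hβ
  rw [coeff_mul]
  refine Finset.sum_eq_zero fun p hp => ?_
  rw [Finset.HasAntidiagonal.mem_antidiagonal] at hp
  rw [← hp, map_add] at hβ
  by_cases h : m ≤ Finsupp.weight w p.1
  · rw [hf _ h, zero_mul]
  · rw [hg _ (by omega), mul_zero]

theorem monomial_mem_weightLT (α : ι →₀ ℕ) (c : A) :
    monomial α c ∈ weightLT A w (Finsupp.weight w α + 1) := by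
  classical
  intro β hβ
  rw [coeff_monomial, if_neg]
  rintro rfl
  omega

theorem C_mem_weightLT (c : A) : C c ∈ weightLT A w (0 + 1) := by
  simpa using monomial_mem_weightLT (w := w) (0 : ι →₀ ℕ) c

theorem prod_pow_mem_weightLT {σ : Type*} {e : ℕ} {v : σ → MvPolynomial ι A}
    (hv : ∀ t, v t ∈ weightLT A w (e + 1)) (s : Finset σ) (α : σ → ℕ) :
    ∏ t ∈ s, v t ^ α t ∈ weightLT A w ((∑ t ∈ s, α t) * e + 1) := by
  have hpow : ∀ t k, v t ^ k ∈ weightLT A w (k * e + 1) := by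
    intro t k
    induction k with
    | zero => simpa using C_mem_weightLT (w := w) (1 : A)
    | succ k ih =>
      rw [pow_succ, Nat.succ_mul, add_right_comm]
      exact mul_mem_weightLT ih (hv t)
  classical
  induction s using Finset.induction_on with
  | empty => simpa using C_mem_weightLT (w := w) (1 : A)
  | insert t s ht ih =>
    rw [Finset.prod_insert ht, Finset.sum_insert ht, add_mul, add_right_comm]
    exact mul_mem_weightLT (hpow t _) ih

/-- Substituting polynomials of weight at most `e` multiplies degrees by at most `e`. -/
theorem aeval_mem_weightLT [Algebra ℚ A] {σ : Type*} {e K : ℕ} {v : σ → MvPolynomial ι A}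
    (hv : ∀ t, v t ∈ weightLT A w (e + 1)) {p : MvPolynomial σ ℚ} (hp : p.totalDegree ≤ K) :
    aeval v p ∈ weightLT A w (K * e + 1) := by
  rw [aeval_def, eval₂_eq]
  refine Submodule.sum_mem _ fun α hα => ?_
  rw [IsScalarTower.algebraMap_apply ℚ A, algebraMap_eq, ← smul_eq_C_mul]
  refine Submodule.smul_mem _ _ (weightLT_mono ?_ (prod_pow_mem_weightLT hv α.support α))
  have h1 : ∑ t ∈ α.support, α t ≤ K := (le_totalDegree hα).trans hp
  gcongr

end WeightFiltration

namespace HallPolynomials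

open MvPolynomial

variable {G : Type*} [Group G] {d : ℕ} {B : MalcevBasis G d} (P : HallPolynomials B)
variable {A : Type*} [CommRing A] [Algebra ℚ A]

/-- Right translation of polynomial functions, `f(a) ↦ f(μ(a, b))`. -/
noncomputable def translate (b : Fin d → A) : MvPolynomial (Fin d) A →ₐ[A] MvPolynomial (Fin d) A :=
  aeval (P.mulCoord X fun j => C (b j))

theorem translate_X (b : Fin d → A) (i : Fin d) :
    P.translate b (X i) = P.mulCoord X (fun j => C (b j)) i :=
  aeval_X _ _

theorem translate_translate (b c : Fin d → A) (f : MvPolynomial (Fin d) A) :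
    P.translate b (P.translate c f) = P.translate (P.mulCoord b c) f := by
  have h : (P.translate b).comp (P.translate c) = P.translate (P.mulCoord b c) := by
    refine MvPolynomial.algHom_ext fun i => ?_
    have h1 := congrFun (P.map_mulCoord ((P.translate b).restrictScalars ℚ) X fun j => C (c j)) i
    have h2 := P.map_mulCoord (IsScalarTower.toAlgHom ℚ A (MvPolynomial (Fin d) A)) b c
    have h3 : ((P.translate b).restrictScalars ℚ : _ → MvPolynomial (Fin d) A) ∘ X =
        P.mulCoord X fun j => C (b j) := by
      funext j
      simp [translate]
    have h4 : ((P.translate b).restrictScalars ℚ : _ → MvPolynomial (Fin d) A) ∘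
        (fun j => C (c j)) = fun j => C (c j) := by
      funext j
      simp [translate]
    rw [h3, h4, mulCoord_assoc] at h1
    rw [AlgHom.comp_apply, translate_X, translate_X]
    refine h1.trans ?_
    exact (congrFun (congrArg (P.mulCoord X) h2) i).symm
  exact DFunLike.congr_fun h f

theorem map_translate_monomial {A' : Type*} [CommRing A'] [Algebra ℚ A'] (f : A →ₐ[ℚ] A')
    (b : Fin d → A) (α : Fin d →₀ ℕ) :
    mapAlgHom f (P.translate b (monomial α 1)) = P.translate (f ∘ b) (monomial α 1) := by
  have h1 := P.map_mulCoord (mapAlgHom f : MvPolynomial (Fin d) A →ₐ[ℚ] _) X fun j => C (b j)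
  have h2 : (mapAlgHom f : MvPolynomial (Fin d) A →ₐ[ℚ] MvPolynomial (Fin d) A') ∘ X = X := by
    funext j
    simp
  have h3 : (mapAlgHom f : MvPolynomial (Fin d) A →ₐ[ℚ] MvPolynomial (Fin d) A') ∘
      (fun j => C (b j)) = fun j => C ((f ∘ b) j) := by
    funext j
    simp
  rw [h2, h3] at h1
  rw [translate, translate, aeval_monomial, aeval_monomial, ← h1]
  simp [Finsupp.prod]

/-- The weights `D^i` of the coordinates, where `D` exceeds the degrees of the polynomials `μ`. -/
def coordWeight (i : Fin d) : ℕ :=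
  (1 + Finset.univ.sup fun j => (P.μ j).totalDegree) ^ (i : ℕ)

theorem translate_X_sub_mem (b : Fin d → A) (i : Fin d) :
    P.translate b (X i) - X i ∈ weightLT A P.coordWeight (P.coordWeight i) := by
  set K := Finset.univ.sup fun j => (P.μ j).totalDegree with hK
  have hw : ∀ j, P.coordWeight j = (1 + K) ^ (j : ℕ) := fun j => rfl
  have hpos : 0 + 1 ≤ P.coordWeight i := by rw [hw]; exact Nat.one_le_pow _ _ (by omega)
  rw [translate, aeval_X, mulCoord_eq_add, add_assoc, add_sub_cancel_left]
  refine Submodule.add_mem _ (weightLT_mono hpos (C_mem_weightLT _)) ?_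
  -- the remaining term involves only the variables of weight at most `e`
  obtain ⟨e, he, hev⟩ : ∃ e, K * e + 1 ≤ P.coordWeight i ∧
      ∀ j < i, P.coordWeight j ≤ e := by
    rcases Nat.eq_zero_or_pos (i : ℕ) with h0 | h0
    · refine ⟨0, by simpa using hpos, fun j hj => ?_⟩
      have : (j : ℕ) < i := hj
      omega
    · refine ⟨(1 + K) ^ ((i : ℕ) - 1), ?_, fun j hj => ?_⟩
      · have h1 : (1 + K) ^ (i : ℕ) = (1 + K) * (1 + K) ^ ((i : ℕ) - 1) := by
          rw [← pow_succ', Nat.sub_add_cancel h0]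
        rw [hw, h1, add_mul, one_mul, add_comm]
        have := Nat.one_le_pow ((i : ℕ) - 1) (1 + K) (by omega)
        omega
      · have : (j : ℕ) < i := hj
        rw [hw]
        exact Nat.pow_le_pow_right (by omega) (by omega)
  refine weightLT_mono he (aeval_mem_weightLT ?_
    (Finset.le_sup (f := fun j => (P.μ j).totalDegree) (Finset.mem_univ i)))
  rintro (j | j)
  · rw [Sum.elim_inl, truncCoord]
    split_ifs with hj
    · refine weightLT_mono ?_ (monomial_mem_weightLT (Finsupp.single j 1) (1 : A))
      have := hev j hj
      rw [Finsupp.weight_single, one_smul]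
      omega
    · exact Submodule.zero_mem _
  · rw [Sum.elim_inr, truncCoord]
    split_ifs with hj
    · exact weightLT_mono (by omega) (C_mem_weightLT _)
    · exact Submodule.zero_mem _

/-- Right translations are unipotent: they change a monomial by terms of smaller weight. -/
theorem translate_monomial_sub_mem (b : Fin d → A) (α : Fin d →₀ ℕ) :
    P.translate b (monomial α 1) - monomial α 1 ∈
      weightLT A P.coordWeight (Finsupp.weight P.coordWeight α) := by
  have hadd : ∀ α β : Fin d →₀ ℕ,
      P.translate b (monomial α 1) - monomial α 1 ∈
        weightLT A P.coordWeight (Finsupp.weight P.coordWeight α) →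
      P.translate b (monomial β 1) - monomial β 1 ∈
        weightLT A P.coordWeight (Finsupp.weight P.coordWeight β) →
      P.translate b (monomial (α + β) 1) - monomial (α + β) 1 ∈
        weightLT A P.coordWeight (Finsupp.weight P.coordWeight (α + β)) := by
    intro α β hα hβ
    have h1 : (monomial (α + β) (1 : A)) = monomial α 1 * monomial β 1 := by
      rw [monomial_mul, one_mul]
    have h2 : P.translate b (monomial β 1) ∈
        weightLT A P.coordWeight (Finsupp.weight P.coordWeight β + 1) := by
      have := Submodule.add_mem _ (weightLT_mono (Nat.le_succ _) hβ)
        (monomial_mem_weightLT (w := P.coordWeight) β (1 : A))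
      rwa [sub_add_cancel] at this
    have h3 : P.translate b (monomial (α + β) 1) - monomial (α + β) 1 =
        (P.translate b (monomial α 1) - monomial α 1) * P.translate b (monomial β 1) +
          (P.translate b (monomial β 1) - monomial β 1) * monomial α 1 := by
      rw [h1, map_mul]
      ring
    rw [h3, map_add]
    refine Submodule.add_mem _ (mul_mem_weightLT hα h2) ?_
    rw [add_comm]
    exact mul_mem_weightLT hβ (monomial_mem_weightLT α 1)
  have hzero : P.translate b (monomial 0 1) - monomial 0 1 ∈
      weightLT A P.coordWeight (Finsupp.weight P.coordWeight (0 : Fin d →₀ ℕ)) := by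
    have : (monomial 0 1 : MvPolynomial (Fin d) A) = 1 := rfl
    rw [this, map_one, sub_self]
    exact Submodule.zero_mem _
  induction α using Finsupp.induction_linear with
  | zero => exact hzero
  | add α β hα hβ => exact hadd α β hα hβ
  | single i k =>
    induction k with
    | zero => rw [Finsupp.single_zero]; exact hzero
    | succ k ih =>
      rw [Finsupp.single_add]
      refine hadd _ _ ih ?_
      rw [Finsupp.weight_single, one_smul]
      exact P.translate_X_sub_mem b i

theorem coeff_translate_monomial_self (b : Fin d → A) (α : Fin d →₀ ℕ) :
    coeff α (P.translate b (monomial α 1)) = 1 := by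
  have := P.translate_monomial_sub_mem b α α le_rfl
  rw [coeff_sub, coeff_monomial, if_pos rfl, sub_eq_zero] at this
  exact this

theorem coeff_translate_monomial_of_ne (b : Fin d → A) {α β : Fin d →₀ ℕ} (hne : β ≠ α)
    (h : Finsupp.weight P.coordWeight α ≤ Finsupp.weight P.coordWeight β) :
    coeff β (P.translate b (monomial α 1)) = 0 := by
  have := P.translate_monomial_sub_mem b α β h
  rwa [coeff_sub, coeff_monomial, if_neg hne.symm, sub_zero] at this

theorem coeff_zero_translate_X (b : Fin d → A) (i : Fin d) :
    coeff 0 (P.translate b (monomial (Finsupp.single i 1) 1)) = b i := by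
  have h1 := P.map_mulCoord
    ((aeval (0 : Fin d → A) : MvPolynomial (Fin d) A →ₐ[A] A).restrictScalars ℚ)
    X fun j => C (b j)
  have h2 : ((aeval (0 : Fin d → A) : MvPolynomial (Fin d) A →ₐ[A] A).restrictScalars ℚ : _ → A) ∘
      X = 0 := by
    funext j
    simp
  have h3 : ((aeval (0 : Fin d → A) : MvPolynomial (Fin d) A →ₐ[A] A).restrictScalars ℚ : _ → A) ∘
      (fun j => C (b j)) = b := by
    funext j
    simp
  rw [h2, h3, zero_mulCoord] at h1
  have h4 : (monomial (Finsupp.single i 1) (1 : A)) = X i := rfl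
  rw [h4, translate_X, ← congrFun h1 i]
  change constantCoeff _ = aeval (0 : Fin d → A) _
  rw [aeval_zero]
  rfl

/-- The representation by right translations on the polynomials of bounded weight. -/
theorem exists_isUnipotentEmbedding (A : Type*) [CommRing A] [Algebra ℚ A] :
    ∃ (n : ℕ) (ρ : Matrix (Fin n) (Fin n) (MvPolynomial (Fin d) ℚ)),
      P.IsUnipotentEmbedding A ρ := by
  classical
  set K := Finset.univ.sup fun j => (P.μ j).totalDegree with hK
  set wt : (Fin d →₀ ℕ) →+ ℕ := Finsupp.weight P.coordWeight with hwt
  have hw : ∀ j, P.coordWeight j = (1 + K) ^ (j : ℕ) := fun j => rfl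
  have hfin : {α : Fin d →₀ ℕ | wt α ≤ (1 + K) ^ d}.Finite := by
    refine (Set.finite_Icc (0 : Fin d →₀ ℕ)
      (Finsupp.equivFunOnFinite.symm fun _ => (1 + K) ^ d)).subset fun α hα => ⟨zero_le, ?_⟩
    intro i
    have h1 : P.coordWeight i ≠ 0 := by
      rw [hw]
      exact pow_ne_zero _ (by omega)
    exact (Finsupp.le_weight P.coordWeight h1 α).trans hα
  obtain ⟨s, hs⟩ := hfin.exists_finset
  have hs' : ∀ α, α ∈ s ↔ wt α ≤ (1 + K) ^ d := hs
  -- enumerate the monomials by increasing weight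
  set f : Fin s.card → ℕ := fun i => wt (s.equivFin.symm i).1 with hf
  let σ : Fin s.card ≃ s := (Tuple.sort f).trans s.equivFin.symm
  have hmono : ∀ i j, i ≤ j → wt (σ i).1 ≤ wt (σ j).1 := fun i j hij => Tuple.monotone_sort f hij
  let ρ : Matrix (Fin s.card) (Fin s.card) (MvPolynomial (Fin d) ℚ) := fun i j =>
    coeff (σ i).1 (P.translate X (monomial (σ j).1 1))
  have hρ : ∀ (g : P.Points A) i j,
      evalMatrix ρ g i j = coeff (σ i).1 (P.translate g.coord (monomial (σ j).1 1)) := by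
    intro g i j
    have h1 := P.map_translate_monomial (aeval g.coord : MvPolynomial (Fin d) ℚ →ₐ[ℚ] A) X (σ j).1
    have h2 : (aeval g.coord : MvPolynomial (Fin d) ℚ →ₐ[ℚ] A) ∘ X = g.coord := by
      funext j
      simp
    rw [h2] at h1
    rw [← h1, evalMatrix, Matrix.map_apply]
    exact (coeff_map _ _ _).symm
  refine ⟨s.card, ρ, ⟨fun g h => ?_, fun g h hgh => ?_, fun g i => ?_, fun g i j hij => ?_⟩⟩
  · ext i j
    rw [Matrix.mul_apply, hρ]
    have h1 : (g * h).coord = P.mulCoord g.coord h.coord := rfl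
    rw [h1, ← translate_translate]
    have h2 : P.translate h.coord (monomial (σ j).1 1) =
        ∑ l, coeff (σ l).1 (P.translate h.coord (monomial (σ j).1 1)) •
          monomial (σ l).1 (1 : A) := by
      rw [Equiv.sum_comp σ (fun α : s => coeff α.1 (P.translate h.coord (monomial (σ j).1 1)) •
          monomial α.1 (1 : A)), Finset.sum_coe_sort s (fun α => coeff α
          (P.translate h.coord (monomial (σ j).1 1)) • monomial α (1 : A))]
      ext β
      rw [coeff_sum]
      simp only [coeff_smul, coeff_monomial, smul_eq_mul, mul_ite, mul_one, mul_zero]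
      rw [Finset.sum_ite_eq']
      split_ifs with hβ
      · rfl
      · refine P.coeff_translate_monomial_of_ne _ ?_ ?_
        · rintro rfl
          exact hβ (σ j).2
        · have h3 := (hs' _).1 (σ j).2
          rw [hs'] at hβ
          exact h3.trans (not_le.1 hβ).le
    rw [h2, map_sum, coeff_sum]
    refine Finset.sum_congr rfl fun l _ => ?_
    rw [map_smul, coeff_smul, hρ, hρ, smul_eq_mul, mul_comm]
  · refine Points.ext (funext fun i => ?_)
    have h0 : (0 : Fin d →₀ ℕ) ∈ s := by
      rw [hs', map_zero]
      exact Nat.zero_le _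
    have hi : Finsupp.single i 1 ∈ s := by
      rw [hs', hwt, Finsupp.weight_single, one_smul, hw]
      exact Nat.pow_le_pow_right (by omega) i.2.le
    have h1 := congrFun (congrFun hgh (σ.symm ⟨_, h0⟩)) (σ.symm ⟨_, hi⟩)
    rw [hρ, hρ, Equiv.apply_symm_apply, Equiv.apply_symm_apply] at h1
    rwa [P.coeff_zero_translate_X, P.coeff_zero_translate_X] at h1
  · rw [hρ, coeff_translate_monomial_self]
  · rw [hρ]
    refine P.coeff_translate_monomial_of_ne _ ?_ (hmono j i hij.le)
    intro h
    exact hij.ne (σ.injective (Subtype.ext h)).symm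

end HallPolynomials

/-! ### Strictly upper triangular matrices -/

section StrictUpper

variable (A : Type*) [CommRing A] [Algebra ℚ A] (n : ℕ)

/-- The matrices whose entries vanish below the `m`-th diagonal above the main one. -/
def upperBand (m : ℕ) : Submodule ℚ (Matrix (Fin n) (Fin n) A) where
  carrier := {M | ∀ i j : Fin n, (j : ℕ) < i + m → M i j = 0}
  zero_mem' _ _ _ := rfl
  add_mem' {M M'} hM hM' i j h := by rw [Matrix.add_apply, hM i j h, hM' i j h, add_zero]
  smul_mem' q M hM i j h := by rw [Matrix.smul_apply, hM i j h, smul_zero]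

/-- The strictly upper triangular matrices. -/
abbrev strictUpper : Submodule ℚ (Matrix (Fin n) (Fin n) A) := upperBand A n 1

variable {A n}

theorem mul_mem_upperBand {a b : ℕ} {M M' : Matrix (Fin n) (Fin n) A} (hM : M ∈ upperBand A n a)
    (hM' : M' ∈ upperBand A n b) : M * M' ∈ upperBand A n (a + b) := by
  intro i j hij
  rw [Matrix.mul_apply]
  refine Finset.sum_eq_zero fun l _ => ?_
  rcases lt_or_ge (l : ℕ) (i + a) with h | h
  · rw [hM i l h, zero_mul]
  · rw [hM' l j (by omega), mul_zero]

theorem upperBand_anti {a b : ℕ} (h : a ≤ b) : upperBand A n b ≤ upperBand A n a :=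
  fun _ hM i j hij => hM i j (by omega)

theorem strictUpper_mul_le : strictUpper A n * strictUpper A n ≤ strictUpper A n :=
  Submodule.mul_le.2 fun _ hM _ hM' => upperBand_anti (by omega) (mul_mem_upperBand hM hM')

theorem strictUpper_pow_le (m : ℕ) : strictUpper A n ^ m ≤ upperBand A n m := by
  induction m with
  | zero =>
    rw [pow_zero, Submodule.one_le]
    intro i j hij
    exact Matrix.one_apply_ne fun h => by subst h; omega
  | succ m ih =>
    rw [pow_succ, Submodule.mul_le]
    exact fun M hM M' hM' => mul_mem_upperBand (ih hM) hM'

theorem strictUpper_pow_eq_bot : strictUpper A n ^ n = ⊥ := by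
  rw [eq_bot_iff]
  intro M hM
  refine (Submodule.mem_bot ℚ).2 (Matrix.ext fun i j => ?_)
  exact strictUpper_pow_le n hM i j (by omega)

end StrictUpper

/-! ### Extension of scalars for Lie algebras of rational matrices -/

namespace LieSubalgebra

variable {A : Type*} [CommRing A] [Algebra ℚ A] {n : ℕ}

variable (A) in
/-- The natural map `A ⊗ L → M_n(A)` for a Lie algebra `L` of rational matrices. -/
noncomputable def matrixBaseChange
    (L : LieSubalgebra ℚ (Matrix (Fin n) (Fin n) ℚ)) :
    A ⊗[ℚ] L →ₗ[A] Matrix (Fin n) (Fin n) A :=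
  TensorProduct.AlgebraTensorModule.lift
    { toFun := fun r =>
        { toFun := fun x => r • (x : Matrix (Fin n) (Fin n) ℚ).map (algebraMap ℚ A)
          map_add' := fun x y => by
            ext i j
            simp [mul_add]
          map_smul' := fun q x => by
            ext i j
            change r * algebraMap ℚ A (q * x.1 i j) = q • (r * algebraMap ℚ A (x.1 i j))
            rw [map_mul, Algebra.smul_def, mul_left_comm] }
      map_add' := fun r s => by
        ext x i j
        simp [add_mul]
      map_smul' := fun r s => by
        ext x i j
        simp [mul_assoc] }

theorem matrixBaseChange_tmul
    (L : LieSubalgebra ℚ (Matrix (Fin n) (Fin n) ℚ)) (r : A) (x : L) :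
    L.matrixBaseChange A (r ⊗ₜ x) = r • (x : Matrix (Fin n) (Fin n) ℚ).map (algebraMap ℚ A) := rfl

theorem matrixBaseChange_injective
    (L : LieSubalgebra ℚ (Matrix (Fin n) (Fin n) ℚ)) :
    Function.Injective (L.matrixBaseChange A) := by
  have h1 : Function.Injective (LinearMap.lTensor A (L.toSubmodule.subtype)) :=
    Module.Flat.lTensor_preserves_injective_linearMap _ Subtype.val_injective
  have h2 : ∀ z, L.matrixBaseChange A z =
      (matrixEquivTensor (Fin n) ℚ A).symm (LinearMap.lTensor A (L.toSubmodule.subtype) z) := by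
    intro z
    induction z with
    | zero => rw [map_zero, map_zero, map_zero]
    | add x y hx hy => rw [map_add, map_add, map_add, hx, hy]
    | tmul r x =>
      rw [LinearMap.lTensor_tmul, matrixEquivTensor_apply_symm]
      rfl
  intro z w hzw
  rw [h2, h2] at hzw
  exact h1 ((matrixEquivTensor (Fin n) ℚ A).symm.injective hzw)

theorem matrixBaseChange_lie
    (L : LieSubalgebra ℚ (Matrix (Fin n) (Fin n) ℚ)) (z w : A ⊗[ℚ] L) :
    L.matrixBaseChange A ⁅z, w⁆ = ⁅L.matrixBaseChange A z, L.matrixBaseChange A w⁆ := by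
  induction z with
  | zero => rw [zero_lie, map_zero, zero_lie]
  | add x y hx hy => rw [add_lie, map_add, map_add, hx, hy, add_lie]
  | tmul r x =>
    induction w with
    | zero => rw [lie_zero (L := A ⊗[ℚ] L) (M := A ⊗[ℚ] L), map_zero, lie_zero]
    | add u v hu hv => 
      rw [lie_add (L := A ⊗[ℚ] L) (M := A ⊗[ℚ] L), map_add, map_add, hu, hv, lie_add]
    | tmul s y =>
      rw [LieAlgebra.ExtendScalars.bracket_tmul, matrixBaseChange_tmul,
        matrixBaseChange_tmul, matrixBaseChange_tmul, smul_lie, lie_smul,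
        smul_smul]
      congr 1
      rw [coe_bracket, Ring.lie_def, Ring.lie_def, Matrix.map_sub _ (map_sub _),
        Matrix.map_mul, Matrix.map_mul]

end LieSubalgebra

/-! ### The logarithm of a unipotent representation -/

namespace HallPolynomials

variable {G : Type*} [Group G] {d : ℕ} {B : MalcevBasis G d} {P : HallPolynomials B}
variable {A A' : Type*} [CommRing A] [Algebra ℚ A] [CommRing A'] [Algebra ℚ A']
variable {n : ℕ} {ρ : Matrix (Fin n) (Fin n) (MvPolynomial (Fin d) ℚ)}

/-- Change of the coefficient ring `G^A → G^{A'}`. -/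
def Points.map (f : A →ₐ[ℚ] A') (g : P.Points A) : P.Points A' := ⟨f ∘ g.coord⟩

theorem Points.map_mul (f : A →ₐ[ℚ] A') (g h : P.Points A) :
    (g * h).map f = g.map f * h.map f :=
  Points.ext (P.map_mulCoord f g.coord h.coord)

theorem Points.map_rpow (f : A →ₐ[ℚ] A') (g : P.Points A) (r : A) :
    (g.rpow r).map f = (g.map f).rpow (f r) :=
  Points.ext (P.map_powCoord f g.coord r)

theorem Points.map_injective {f : A →ₐ[ℚ] A'} (hf : Function.Injective f) :
    Function.Injective (Points.map (P := P) f) := fun _ _ hgh =>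
  Points.ext (funext fun i => hf (congrFun (congrArg Points.coord hgh) i))

theorem evalMatrix_map (f : A →ₐ[ℚ] A') (g : P.Points A) :
    evalMatrix ρ (g.map f) = f.mapMatrix (evalMatrix ρ g) := by
  ext i j
  exact (MvPolynomial.comp_aeval_apply g.coord f (ρ i j)).symm

theorem logMap_eq (g : P.Points A) : logMap ρ g = nilLog n (evalMatrix ρ g) := rfl

theorem logMap_map (f : A →ₐ[ℚ] A') (g : P.Points A) :
    logMap ρ (g.map f) = f.mapMatrix (logMap ρ g) := by
  rw [logMap_eq, logMap_eq, evalMatrix_map, map_nilLog]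

theorem map_logMap_rpow_apply (f : A →ₐ[ℚ] A') (g : P.Points A) (r : A)
    (i j : Fin n) : f (logMap ρ (g.rpow r) i j) = logMap ρ ((g.map f).rpow (f r)) i j := by
  rw [← Points.map_rpow, logMap_map]
  rfl

theorem map_smul_logMap_apply (f : A →ₐ[ℚ] A') (g : P.Points A) (r : A)
    (i j : Fin n) : f ((r • logMap ρ g) i j) = (f r • logMap ρ (g.map f)) i j := by
  rw [logMap_map]
  exact map_mul f r (logMap ρ g i j)

theorem logMap_eq_of_exp {g : P.Points A}
    {M : Matrix (Fin n) (Fin n) A} (hM : M ∈ strictUpper A n)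
    (hg : evalMatrix ρ g = IsNilpotent.exp M) : logMap ρ g = M := by
  rw [logMap_eq, hg, nilLog_exp_of_mem strictUpper_pow_eq_bot hM]

theorem isPowerClosed_top : IsPowerClosed (⊤ : Subgroup (P.Points A)) := fun _ _ _ => trivial

namespace IsUnipotentEmbedding

/-- A representation that is unipotent and faithful over `A'` is so over subrings of `A'`. -/
theorem of_injective {f : A →ₐ[ℚ] A'} (hf : Function.Injective f)
    (h : P.IsUnipotentEmbedding A' ρ) : P.IsUnipotentEmbedding A ρ where
  map_mul g g' := by
    have hm : Function.Injective (f.mapMatrix : Matrix (Fin n) (Fin n) A → _) :=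
      fun M M' hM => Matrix.map_injective hf hM
    apply hm
    rw [← evalMatrix_map, Points.map_mul, h.map_mul, evalMatrix_map, evalMatrix_map, _root_.map_mul]
  injective g g' hgg := Points.map_injective hf (h.injective (by
    rw [evalMatrix_map, evalMatrix_map, hgg]))
  diag g i := hf (by
    rw [map_one, ← h.diag (g.map f) i, evalMatrix_map]
    rfl)
  upper g i j hij := hf (by
    rw [map_zero, ← h.upper (g.map f) i j hij, evalMatrix_map]
    rfl)

theorem evalMatrix_sub_one_mem (h : P.IsUnipotentEmbedding A ρ) (g : P.Points A) :
    evalMatrix ρ g - 1 ∈ strictUpper A n := by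
  intro i j hij
  rw [Matrix.sub_apply]
  rcases eq_or_ne i j with rfl | hne
  · rw [h.diag, Matrix.one_apply_eq, sub_self]
  · rw [h.upper g i j (by
      rw [Fin.lt_def]
      have := Fin.val_ne_of_ne hne
      omega), Matrix.one_apply_ne hne, sub_self]

theorem logMap_mem (h : P.IsUnipotentEmbedding A ρ) (g : P.Points A) :
    logMap ρ g ∈ strictUpper A n := by
  rw [logMap_eq]
  exact nilLog_mem (N := strictUpper A n) strictUpper_mul_le n (h.evalMatrix_sub_one_mem g)

theorem exp_logMap (h : P.IsUnipotentEmbedding A ρ) (g : P.Points A) :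
    IsNilpotent.exp (logMap ρ g) = evalMatrix ρ g := by
  rw [logMap_eq]
  exact exp_nilLog_of_mem (N := strictUpper A n) strictUpper_pow_eq_bot (h.evalMatrix_sub_one_mem g)

theorem isNilpotent_logMap (h : P.IsUnipotentEmbedding A ρ) (g : P.Points A) :
    IsNilpotent (logMap ρ g) :=
  isNilpotent_of_mem strictUpper_pow_eq_bot (h.logMap_mem g)

theorem logMap_injective (h : P.IsUnipotentEmbedding A ρ) :
    Function.Injective (logMap ρ : P.Points A → _) := fun _ _ hgg =>
  h.injective (by rw [← h.exp_logMap, hgg, h.exp_logMap])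

theorem evalMatrix_one (h : P.IsUnipotentEmbedding A ρ) : evalMatrix ρ (1 : P.Points A) = 1 := by
  have hu : IsUnit (evalMatrix ρ (1 : P.Points A)) := by
    rw [← h.exp_logMap]
    exact IsNilpotent.isUnit_exp (h.isNilpotent_logMap 1)
  have h1 := h.map_mul 1 1
  rw [mul_one] at h1
  exact (hu.mul_eq_left.1 h1.symm)

theorem logMap_mul (h : P.IsUnipotentEmbedding A ρ) (g g' : P.Points A) :
    logMap ρ (g * g') =
      nilLog n (IsNilpotent.exp (logMap ρ g) * IsNilpotent.exp (logMap ρ g')) := by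
  rw [h.exp_logMap, h.exp_logMap, ← h.map_mul, logMap_eq]

theorem logMap_one (h : P.IsUnipotentEmbedding A ρ) : logMap ρ (1 : P.Points A) = 0 :=
  logMap_eq_of_exp (Submodule.zero_mem _) (by rw [h.evalMatrix_one, IsNilpotent.exp_zero])

theorem evalMatrix_zpow (h : P.IsUnipotentEmbedding A ρ) (g : P.Points A) (m : ℤ) :
    evalMatrix ρ (g ^ m) = IsNilpotent.exp (m • logMap ρ g) := by
  let E : P.Points A →* Matrix (Fin n) (Fin n) A :=
    { toFun := evalMatrix ρ
      map_one' := h.evalMatrix_one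
      map_mul' := h.map_mul }
  have hnil : ∀ m : ℤ, IsNilpotent (m • logMap ρ g) := fun m =>
    
    isNilpotent_of_mem (N := strictUpper A n) strictUpper_pow_eq_bot
      (zsmul_mem (h.logMap_mem g) m)
  let F : Multiplicative ℤ →* Matrix (Fin n) (Fin n) A :=
    { toFun := fun m => IsNilpotent.exp (m.toAdd • logMap ρ g)
      map_one' := by simp
      map_mul' := fun a b => by
        rw [toAdd_mul, add_smul, IsNilpotent.exp_add_of_commute
          (((Commute.refl (logMap ρ g)).smul_left _).smul_right _) (hnil _) (hnil _)] }
  have hEF : E.comp (zpowersHom _ g) = F := by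
    refine MonoidHom.ext_mint ?_
    change evalMatrix ρ (g ^ (1 : ℤ)) = IsNilpotent.exp ((1 : ℤ) • logMap ρ g)
    rw [zpow_one, one_smul, h.exp_logMap]
  exact DFunLike.congr_fun hEF (Multiplicative.ofAdd m)

theorem logMap_zpow (h : P.IsUnipotentEmbedding A ρ) (g : P.Points A) (m : ℤ) :
    logMap ρ (g ^ m) = m • logMap ρ g :=
  logMap_eq_of_exp (zsmul_mem (h.logMap_mem g) m) (h.evalMatrix_zpow g m)

theorem logMap_conj (h : P.IsUnipotentEmbedding A ρ) (g g' : P.Points A) :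
    logMap ρ (g * g' * g⁻¹) =
      IsNilpotent.exp (logMap ρ g) * logMap ρ g' * IsNilpotent.exp (-logMap ρ g) := by
  have h1 : evalMatrix ρ g⁻¹ = IsNilpotent.exp (-logMap ρ g) := by
    have := h.evalMatrix_zpow g (-1)
    rwa [zpow_neg_one, neg_one_zsmul] at this
  have h2 := nilLog_exp_mul_exp_mul_exp_neg (N := strictUpper A n) strictUpper_mul_le
    strictUpper_pow_eq_bot (h.logMap_mem g) (h.logMap_mem g')
  rw [← h2, h.exp_logMap, h.exp_logMap, ← h1, ← h.map_mul, ← h.map_mul, logMap_eq]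

end IsUnipotentEmbedding

/-- The point of `G^ℚ` with given integral coordinates. -/
def intPoint (P : HallPolynomials B) (z : Fin d → ℤ) : P.Points ℚ := ⟨fun j => (z j : ℚ)⟩

/-- `G` maps to `G^ℚ` by `x(z) ↦ x(z)`. -/
theorem exists_hom_intPoint (P : HallPolynomials B) :
    ∃ φ : G →* P.Points ℚ, ∀ z, φ (B.elt z) = P.intPoint z := by
  choose s hs using B.elt_surjective
  have hs' : ∀ z, s (B.elt z) = z := fun z => B.elt_injective (hs _)
  refine ⟨MonoidHom.mk' (fun g => P.intPoint (s g)) fun g h => ?_, fun z => ?_⟩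
  · obtain ⟨c, hc, hc'⟩ := P.elt_mulCoord (s g) (s h)
    rw [hs, hs] at hc
    rw [hc, hs']
    exact Points.ext hc'.symm
  · rw [MonoidHom.mk'_apply, hs']

theorem intPoint_zpow (P : HallPolynomials B) (z : Fin d → ℤ) (m : ℤ) :
    P.intPoint z ^ m = (P.intPoint z).rpow (m : ℚ) := by
  obtain ⟨φ, hφ⟩ := P.exists_hom_intPoint
  obtain ⟨c, hc, hc'⟩ := P.elt_powCoord z m
  rw [← hφ, ← map_zpow, hc, hφ, hφ]
  exact Points.ext hc'.symm

namespace IsUnipotentEmbedding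

/-- The powers `g ^ r` are the exponentials of the multiples of `log g`: this is a polynomial
identity, which holds at integral points. -/
theorem logMap_rpow (h : P.IsUnipotentEmbedding ℚ ρ) (g : P.Points A) (r : A) :
    logMap ρ (g.rpow r) = r • logMap ρ g := by
  let g₀ : P.Points (MvPolynomial (Fin d ⊕ Unit) ℚ) := ⟨fun j => MvPolynomial.X (Sum.inl j)⟩
  let r₀ : MvPolynomial (Fin d ⊕ Unit) ℚ := MvPolynomial.X (Sum.inr ())
  ext i j
  have key := aeval_eq_of_int (A := A) (p := logMap ρ (g₀.rpow r₀) i j)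
    (q := (r₀ • logMap ρ g₀) i j) (fun z => by
      have h3 : g₀.map (MvPolynomial.aeval fun j => (z j : ℚ)) =
          P.intPoint fun j => z (Sum.inl j) :=
        Points.ext (funext fun j => MvPolynomial.aeval_X _ _)
      rw [map_logMap_rpow_apply, map_smul_logMap_apply, h3, MvPolynomial.aeval_X,
        ← P.intPoint_zpow, h.logMap_zpow, Int.cast_smul_eq_zsmul]) (Sum.elim g.coord fun _ => r)
  have h3 : g₀.map (MvPolynomial.aeval (Sum.elim g.coord fun _ => r)) = g :=
    Points.ext (funext fun j => MvPolynomial.aeval_X _ _)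
  rw [map_logMap_rpow_apply, map_smul_logMap_apply, h3, MvPolynomial.aeval_X] at key
  exact key

/-- The logarithms of a power-closed subgroup of `G^A` form a Lie algebra over `A`. -/
noncomputable def logLie (h : P.IsUnipotentEmbedding A ρ) (hQ : P.IsUnipotentEmbedding ℚ ρ)
    (H : Subgroup (P.Points A)) (hH : IsPowerClosed H) :
    LieSubalgebra A (Matrix (Fin n) (Fin n) A) :=
  have hlog : IsLogGroup (strictUpper A n) n (logMap ρ '' (H : Set (P.Points A))) :=
    { subset := by
        rintro _ ⟨g, -, rfl⟩
        exact h.logMap_mem g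
      zero_mem := ⟨1, H.one_mem, h.logMap_one⟩
      smul_mem := by
        rintro q _ ⟨g, hg, rfl⟩
        refine ⟨g.rpow (algebraMap ℚ A q), hH g hg _, ?_⟩
        rw [hQ.logMap_rpow, algebraMap_smul]
      mul_mem := by
        rintro _ ⟨g, hg, rfl⟩ _ ⟨g', hg', rfl⟩
        exact ⟨g * g', H.mul_mem hg hg', h.logMap_mul g g'⟩ }
  { carrier := logMap ρ '' (H : Set (P.Points A))
    zero_mem' := hlog.zero_mem
    add_mem' := hlog.add_mem strictUpper_mul_le strictUpper_pow_eq_bot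
    smul_mem' := by
      rintro r _ ⟨g, hg, rfl⟩
      exact ⟨g.rpow r, hH g hg r, hQ.logMap_rpow g r⟩
    lie_mem' := hlog.lie_mem strictUpper_mul_le strictUpper_pow_eq_bot }

/-- The elements of `G^A` with logarithm in a given Lie algebra. -/
def expSubgroup (h : P.IsUnipotentEmbedding A ρ) (M : LieSubalgebra A (Matrix (Fin n) (Fin n) A))
    (hM : ∀ x ∈ M, x ∈ strictUpper A n) : Subgroup (P.Points A) where
  carrier := {g | logMap ρ g ∈ M}
  one_mem' := by
    change logMap ρ (1 : P.Points A) ∈ M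
    rw [h.logMap_one]
    exact M.zero_mem
  mul_mem' {g g'} hg hg' := by
    change logMap ρ (g * g') ∈ M
    rw [h.logMap_mul]
    exact nilLog_exp_mul_exp_mem (N := strictUpper A n) (M := M.toSubmodule.restrictScalars ℚ)
      strictUpper_mul_le strictUpper_pow_eq_bot hM (fun _ ha _ hb => M.lie_mem ha hb) hg hg'
  inv_mem' {g} hg := by
    change logMap ρ g⁻¹ ∈ M
    have := h.logMap_zpow g (-1)
    rw [zpow_neg_one, neg_one_zsmul] at this
    rw [this]
    exact M.neg_mem hg

theorem isPowerClosed_expSubgroup (h : P.IsUnipotentEmbedding A ρ)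
    (hQ : P.IsUnipotentEmbedding ℚ ρ) (M : LieSubalgebra A (Matrix (Fin n) (Fin n) A))
    (hM : ∀ x ∈ M, x ∈ strictUpper A n) : IsPowerClosed (h.expSubgroup M hM) := by
  intro g hg r
  change logMap ρ (g.rpow r) ∈ M
  rw [hQ.logMap_rpow]
  exact M.smul_mem r hg

end IsUnipotentEmbedding

/-- The monomials occurring in the polynomials `log ρ(x(a))`. -/
noncomputable def logSupport (P : HallPolynomials B)
    (ρ : Matrix (Fin n) (Fin n) (MvPolynomial (Fin d) ℚ)) : Finset (Fin d →₀ ℕ) :=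
  open Classical in
  (Finset.univ : Finset (Fin n × Fin n)).biUnion fun p =>
    (logMap ρ (⟨MvPolynomial.X⟩ : P.Points (MvPolynomial (Fin d) ℚ)) p.1 p.2).support

/-- The matrix coefficient of the monomial `a^α` in `log ρ(x(a))`. -/
noncomputable def logCoeff (P : HallPolynomials B)
    (ρ : Matrix (Fin n) (Fin n) (MvPolynomial (Fin d) ℚ)) (α : Fin d →₀ ℕ) :
    Matrix (Fin n) (Fin n) ℚ := fun i j =>
  (logMap ρ (⟨MvPolynomial.X⟩ : P.Points (MvPolynomial (Fin d) ℚ)) i j).coeff α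

theorem logMap_eq_sum (g : P.Points A) :
    logMap ρ g = ∑ α ∈ P.logSupport ρ,
      (α.prod fun i e => g.coord i ^ e) • (P.logCoeff ρ α).map (algebraMap ℚ A) := by
  classical
  have h1 : (⟨MvPolynomial.X⟩ : P.Points (MvPolynomial (Fin d) ℚ)).map
      (MvPolynomial.aeval g.coord) = g :=
    Points.ext (funext fun j => MvPolynomial.aeval_X _ _)
  ext i j
  conv_lhs => rw [← h1, logMap_map, AlgHom.mapMatrix_apply, Matrix.map_apply,
    MvPolynomial.aeval_def, MvPolynomial.eval₂_eq']
  rw [Matrix.sum_apply]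
  have hsub : (logMap ρ (⟨MvPolynomial.X⟩ : P.Points (MvPolynomial (Fin d) ℚ)) i j).support ⊆
      P.logSupport ρ := by
    intro α hα
    exact Finset.mem_biUnion.2 ⟨(i, j), Finset.mem_univ _, hα⟩
  rw [Finset.sum_subset hsub]
  · refine Finset.sum_congr rfl fun α _ => ?_
    rw [Matrix.smul_apply, Matrix.map_apply, smul_eq_mul, mul_comm, Finsupp.prod_fintype _ _
      fun i => pow_zero _]
    rfl
  · intro α _ hα
    rw [MvPolynomial.notMem_support_iff.1 hα, map_zero, zero_mul]

namespace IsUnipotentEmbedding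

/-- The coefficients of `log ρ(x(a))`, as a polynomial in `a`, are logarithms of elements of
`G^ℚ`, because its values at rational points are. -/
theorem logCoeff_mem (h : P.IsUnipotentEmbedding ℚ ρ) {α : Fin d →₀ ℕ}
    (hα : α ∈ P.logSupport ρ) : P.logCoeff ρ α ∈ h.logLie h ⊤ isPowerClosed_top := by
  refine coeff_mem_of_forall_sum_prod_pow_smul_mem (h.logLie h ⊤ isPowerClosed_top).toSubmodule
    (P.logSupport ρ) (P.logCoeff ρ) (fun a => ?_) hα
  have h1 := logMap_eq_sum (ρ := ρ) (⟨a⟩ : P.Points ℚ)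
  refine ⟨⟨a⟩, Subgroup.mem_top _, h1.trans (Finset.sum_congr rfl fun α _ => ?_)⟩
  congr 1

/-- `log ρ(G^A)` is spanned over `A` by `log ρ(G^ℚ)`. -/
theorem range_matrixBaseChange (h : P.IsUnipotentEmbedding A ρ) (hQ : P.IsUnipotentEmbedding ℚ ρ) :
    LinearMap.range ((hQ.logLie hQ ⊤ isPowerClosed_top).matrixBaseChange A) =
      (h.logLie hQ ⊤ isPowerClosed_top).toSubmodule := by
  apply le_antisymm
  · rintro _ ⟨z, rfl⟩
    induction z with
    | zero => rw [map_zero]; exact Submodule.zero_mem _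
    | add x y hx hy => rw [_root_.map_add]; exact Submodule.add_mem _ hx hy
    | tmul r x =>
      obtain ⟨x, g, -, rfl⟩ := x
      refine Submodule.smul_mem _ r ⟨g.map (Algebra.ofId ℚ A), Subgroup.mem_top _, ?_⟩
      rw [logMap_map]
      rfl
  · rintro _ ⟨g, -, rfl⟩
    rw [logMap_eq_sum]
    refine Submodule.sum_mem _ fun α hα => ⟨_ ⊗ₜ ⟨_, hQ.logCoeff_mem hα⟩, rfl⟩

/-- The natural isomorphism `A ⊗ log ρ(G^ℚ) ≃ log ρ(G^A)`. -/
noncomputable def baseChangeEquiv (h : P.IsUnipotentEmbedding A ρ)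
    (hQ : P.IsUnipotentEmbedding ℚ ρ) :
    (A ⊗[ℚ] hQ.logLie hQ ⊤ isPowerClosed_top) ≃ₗ⁅A⁆ h.logLie hQ ⊤ isPowerClosed_top :=
  { (LinearEquiv.ofInjective _ (LieSubalgebra.matrixBaseChange_injective _)).trans
      (LinearEquiv.ofEq _ _ (h.range_matrixBaseChange hQ)) with
    map_lie' := fun {z w} => Subtype.ext (LieSubalgebra.matrixBaseChange_lie _ z w) }

/-- The bijection `log : G^A → A ⊗ log ρ(G^ℚ)`. -/
noncomputable def logEquiv (h : P.IsUnipotentEmbedding A ρ) (hQ : P.IsUnipotentEmbedding ℚ ρ) :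
    P.Points A ≃ A ⊗[ℚ] hQ.logLie hQ ⊤ isPowerClosed_top :=
  (Equiv.ofBijective (fun g => (⟨logMap ρ g, g, Subgroup.mem_top g, rfl⟩ :
      h.logLie hQ ⊤ isPowerClosed_top))
    ⟨fun _ _ hgg => h.logMap_injective (congrArg Subtype.val hgg), by
      rintro ⟨_, g, -, rfl⟩
      exact ⟨g, rfl⟩⟩).trans (h.baseChangeEquiv hQ).toLinearEquiv.toEquiv.symm

theorem baseChangeEquiv_logEquiv (h : P.IsUnipotentEmbedding A ρ)
    (hQ : P.IsUnipotentEmbedding ℚ ρ) (g : P.Points A) :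
    (h.baseChangeEquiv hQ (h.logEquiv hQ g) : Matrix (Fin n) (Fin n) A) = logMap ρ g :=
  congrArg Subtype.val ((h.baseChangeEquiv hQ).toLinearEquiv.apply_symm_apply
    (⟨logMap ρ g, g, Subgroup.mem_top g, rfl⟩ : h.logLie hQ ⊤ isPowerClosed_top))

end IsUnipotentEmbedding

end HallPolynomials

/-! ### Codimension of Lie subalgebras over the power series ring -/

section Codimension

variable {k : Type*} [Field k]

section FiniteDimensional

variable {Q : Type*} [AddCommGroup Q] [Module k⟦X⟧ Q] [Module k Q] [IsScalarTower k k⟦X⟧ Q]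

/-- A finitely generated `k⟦X⟧`-module killed by a power of `X` is finite-dimensional over `k`. -/
theorem finiteDimensional_of_X_pow_smul_eq_zero [Module.Finite k⟦X⟧ Q] {e : ℕ}
    (h : ∀ q : Q, (PowerSeries.X : k⟦X⟧) ^ e • q = 0) : FiniteDimensional k Q := by
  classical
  obtain ⟨s, hs⟩ := Module.Finite.fg_top (R := k⟦X⟧) (M := Q)
  let W : Submodule k Q := Submodule.span k
    ((((Finset.range e) ×ˢ s).image fun p => (PowerSeries.X : k⟦X⟧) ^ p.1 • p.2 : Finset Q) : Set Q)
  refine Module.finite_def.2 ⟨_, (?_ : W = ⊤)⟩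
  rw [eq_top_iff]
  rintro q -
  have hq : q ∈ Submodule.span k⟦X⟧ (s : Set Q) := by rw [hs]; trivial
  have hmono : ∀ x ∈ s, ∀ m, (PowerSeries.X : k⟦X⟧) ^ m • x ∈ W := by
    intro x hx m
    rcases lt_or_ge m e with hm | hm
    · refine Submodule.subset_span (Finset.mem_coe.2 (Finset.mem_image.2 ⟨(m, x), ?_, rfl⟩))
      exact Finset.mem_product.2 ⟨Finset.mem_range.2 hm, hx⟩
    · obtain ⟨l, rfl⟩ := Nat.exists_eq_add_of_le hm
      rw [pow_add, mul_smul, h]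
      exact W.zero_mem
  have hpoly : ∀ x ∈ s, ∀ p : Polynomial k, (p : k⟦X⟧) • x ∈ W := by
    intro x hx p
    induction p using Polynomial.induction_on' with
    | add p p' hp hp' =>
      rw [Polynomial.coe_add, add_smul]
      exact W.add_mem hp hp'
    | monomial m a =>
      have h1 : ((Polynomial.monomial m a : Polynomial k) : k⟦X⟧) = a • PowerSeries.X ^ m := by
        rw [Polynomial.coe_monomial, PowerSeries.X_pow_eq, ← map_smul, smul_eq_mul, mul_one]
      rw [h1, smul_assoc]
      exact W.smul_mem a (hmono x hx m)
  have hr : ∀ x ∈ s, ∀ r : k⟦X⟧, r • x ∈ W := by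
    intro x hx r
    have h1 : (PowerSeries.X : k⟦X⟧) ^ e ∣ r - (PowerSeries.trunc e r : Polynomial k) := by
      rw [PowerSeries.X_pow_dvd_iff]
      intro m hm
      rw [map_sub, Polynomial.coeff_coe, PowerSeries.coeff_trunc, if_pos hm, sub_self]
    obtain ⟨r', hr'⟩ := h1
    have h2 : r • x = ((PowerSeries.trunc e r : Polynomial k) : k⟦X⟧) • x := by
      rw [← sub_eq_zero, ← sub_smul, hr', mul_smul, h]
    rw [h2]
    exact hpoly x hx _
  have hall : ∀ r : k⟦X⟧, r • q ∈ W := by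
    induction hq using Submodule.span_induction with
    | mem x hx => exact hr x hx
    | zero => simp
    | add x y _ _ hx hy =>
      intro r
      rw [smul_add]
      exact W.add_mem (hx r) (hy r)
    | smul r' x _ hx =>
      intro r
      rw [smul_smul]
      exact hx _
  simpa using hall 1

/-- Every element of a `k⟦X⟧`-module of finite dimension over `k` is killed by a power of `X`. -/
theorem exists_X_pow_smul_eq_zero [FiniteDimensional k Q] (q : Q) :
    ∃ e : ℕ, (PowerSeries.X : k⟦X⟧) ^ e • q = 0 := by
  let f : k⟦X⟧ →ₗ[k] Q :=
    { toFun := fun r => r • q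
      map_add' := fun r r' => add_smul r r' q
      map_smul' := fun a r => smul_assoc a r q }
  let g : Polynomial k →ₗ[k] k⟦X⟧ := (Polynomial.coeToPowerSeries.algHom k).toLinearMap
  have hg : ∀ p, g p = (p : k⟦X⟧) := fun p => by
    simp [g, Polynomial.coeToPowerSeries.algHom_apply]
  obtain ⟨p, hp, hp0⟩ : ∃ p, (f ∘ₗ g) p = 0 ∧ p ≠ 0 := by
    by_contra! hinj
    have := Module.Finite.of_injective (f ∘ₗ g) ((injective_iff_map_eq_zero _).2 hinj)
    exact Polynomial.not_finite this
  have hp1 : (p : k⟦X⟧) ≠ 0 := fun h => hp0 (Polynomial.coe_injective k (by simpa using h))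
  have hp2 : (p : k⟦X⟧) • q = 0 := by
    rw [← hg]
    exact hp
  refine ⟨(p : k⟦X⟧).order.toNat, ?_⟩
  obtain ⟨u, hu⟩ := PowerSeries.isUnit_divided_by_X_pow_order hp1
  rw [← PowerSeries.X_pow_order_mul_divXPowOrder (f := (p : k⟦X⟧)), mul_comm, mul_smul, ← hu] at hp2
  exact (smul_eq_zero_iff_eq u).1 hp2

end FiniteDimensional

section LieChain

variable {T : Type*} [LieRing T] [LieAlgebra k⟦X⟧ T]

/-- There is a strictly decreasing chain of length `m` of Lie subalgebras from `⊤` to `M`. -/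
inductive HasLieChain : LieSubalgebra k⟦X⟧ T → ℕ → Prop
  | top : HasLieChain ⊤ 0
  | step {M M' : LieSubalgebra k⟦X⟧ T} {m : ℕ} (h : M < M') (hM : HasLieChain M' m) :
      HasLieChain M (m + 1)

/-- The subalgebra `M + X^j T`. -/
noncomputable def addXPow (M : LieSubalgebra k⟦X⟧ T) (j : ℕ) : LieSubalgebra k⟦X⟧ T :=
  { M.toSubmodule ⊔ LinearMap.range (LinearMap.lsmul k⟦X⟧ T ((PowerSeries.X : k⟦X⟧) ^ j)) with
    lie_mem' := by
      intro u v hu hv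
      obtain ⟨m, hm, _, ⟨t, rfl⟩, rfl⟩ := Submodule.mem_sup.1 hu
      obtain ⟨m', hm', _, ⟨t', rfl⟩, rfl⟩ := Submodule.mem_sup.1 hv
      refine Submodule.mem_sup.2 ⟨⁅m, m'⁆, M.lie_mem hm hm', _,
        ⟨⁅m, t'⁆ + ⁅t, m' + (PowerSeries.X : k⟦X⟧) ^ j • t'⁆, rfl⟩, ?_⟩
      simp only [LinearMap.lsmul_apply, add_lie, smul_lie, lie_add, lie_smul, smul_add]
      rw [add_assoc, add_left_comm (_ • ⁅m, t'⁆)] }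

theorem mem_addXPow {M : LieSubalgebra k⟦X⟧ T} {j : ℕ} {u : T} :
    u ∈ addXPow M j ↔ ∃ m ∈ M, ∃ t : T, m + (PowerSeries.X : k⟦X⟧) ^ j • t = u := by
  refine Submodule.mem_sup.trans ⟨?_, ?_⟩
  · rintro ⟨m, hm, _, ⟨t, rfl⟩, rfl⟩
    exact ⟨m, hm, t, rfl⟩
  · rintro ⟨m, hm, t, rfl⟩
    exact ⟨m, hm, _, ⟨t, rfl⟩, rfl⟩

theorem le_addXPow (M : LieSubalgebra k⟦X⟧ T) (j : ℕ) : M ≤ addXPow M j :=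
  fun m hm => mem_addXPow.2 ⟨m, hm, 0, by rw [smul_zero, add_zero]⟩

theorem addXPow_succ_le (M : LieSubalgebra k⟦X⟧ T) (j : ℕ) : addXPow M (j + 1) ≤ addXPow M j := by
  intro u hu
  obtain ⟨m, hm, t, rfl⟩ := mem_addXPow.1 hu
  exact mem_addXPow.2 ⟨m, hm, (PowerSeries.X : k⟦X⟧) • t, by rw [smul_smul, ← pow_succ]⟩

variable [Module k T] [IsScalarTower k k⟦X⟧ T]

/-- Comparison of the quotients by two submodules `M < M'`. -/
theorem finrank_quotient_of_le {M M' : Submodule k⟦X⟧ T} (h : M ≤ M')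
    [FiniteDimensional k (T ⧸ M)] :
    FiniteDimensional k (T ⧸ M') ∧
      Module.finrank k (T ⧸ M') +
        Module.finrank k (LinearMap.ker ((Submodule.factor h).restrictScalars k)) =
      Module.finrank k (T ⧸ M) := by
  have hsurj : Function.Surjective ((Submodule.factor h).restrictScalars k) :=
    Submodule.factor_surjective h
  refine ⟨Module.Finite.of_surjective _ hsurj, ?_⟩
  rw [← LinearMap.finrank_range_add_finrank_ker ((Submodule.factor h).restrictScalars k),
    LinearMap.range_eq_top.2 hsurj, finrank_top]

theorem finiteDimensional_quotient_of_le {M M' : Submodule k⟦X⟧ T} (h : M ≤ M')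
    (hM : FiniteDimensional k (T ⧸ M)) : FiniteDimensional k (T ⧸ M') :=
  (finrank_quotient_of_le h).1

theorem finrank_quotient_lt {M M' : Submodule k⟦X⟧ T} (h : M < M')
    [FiniteDimensional k (T ⧸ M)] :
    Module.finrank k (T ⧸ M') < Module.finrank k (T ⧸ M) := by
  obtain ⟨x, hx, hxM⟩ := SetLike.exists_of_lt h
  rw [← (finrank_quotient_of_le h.le).2]
  have : Nontrivial (LinearMap.ker ((Submodule.factor h.le).restrictScalars k)) := by
    refine ⟨⟨⟨Submodule.Quotient.mk x, ?_⟩, 0, ?_⟩⟩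
    · change Submodule.Quotient.mk x = (0 : T ⧸ M')
      exact (Submodule.Quotient.mk_eq_zero _).2 hx
    · intro h0
      exact hxM ((Submodule.Quotient.mk_eq_zero _).1 (congrArg Subtype.val h0))
  have := Module.finrank_pos (R := k)
    (M := LinearMap.ker ((Submodule.factor h.le).restrictScalars k))
  omega

theorem HasLieChain.le_finrank {M : LieSubalgebra k⟦X⟧ T} {m : ℕ} (h : HasLieChain M m)
    (hM : FiniteDimensional k (T ⧸ M.toSubmodule)) :
    m ≤ Module.finrank k (T ⧸ M.toSubmodule) := by
  induction h with
  | top => exact Nat.zero_le _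
  | step h _ ih =>
    have h' : _ < _ := finrank_quotient_lt (T := T) (k := k) (M := LieSubalgebra.toSubmodule _)
      (M' := LieSubalgebra.toSubmodule _) h
    have := ih (finiteDimensional_quotient_of_le h.le hM)
    omega

/-- A proper subalgebra of finite codimension is contained in one whose codimension is one less. -/
theorem exists_finrank_quotient_eq_succ [LieRing.IsNilpotent T] {M : LieSubalgebra k⟦X⟧ T}
    (hM : FiniteDimensional k (T ⧸ M.toSubmodule)) (htop : M ≠ ⊤) :
    ∃ M' : LieSubalgebra k⟦X⟧ T, M < M' ∧
      Module.finrank k (T ⧸ M.toSubmodule) = Module.finrank k (T ⧸ M'.toSubmodule) + 1 := by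
  -- an element outside `M` all of whose brackets lie in `M`
  obtain ⟨x, hxM, hx⟩ : ∃ x ∉ M, ∀ y : T, ⁅y, x⁆ ∈ M := by
    by_contra! hcon
    have h1 : ∀ j, ∃ x ∈ LieModule.lowerCentralSeries k⟦X⟧ T T j, x ∉ M := by
      intro j
      induction j with
      | zero =>
        by_contra! h
        exact htop (eq_top_iff.2 fun x _ => h x (by simp))
      | succ j ih =>
        obtain ⟨x, hx, hxM⟩ := ih
        obtain ⟨y, hy⟩ := hcon x hxM
        refine ⟨⁅y, x⁆, ?_, hy⟩
        rw [LieModule.lowerCentralSeries_succ]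
        exact LieSubmodule.lie_mem_lie (LieSubmodule.mem_top y) hx
    obtain ⟨c, hc⟩ := LieModule.IsNilpotent.nilpotent k⟦X⟧ T T
    obtain ⟨x, hx, hxM⟩ := h1 c
    rw [hc, LieSubmodule.mem_bot] at hx
    exact hxM (hx ▸ M.zero_mem)
  -- after multiplication by a power of `X` its multiple by `X` lies in `M` as well
  obtain ⟨z, hzM, hz, hXz⟩ : ∃ z ∉ M, (∀ y : T, ⁅y, z⁆ ∈ M) ∧ (PowerSeries.X : k⟦X⟧) • z ∈ M := by
    classical
    have hex : ∃ e : ℕ, (PowerSeries.X : k⟦X⟧) ^ e • x ∈ M := by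
      obtain ⟨e, he⟩ := exists_X_pow_smul_eq_zero (k := k)
        (Submodule.Quotient.mk (p := M.toSubmodule) x)
      exact ⟨e, (Submodule.Quotient.mk_eq_zero M.toSubmodule).1 he⟩
    rcases he : Nat.find hex with _ | e
    · have := Nat.find_spec hex
      rw [he, pow_zero, one_smul] at this
      exact absurd this hxM
    · refine ⟨(PowerSeries.X : k⟦X⟧) ^ e • x, Nat.find_min hex (by omega), fun y => ?_, ?_⟩
      · rw [lie_smul]
        exact M.smul_mem _ (hx y)
      · rw [smul_smul, ← pow_succ', ← he]
        exact Nat.find_spec hex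
  have hz' : ∀ y : T, ⁅z, y⁆ ∈ M := fun y => by
    rw [← lie_skew]
    exact M.neg_mem (hz y)
  let M' : LieSubalgebra k⟦X⟧ T :=
    { M.toSubmodule ⊔ Submodule.span k⟦X⟧ {z} with
      lie_mem' := by
        intro u v hu hv
        obtain ⟨m, hm, _, hr, rfl⟩ := Submodule.mem_sup.1 hu
        obtain ⟨r, rfl⟩ := Submodule.mem_span_singleton.1 hr
        obtain ⟨m', hm', _, hr', rfl⟩ := Submodule.mem_sup.1 hv
        obtain ⟨r', rfl⟩ := Submodule.mem_span_singleton.1 hr'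
        refine (le_sup_left : M.toSubmodule ≤ M.toSubmodule ⊔ Submodule.span k⟦X⟧ {z})
          (?_ : _ ∈ M)
        rw [add_lie, smul_lie, lie_add, lie_smul]
        exact M.add_mem (M.add_mem (M.lie_mem hm hm') (M.smul_mem _ (hz m)))
          (M.smul_mem _ (hz' _)) }
  have hle : M.toSubmodule ≤ M'.toSubmodule := le_sup_left
  have hzM' : z ∈ M' := Submodule.mem_sup_right (Submodule.mem_span_singleton_self z)
  refine ⟨M', lt_of_le_of_ne hle fun h => hzM (h ▸ hzM'), ?_⟩
  rw [← (finrank_quotient_of_le hle).2]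
  congr 1
  have hker : LinearMap.ker ((Submodule.factor hle).restrictScalars k) =
      Submodule.span k {Submodule.Quotient.mk (p := M.toSubmodule) z} := by
    apply le_antisymm
    · intro q hq
      obtain ⟨u, rfl⟩ := Submodule.Quotient.mk_surjective _ q
      have hu : u ∈ M' := (Submodule.Quotient.mk_eq_zero M'.toSubmodule).1 hq
      obtain ⟨m, hm, _, hr, rfl⟩ := Submodule.mem_sup.1 hu
      obtain ⟨r, rfl⟩ := Submodule.mem_span_singleton.1 hr
      obtain ⟨r', hr'⟩ : (PowerSeries.X : k⟦X⟧) ∣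
          r - algebraMap k k⟦X⟧ (PowerSeries.constantCoeff r) := by
        rw [PowerSeries.X_dvd_iff, map_sub, sub_eq_zero]
        exact (PowerSeries.constantCoeff_C _).symm
      refine Submodule.mem_span_singleton.2 ⟨PowerSeries.constantCoeff r, ?_⟩
      rw [← Submodule.Quotient.mk_smul, eq_comm, Submodule.Quotient.eq]
      have h1 : r • z - PowerSeries.constantCoeff r • z = r' • (PowerSeries.X : k⟦X⟧) • z := by
        rw [smul_smul, mul_comm, ← hr', sub_smul, algebraMap_smul]
      rw [add_sub_assoc, h1]
      exact M.add_mem hm (M.smul_mem _ hXz)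
    · rw [Submodule.span_singleton_le_iff_mem]
      exact (Submodule.Quotient.mk_eq_zero M'.toSubmodule).2 hzM'
  rw [hker]
  exact finrank_span_singleton fun h => hzM ((Submodule.Quotient.mk_eq_zero _).1 h)

theorem hasLieChain_finrank [LieRing.IsNilpotent T] {M : LieSubalgebra k⟦X⟧ T}
    (hM : FiniteDimensional k (T ⧸ M.toSubmodule)) :
    HasLieChain M (Module.finrank k (T ⧸ M.toSubmodule)) := by
  induction hc : Module.finrank k (T ⧸ M.toSubmodule) generalizing M with
  | zero =>
    by_cases htop : M = ⊤
    · rw [htop]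
      exact HasLieChain.top
    · obtain ⟨M', -, h⟩ := exists_finrank_quotient_eq_succ hM htop
      omega
  | succ c ih =>
    by_cases htop : M = ⊤
    · have := hM
      subst htop
      have : Subsingleton (T ⧸ (⊤ : LieSubalgebra k⟦X⟧ T).toSubmodule) :=
        Submodule.Quotient.subsingleton_iff.2 rfl
      rw [Module.finrank_zero_of_subsingleton] at hc
      omega
    · obtain ⟨M', hlt, h⟩ := exists_finrank_quotient_eq_succ hM htop
      exact HasLieChain.step hlt
        (ih (finiteDimensional_quotient_of_le (M := M.toSubmodule) (M' := M'.toSubmodule)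
          hlt.le hM) (by omega))

theorem finiteDimensional_quotient_of_X_pow_mem [Module.Finite k⟦X⟧ T] {M : LieSubalgebra k⟦X⟧ T}
    {j : ℕ} (h : ∀ t : T, (PowerSeries.X : k⟦X⟧) ^ j • t ∈ M) :
    FiniteDimensional k (T ⧸ M.toSubmodule) := by
  refine finiteDimensional_of_X_pow_smul_eq_zero (e := j) fun q => ?_
  obtain ⟨t, rfl⟩ := Submodule.Quotient.mk_surjective _ q
  exact (Submodule.Quotient.mk_eq_zero M.toSubmodule).2 (h t)

/-- If the subalgebras `M + X^j T` do not decrease strictly, then Nakayama's lemma shows that `M`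
contains some `X^j T`. -/
theorem finiteDimensional_of_addXPow_le [Module.Finite k⟦X⟧ T] {M : LieSubalgebra k⟦X⟧ T} {j : ℕ}
    (h : addXPow M j ≤ addXPow M (j + 1)) : FiniteDimensional k (T ⧸ M.toSubmodule) := by
  refine finiteDimensional_quotient_of_X_pow_mem (j := j) fun t => ?_
  let N : Submodule k⟦X⟧ T := LinearMap.range (LinearMap.lsmul k⟦X⟧ T ((PowerSeries.X : k⟦X⟧) ^ j))
  have hN : N ≤ M.toSubmodule := by
    refine Submodule.le_of_le_smul_of_le_jacobson_bot (I := Ideal.span {PowerSeries.X})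
      ?_ ?_ ?_
    · change (LinearMap.range _).FG
      rw [← Submodule.map_top]
      exact Module.Finite.fg_top.map _
    · rw [IsLocalRing.jacobson_eq_maximalIdeal ⊥ bot_ne_top, Ideal.span_singleton_le_iff_mem,
        IsLocalRing.mem_maximalIdeal]
      exact PowerSeries.X_prime.not_isUnit
    · rintro _ ⟨t, rfl⟩
      obtain ⟨m, hm, t', ht'⟩ := mem_addXPow.1
        (h (mem_addXPow.2 ⟨0, M.zero_mem, t, zero_add _⟩))
      rw [LinearMap.lsmul_apply, ← ht', pow_succ', mul_smul]
      exact Submodule.add_mem_sup hm (Submodule.smul_mem_smul (Ideal.mem_span_singleton_self _)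
        ⟨t', rfl⟩)
  exact hN ⟨t, rfl⟩

/-- In infinite codimension there are arbitrarily long chains, namely the subalgebras
`M + X^j T`. -/
theorem exists_hasLieChain_of_not_finiteDimensional [Module.Finite k⟦X⟧ T]
    {M : LieSubalgebra k⟦X⟧ T} (hM : ¬ FiniteDimensional k (T ⧸ M.toSubmodule)) (j : ℕ) :
    HasLieChain M (j + 1) := by
  have h1 : ∀ j, HasLieChain (addXPow M j) j := by
    intro j
    induction j with
    | zero =>
      have : addXPow M 0 = ⊤ := eq_top_iff.2 fun u _ =>
        mem_addXPow.2 ⟨0, M.zero_mem, u, by rw [pow_zero, one_smul, zero_add]⟩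
      rw [this]
      exact HasLieChain.top
    | succ j ih =>
      exact HasLieChain.step (lt_of_le_not_ge (addXPow_succ_le M j) fun h =>
        hM (finiteDimensional_of_addXPow_le h)) ih
  exact HasLieChain.step (lt_of_le_not_ge (le_addXPow M j) fun h =>
    hM (finiteDimensional_of_addXPow_le (h.trans (le_addXPow M (j + 1))))) (h1 j)

/-- The maximal length of a chain from `⊤` to `M` is the dimension of `T ⧸ M`. -/
theorem isGreatest_hasLieChain_iff [LieRing.IsNilpotent T] [Module.Finite k⟦X⟧ T]
    {M : LieSubalgebra k⟦X⟧ T} {m : ℕ} :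
    IsGreatest {m | HasLieChain M m} m ↔
      FiniteDimensional k (T ⧸ M.toSubmodule) ∧ Module.finrank k (T ⧸ M.toSubmodule) = m := by
  constructor
  · intro h
    have hfin : FiniteDimensional k (T ⧸ M.toSubmodule) := by
      by_contra hcon
      have : m + 1 ≤ m := h.2 (exists_hasLieChain_of_not_finiteDimensional hcon m)
      omega
    exact ⟨hfin, le_antisymm (h.2 (hasLieChain_finrank hfin)) (h.1.le_finrank hfin)⟩
  · rintro ⟨hfin, rfl⟩
    exact ⟨hasLieChain_finrank hfin, fun _ h => h.le_finrank hfin⟩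

end LieChain

end Codimension

/-! ### The correspondence between power-closed subgroups and Lie subalgebras -/

namespace HallPolynomials

variable {G : Type*} [Group G] {d : ℕ} {B : MalcevBasis G d} {P : HallPolynomials B}

theorem HasChain.step {A : Type*} [CommRing A] [Algebra ℚ A] {H K : Subgroup (P.Points A)} {m : ℕ}
    (hK : HasChain K m) (hH : IsPowerClosed H) (hle : H ≤ K) (hidx : H.relIndex K = 0) :
    HasChain H (m + 1) := by
  obtain ⟨c, hc0, hcm, hcp, hcs⟩ := hK
  refine ⟨Fin.snoc (α := fun _ => Subgroup (P.Points A)) c H, ?_, Fin.snoc_last _ _,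
    fun i => ?_, fun i => ?_⟩
  · rw [← Fin.castSucc_zero, Fin.snoc_castSucc, hc0]
  · induction i using Fin.lastCases with
    | last => rwa [Fin.snoc_last]
    | cast i => rw [Fin.snoc_castSucc]; exact hcp i
  · rw [Fin.snoc_castSucc]
    induction i using Fin.lastCases with
    | last => rw [Fin.succ_last, Fin.snoc_last, hcm]; exact ⟨hle, hidx⟩
    | cast i => rw [Fin.succ_castSucc, Fin.snoc_castSucc]; exact hcs i

namespace IsUnipotentEmbedding

variable {A : Type*} [CommRing A] [Algebra ℚ A]
variable {n : ℕ} {ρ : Matrix (Fin n) (Fin n) (MvPolynomial (Fin d) ℚ)}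

/-- A power-closed subgroup that contains a proper power of an element contains the element. -/
theorem mem_of_pow_mem (h : P.IsUnipotentEmbedding A ρ) (hQ : P.IsUnipotentEmbedding ℚ ρ)
    {H : Subgroup (P.Points A)} (hH : IsPowerClosed H) {g : P.Points A} {m : ℕ} (hm : m ≠ 0)
    (hg : g ^ m ∈ H) : g ∈ H := by
  have h1 : (g ^ m).rpow (algebraMap ℚ A (m : ℚ)⁻¹) = g := by
    apply h.logMap_injective
    rw [hQ.logMap_rpow, ← zpow_natCast, h.logMap_zpow, algebraMap_smul, natCast_zsmul,
      ← Nat.cast_smul_eq_nsmul ℚ, smul_smul, inv_mul_cancel₀ (Nat.cast_ne_zero.2 hm), one_smul]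
  rw [← h1]
  exact hH _ hg _

/-- Among power-closed subgroups, proper inclusions have infinite index. -/
theorem relIndex_eq_zero (h : P.IsUnipotentEmbedding A ρ) (hQ : P.IsUnipotentEmbedding ℚ ρ)
    {H K : Subgroup (P.Points A)} (hH : IsPowerClosed H) (hlt : H < K) : H.relIndex K = 0 := by
  by_contra hne
  obtain ⟨g, hgK, hgH⟩ := SetLike.exists_of_lt hlt
  obtain ⟨m, hm, -, hgm⟩ := Subgroup.exists_pow_mem_of_relIndex_ne_zero hne hgK
  exact hgH (h.mem_of_pow_mem hQ hH hm.ne' hgm.1)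

/-- The embedding of `A ⊗ log ρ(G^ℚ)` into the Lie algebra of matrices. -/
noncomputable def toMatrixHom (hQ : P.IsUnipotentEmbedding ℚ ρ) (A : Type*) [CommRing A]
    [Algebra ℚ A] :
    (A ⊗[ℚ] hQ.logLie hQ ⊤ isPowerClosed_top) →ₗ⁅A⁆ Matrix (Fin n) (Fin n) A :=
  { (hQ.logLie hQ ⊤ isPowerClosed_top).matrixBaseChange A with
    map_lie' := fun {z w} => LieSubalgebra.matrixBaseChange_lie _ z w }

theorem toMatrixHom_injective (hQ : P.IsUnipotentEmbedding ℚ ρ) :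
    Function.Injective (hQ.toMatrixHom A) :=
  LieSubalgebra.matrixBaseChange_injective _

theorem toMatrixHom_logEquiv (h : P.IsUnipotentEmbedding A ρ) (hQ : P.IsUnipotentEmbedding ℚ ρ)
    (g : P.Points A) : hQ.toMatrixHom A (h.logEquiv hQ g) = logMap ρ g :=
  h.baseChangeEquiv_logEquiv hQ g

/-- The Lie algebra `log H`, for a power-closed subgroup `H`, inside `A ⊗ log ρ(G^ℚ)`. -/
noncomputable def lieOf (h : P.IsUnipotentEmbedding A ρ) (hQ : P.IsUnipotentEmbedding ℚ ρ)
    (H : Subgroup (P.Points A)) (hH : IsPowerClosed H) :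
    LieSubalgebra A (A ⊗[ℚ] hQ.logLie hQ ⊤ isPowerClosed_top) :=
  (h.logLie hQ H hH).comap (hQ.toMatrixHom A)

theorem mem_lieOf (h : P.IsUnipotentEmbedding A ρ) (hQ : P.IsUnipotentEmbedding ℚ ρ)
    {H : Subgroup (P.Points A)} {hH : IsPowerClosed H} {g : P.Points A} :
    h.logEquiv hQ g ∈ h.lieOf hQ H hH ↔ g ∈ H := by
  change hQ.toMatrixHom A (h.logEquiv hQ g) ∈ h.logLie hQ H hH ↔ g ∈ H
  rw [h.toMatrixHom_logEquiv hQ]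
  constructor
  · rintro ⟨g', hg', hgg⟩
    rwa [← h.logMap_injective hgg]
  · exact fun hg => ⟨g, hg, rfl⟩

theorem coe_lieOf (h : P.IsUnipotentEmbedding A ρ) (hQ : P.IsUnipotentEmbedding ℚ ρ)
    {H : Subgroup (P.Points A)} {hH : IsPowerClosed H} :
    (h.lieOf hQ H hH : Set (A ⊗[ℚ] hQ.logLie hQ ⊤ isPowerClosed_top)) =
      h.logEquiv hQ '' (H : Set (P.Points A)) := by
  ext z
  obtain ⟨g, rfl⟩ := (h.logEquiv hQ).surjective z
  rw [(h.logEquiv hQ).injective.mem_set_image]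
  exact h.mem_lieOf hQ

theorem toMatrixHom_mem (h : P.IsUnipotentEmbedding A ρ) (hQ : P.IsUnipotentEmbedding ℚ ρ)
    (z : A ⊗[ℚ] hQ.logLie hQ ⊤ isPowerClosed_top) : hQ.toMatrixHom A z ∈ strictUpper A n := by
  obtain ⟨g, rfl⟩ := (h.logEquiv hQ).surjective z
  rw [h.toMatrixHom_logEquiv hQ]
  exact h.logMap_mem g

/-- The subgroup `exp M` of `G^A`, for a Lie subalgebra `M` of `A ⊗ log ρ(G^ℚ)`. -/
noncomputable def groupOf (h : P.IsUnipotentEmbedding A ρ) (hQ : P.IsUnipotentEmbedding ℚ ρ)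
    (M : LieSubalgebra A (A ⊗[ℚ] hQ.logLie hQ ⊤ isPowerClosed_top)) : Subgroup (P.Points A) :=
  h.expSubgroup (M.map (hQ.toMatrixHom A)) (by
    rintro _ ⟨z, -, rfl⟩
    exact h.toMatrixHom_mem hQ z)

theorem isPowerClosed_groupOf (h : P.IsUnipotentEmbedding A ρ) (hQ : P.IsUnipotentEmbedding ℚ ρ)
    (M : LieSubalgebra A (A ⊗[ℚ] hQ.logLie hQ ⊤ isPowerClosed_top)) :
    IsPowerClosed (h.groupOf hQ M) :=
  h.isPowerClosed_expSubgroup hQ _ _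

theorem mem_groupOf (h : P.IsUnipotentEmbedding A ρ) (hQ : P.IsUnipotentEmbedding ℚ ρ)
    {M : LieSubalgebra A (A ⊗[ℚ] hQ.logLie hQ ⊤ isPowerClosed_top)} {g : P.Points A} :
    g ∈ h.groupOf hQ M ↔ h.logEquiv hQ g ∈ M := by
  change logMap ρ g ∈ M.map (hQ.toMatrixHom A) ↔ _
  rw [← h.toMatrixHom_logEquiv hQ]
  constructor
  · rintro ⟨z, hz, hzg⟩
    rwa [← hQ.toMatrixHom_injective hzg]
  · exact fun hg => ⟨_, hg, rfl⟩

theorem groupOf_lieOf (h : P.IsUnipotentEmbedding A ρ) (hQ : P.IsUnipotentEmbedding ℚ ρ)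
    (H : Subgroup (P.Points A)) (hH : IsPowerClosed H) : h.groupOf hQ (h.lieOf hQ H hH) = H :=
  Subgroup.ext fun _ => (h.mem_groupOf hQ).trans (h.mem_lieOf hQ)

theorem lieOf_groupOf (h : P.IsUnipotentEmbedding A ρ) (hQ : P.IsUnipotentEmbedding ℚ ρ)
    (M : LieSubalgebra A (A ⊗[ℚ] hQ.logLie hQ ⊤ isPowerClosed_top)) :
    h.lieOf hQ (h.groupOf hQ M) (h.isPowerClosed_groupOf hQ M) = M := by
  ext z
  obtain ⟨g, rfl⟩ := (h.logEquiv hQ).surjective z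
  exact (h.mem_lieOf hQ).trans (h.mem_groupOf hQ)

theorem groupOf_lt_groupOf (h : P.IsUnipotentEmbedding A ρ) (hQ : P.IsUnipotentEmbedding ℚ ρ)
    {M M' : LieSubalgebra A (A ⊗[ℚ] hQ.logLie hQ ⊤ isPowerClosed_top)} (hlt : M < M') :
    h.groupOf hQ M < h.groupOf hQ M' := by
  refine lt_of_le_of_ne (fun g hg => (h.mem_groupOf hQ).2 (hlt.le ((h.mem_groupOf hQ).1 hg)))
    fun heq => hlt.ne ?_
  rw [← h.lieOf_groupOf hQ M, ← h.lieOf_groupOf hQ M']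
  congr 1

theorem lieOf_lt_lieOf (h : P.IsUnipotentEmbedding A ρ) (hQ : P.IsUnipotentEmbedding ℚ ρ)
    {H K : Subgroup (P.Points A)} (hH : IsPowerClosed H) (hK : IsPowerClosed K) (hlt : H < K) :
    h.lieOf hQ H hH < h.lieOf hQ K hK := by
  obtain ⟨g, hgK, hgH⟩ := SetLike.exists_of_lt hlt
  refine SetLike.lt_iff_le_and_exists.2 ⟨fun z hz => ?_, h.logEquiv hQ g, (h.mem_lieOf hQ).2 hgK,
    fun hg => hgH ((h.mem_lieOf hQ).1 hg)⟩
  obtain ⟨g, rfl⟩ := (h.logEquiv hQ).surjective z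
  exact (h.mem_lieOf hQ).2 (hlt.le ((h.mem_lieOf hQ).1 hz))

/-- `H` is normal if and only if `log H` is an ideal: conjugation is the exponential of the
adjoint action. -/
theorem normal_iff (h : P.IsUnipotentEmbedding A ρ) (hQ : P.IsUnipotentEmbedding ℚ ρ)
    {H : Subgroup (P.Points A)} (hH : IsPowerClosed H) :
    H.Normal ↔ ∀ x y : A ⊗[ℚ] hQ.logLie hQ ⊤ isPowerClosed_top,
      y ∈ h.lieOf hQ H hH → ⁅x, y⁆ ∈ h.lieOf hQ H hH := by
  have hmem : ∀ z, z ∈ h.lieOf hQ H hH ↔ hQ.toMatrixHom A z ∈ h.logLie hQ H hH := fun z => Iff.rfl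
  have hn : strictUpper A n ^ n = ⊥ := strictUpper_pow_eq_bot
  constructor
  · intro hnormal x y hy
    obtain ⟨g, rfl⟩ := (h.logEquiv hQ).surjective x
    obtain ⟨g', rfl⟩ := (h.logEquiv hQ).surjective y
    have hg' := (h.mem_lieOf hQ).1 hy
    rw [hmem, LieHom.map_lie, h.toMatrixHom_logEquiv, h.toMatrixHom_logEquiv]
    refine lie_mem_of_forall_conj_mem (V := (h.logLie hQ H hH).toSubmodule.restrictScalars ℚ) hn
      (h.logMap_mem g) (h.logMap_mem g') fun q => ?_
    have h1 : q • logMap ρ g = logMap ρ (g.rpow (algebraMap ℚ A q)) := by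
      rw [hQ.logMap_rpow, algebraMap_smul]
    rw [h1, ← h.logMap_conj]
    exact ⟨_, hnormal.conj_mem g' hg' _, rfl⟩
  · intro hideal
    refine ⟨fun g' hg' g => ?_⟩
    rw [← h.mem_lieOf hQ (hH := hH), hmem, h.toMatrixHom_logEquiv, h.logMap_conj,
      exp_mul_mul_exp_neg hn (h.logMap_mem g) (h.logMap_mem g')]
    have had : ∀ i, ∃ y ∈ h.lieOf hQ H hH,
        hQ.toMatrixHom A y = adIter (logMap ρ g) i (logMap ρ g') := by
      intro i
      induction i with
      | zero => exact ⟨_, (h.mem_lieOf hQ).2 hg', h.toMatrixHom_logEquiv hQ g'⟩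
      | succ i ih =>
        obtain ⟨y, hy, hyi⟩ := ih
        refine ⟨⁅h.logEquiv hQ g, y⁆, hideal _ _ hy, ?_⟩
        rw [LieHom.map_lie, hyi, h.toMatrixHom_logEquiv, adIter_succ]
    refine Submodule.sum_mem ((h.logLie hQ H hH).toSubmodule.restrictScalars ℚ) fun i _ =>
      Submodule.smul_mem _ _ ?_
    obtain ⟨y, hy, hyi⟩ := had i
    rw [← hyi]
    exact hy

theorem isNilpotent_baseChange (h : P.IsUnipotentEmbedding A ρ) (hQ : P.IsUnipotentEmbedding ℚ ρ) :
    LieRing.IsNilpotent (A ⊗[ℚ] hQ.logLie hQ ⊤ isPowerClosed_top) := by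
  have h1 : ∀ j, ∀ z ∈ LieModule.lowerCentralSeries A
      (A ⊗[ℚ] hQ.logLie hQ ⊤ isPowerClosed_top) (A ⊗[ℚ] hQ.logLie hQ ⊤ isPowerClosed_top) j,
      hQ.toMatrixHom A z ∈ upperBand A n (j + 1) := by
    intro j
    induction j with
    | zero => exact fun z _ => h.toMatrixHom_mem hQ z
    | succ j ih =>
      intro z hz
      rw [LieModule.lowerCentralSeries_succ, ← LieSubmodule.mem_toSubmodule,
        LieSubmodule.lieIdeal_oper_eq_linear_span'] at hz
      induction hz using Submodule.span_induction with
      | zero => rw [map_zero]; exact Submodule.zero_mem _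
      | add x y _ _ hx hy => rw [_root_.map_add]; exact Submodule.add_mem _ hx hy
      | smul r x _ hx =>
        intro i j hij
        rw [map_smul, Matrix.smul_apply, hx i j hij, smul_zero]
      | mem x hx =>
        obtain ⟨u, -, v, hv, rfl⟩ := hx
        have hu := h.toMatrixHom_mem hQ u
        have hv := ih v hv
        rw [LieHom.map_lie, Ring.lie_def]
        refine Submodule.sub_mem _ (upperBand_anti ?_ (mul_mem_upperBand hu hv))
          (upperBand_anti ?_ (mul_mem_upperBand hv hu)) <;> omega
  refine (LieModule.isNilpotent_iff A _ _).2 ⟨n, eq_bot_iff.2 fun z hz => ?_⟩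
  refine hQ.toMatrixHom_injective ?_
  rw [map_zero]
  ext i j
  exact h1 n z hz i j (by omega)

end IsUnipotentEmbedding

section PowerSeries

variable {k : Type*} [Field k] [CharZero k]
variable {n : ℕ} {ρ : Matrix (Fin n) (Fin n) (MvPolynomial (Fin d) ℚ)}

namespace IsUnipotentEmbedding

/-- Chains of power-closed subgroups correspond to chains of Lie subalgebras. -/
theorem hasChain_iff (h : P.IsUnipotentEmbedding k⟦X⟧ ρ) (hQ : P.IsUnipotentEmbedding ℚ ρ)
    {H : Subgroup (P.Points k⟦X⟧)} (hH : IsPowerClosed H) {m : ℕ} :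
    HasChain H m ↔ HasLieChain (h.lieOf hQ H hH) m := by
  constructor
  · rintro ⟨c, hc0, hcm, hcp, hcs⟩
    have h1 : ∀ i : Fin (m + 1), HasLieChain (h.lieOf hQ (c i) (hcp i)) i := by
      intro i
      induction i using Fin.induction with
      | zero =>
        have : h.lieOf hQ (c 0) (hcp 0) = ⊤ := by
          rw [eq_top_iff]
          intro z _
          obtain ⟨g, rfl⟩ := (h.logEquiv hQ).surjective z
          rw [h.mem_lieOf hQ, hc0]
          trivial
        rw [this]
        exact HasLieChain.top
      | succ i ih =>
        refine HasLieChain.step (h.lieOf_lt_lieOf hQ _ _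
          (lt_of_le_of_ne (hcs i).1 fun heq => ?_)) ih
        have := (hcs i).2
        rw [heq, Subgroup.relIndex_self] at this
        exact one_ne_zero this
    have h2 := h1 (Fin.last m)
    subst hcm
    exact h2
  · intro hc
    have h1 : ∀ (M : LieSubalgebra k⟦X⟧ (k⟦X⟧ ⊗[ℚ] hQ.logLie hQ ⊤ isPowerClosed_top)) (m : ℕ),
        HasLieChain M m → HasChain (h.groupOf hQ M) m := by
      intro M m hM
      induction hM with
      | top =>
        have : h.groupOf hQ ⊤ = ⊤ := eq_top_iff.2 fun g _ => (h.mem_groupOf hQ).2 trivial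
        rw [this]
        exact ⟨fun _ => ⊤, rfl, rfl, fun _ => isPowerClosed_top, fun i => i.elim0⟩
      | step hlt _ ih =>
        have hlt' := h.groupOf_lt_groupOf hQ hlt
        exact ih.step (h.isPowerClosed_groupOf hQ _) hlt'.le
          (h.relIndex_eq_zero hQ (h.isPowerClosed_groupOf hQ _) hlt')
    rw [← h.groupOf_lieOf hQ H hH]
    exact h1 _ _ hc

theorem hasCodim_iff (h : P.IsUnipotentEmbedding k⟦X⟧ ρ) (hQ : P.IsUnipotentEmbedding ℚ ρ)
    {H : Subgroup (P.Points k⟦X⟧)} (hH : IsPowerClosed H) {m : ℕ} :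
    HasCodim H m ↔
      FiniteDimensional k ((k⟦X⟧ ⊗[ℚ] hQ.logLie hQ ⊤ isPowerClosed_top) ⧸
        (h.lieOf hQ H hH).toSubmodule) ∧
      Module.finrank k ((k⟦X⟧ ⊗[ℚ] hQ.logLie hQ ⊤ isPowerClosed_top) ⧸
        (h.lieOf hQ H hH).toSubmodule) = m := by
  have := h.isNilpotent_baseChange hQ
  have : Module.Finite ℚ (hQ.logLie hQ ⊤ isPowerClosed_top) :=
    FiniteDimensional.finiteDimensional_submodule (hQ.logLie hQ ⊤ isPowerClosed_top).toSubmodule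
  rw [← isGreatest_hasLieChain_iff, HasCodim]
  simp only [h.hasChain_iff hQ hH]

/-- The correspondence between power-closed subgroups and Lie subalgebras of finite codimension,
with underlying map `H ↦ log H` and inverse `M ↦ exp M`. -/
noncomputable def correspondence (h : P.IsUnipotentEmbedding k⟦X⟧ ρ)
    (hQ : P.IsUnipotentEmbedding ℚ ρ) :
    {H : Subgroup (P.Points k⟦X⟧) // IsPowerClosed H ∧ ∃ m, HasCodim H m} ≃
      {M : LieSubalgebra k⟦X⟧ (k⟦X⟧ ⊗[ℚ] hQ.logLie hQ ⊤ isPowerClosed_top) //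
        FiniteDimensional k ((k⟦X⟧ ⊗[ℚ] hQ.logLie hQ ⊤ isPowerClosed_top) ⧸ M.toSubmodule)} where
  toFun H := ⟨h.lieOf hQ H.1 H.2.1, by
    obtain ⟨m, hm⟩ := H.2.2
    exact ((h.hasCodim_iff hQ H.2.1).1 hm).1⟩
  invFun M := ⟨h.groupOf hQ M.1, h.isPowerClosed_groupOf hQ M.1, _,
    (h.hasCodim_iff hQ (h.isPowerClosed_groupOf hQ M.1)).2 ⟨by
      rw [h.lieOf_groupOf hQ M.1]
      exact M.2, rfl⟩⟩
  left_inv H := Subtype.ext (h.groupOf_lieOf hQ H.1 H.2.1)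
  right_inv M := Subtype.ext (h.lieOf_groupOf hQ M.1)

end IsUnipotentEmbedding

end PowerSeries

end HallPolynomials

theorem mainTheorem9 {k : Type*} [Field k] [CharZero k]
    {G : Type*} [Group G] [Group.FG G] [Group.IsNilpotent G]
    (htf : ∀ g : G, IsOfFinOrder g → g = 1) :
    (∃ d : ℕ, Nonempty (MalcevBasis G d)) ∧
    ∀ (d : ℕ) (B : MalcevBasis G d),
      Nonempty (HallPolynomials B) ∧
      ∀ P : HallPolynomials B,
        (∃ (n : ℕ) (ρ : Matrix (Fin n) (Fin n) (MvPolynomial (Fin d) ℚ)),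
          P.IsUnipotentEmbedding k⟦X⟧ ρ) ∧
        ∀ (n : ℕ) (ρ : Matrix (Fin n) (Fin n) (MvPolynomial (Fin d) ℚ)),
          P.IsUnipotentEmbedding k⟦X⟧ ρ →
          -- the Lie algebras `L_ℚ = log G^ℚ` and `𝓛 = log G^{k[[t]]}`
          ∃ (LQ : LieSubalgebra ℚ (Matrix (Fin n) (Fin n) ℚ))
            (L : LieSubalgebra k⟦X⟧ (Matrix (Fin n) (Fin n) k⟦X⟧)),
            (LQ : Set (Matrix (Fin n) (Fin n) ℚ)) =
              Set.range (fun g : P.Points ℚ => HallPolynomials.logMap ρ g) ∧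
            (L : Set (Matrix (Fin n) (Fin n) k⟦X⟧)) =
              Set.range (fun g : P.Points k⟦X⟧ => HallPolynomials.logMap ρ g) ∧
            -- the natural isomorphism `k[[t]] ⊗ L_ℚ ≃ 𝓛`, and `log` as a map to `k[[t]] ⊗ L_ℚ`
            ∃ (e : (k⟦X⟧ ⊗[ℚ] LQ) ≃ₗ⁅k⟦X⟧⁆ L) (logG : P.Points k⟦X⟧ ≃ k⟦X⟧ ⊗[ℚ] LQ),
              (∀ (r : k⟦X⟧) (x : LQ), (e (r ⊗ₜ[ℚ] x) : Matrix (Fin n) (Fin n) k⟦X⟧) =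
                r • (x : Matrix (Fin n) (Fin n) ℚ).map (algebraMap ℚ k⟦X⟧)) ∧
              (∀ g : P.Points k⟦X⟧, (e (logG g) : Matrix (Fin n) (Fin n) k⟦X⟧) =
                HallPolynomials.logMap ρ g) ∧
              -- the correspondence
              ∃ Φ : {H : Subgroup (P.Points k⟦X⟧) //
                      HallPolynomials.IsPowerClosed H ∧ ∃ m, HallPolynomials.HasCodim H m} ≃
                    {M : LieSubalgebra k⟦X⟧ (k⟦X⟧ ⊗[ℚ] LQ) //
                      FiniteDimensional k ((k⟦X⟧ ⊗[ℚ] LQ) ⧸ M.toSubmodule)},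
                (∀ H, ((Φ H).1 : Set (k⟦X⟧ ⊗[ℚ] LQ)) =
                  logG '' (H.1 : Set (P.Points k⟦X⟧))) ∧
                (∀ H m, HallPolynomials.HasCodim H.1 m ↔
                  Module.finrank k ((k⟦X⟧ ⊗[ℚ] LQ) ⧸ (Φ H).1.toSubmodule) = m) ∧
                (∀ H, H.1.Normal ↔
                  ∀ x y : k⟦X⟧ ⊗[ℚ] LQ, y ∈ (Φ H).1 → ⁅x, y⁆ ∈ (Φ H).1) := by
  refine ⟨exists_malcevBasis htf, fun d B => ⟨nonempty_hallPolynomials B, fun P =>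
    ⟨P.exists_isUnipotentEmbedding k⟦X⟧, fun n ρ h => ?_⟩⟩⟩
  have hQ : P.IsUnipotentEmbedding ℚ ρ :=
    h.of_injective (f := Algebra.ofId ℚ k⟦X⟧) (algebraMap ℚ k⟦X⟧).injective
  refine ⟨hQ.logLie hQ ⊤ HallPolynomials.isPowerClosed_top,
    h.logLie hQ ⊤ HallPolynomials.isPowerClosed_top,
    Set.image_univ, Set.image_univ, h.baseChangeEquiv hQ, h.logEquiv hQ,
    fun r x => rfl, h.baseChangeEquiv_logEquiv hQ, h.correspondence hQ, fun H => h.coe_lieOf hQ,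
    fun H m => (h.hasCodim_iff hQ H.2.1).trans (and_iff_right (h.correspondence hQ H).2),
    fun H => h.normal_iff hQ H.2.1⟩
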